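/- Let $k\ge 0$ be an integer, $N\ge1$, and $p$ a prime. The paramodular group $K(N)\subset \mathrm{Sp}_2(\mathbb Q)$ (degree $2$, i.e. $4\times4$ matrices, for $J=\begin{pmatrix}0&-1\\1&0\end{pmatrix}$) is the stabilizer of the column lattice $\mathbb Z\oplus\mathbb Z\oplus\mathbb Z\oplus N\mathbb Z$. Let $\mathcal H_2$ be the Siegel upper half space of degree $2$. For $g=\begin{pmatrix}A&B\\C&D\end{pmatrix}$ with $g'Jg=m(g)J$, $m(g)>0$, put $(f|_kg)(\Omega)=m(g)^{2k-3}\det(C\Omega+D)^{-k}f((A\Omega+B)(C\Omega+D)^{-1})$. Let $S_k(K(N))$ be the space of holomorphic $f:\mathcal H_2\to\mathbb C$ with $f|_kg=f$ for all $g\in K(N)$ and $\lim_{\lambda\to+\infty}(f|_kg)\left(\begin{smallmatrix}\tau&0\\0&i\lambda\end{smallmatrix}\right)=0$ for all $g\in\mathrm{Sp}_2(\mathbb Q)$ and all $\tau$ in the upper half plane. Every such $f$ has a unique Fourier expansion $f(\Omega)=\sum_t a(t;f)e^{2\pi i\,\mathrm{tr}(t\Omega)}$ over the matrices $t=\begin{pmatrix}n&r/2\\r/2&mN\end{pmatrix}$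 with $n,m\in\mathbb Z_{\ge0}$, $r\in\mathbb Z$, $4nmN-r^2\ge0$; put $a(t;f)=0$ for all other $t$. For a diagonal matrix $\delta$ let $f|T=\sum_g f|_kg$ over representatives $g$ of $K(N)\backslash K(N)\delta K(N)$, where $\delta=\mathrm{diag}(1,1,p,p)$ for $T=T(p)$, $\delta=\mathrm{diag}(1,p,p^2,p)$ for $T=T_1(p^2)$, and $\delta=\mathrm{diag}(p,p^2,p,1)$ for $T=T_0(p^2)$. (i) Let $k\ge3$, and let $T$ be $T(p)$ or $T_1(p^2)$ if $p\nmid N$, and $T(p)$ or $T_0(p^2)$ if $p\,\|\,N$. Then for every $f\in S_k(K(N))$ also $f|T\in S_k(K(N))$, and the Fourier coefficients of $f|T$ are fixed finite $\mathbb Z$-linear combinations, independent of $f$, of the Fourier coefficients of $f$. (ii) Let $p\,\|\,N$ and $k\ge0$, and let $M,a,c\in\mathbb Z$ satisfy $M\cdot N/p\equiv1\bmod p$ and $ap-cN/p=1$. Write $t[u]=u'tu$, and let $\chi_p(x)=p-1$ if $x\in p\mathbb Z$ and $\chi_p(x)=-1$ otherwise. Then for all $f\in S_k(K(N))$, also $f|T(p),f|T_0(p^2)\in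 S_k(K(N))$, and for all $t=\begin{pmatrix}n&r/2\\r/2&mN\end{pmatrix}$ as above with $4nmN-r^2>0$, with $x,y$ running over $0,\dots,p-1$, $$\begin{aligned}a(t;f|T(p))&=a(pt;f)+p^{k-2}\sum_{x}a\!\left(\tfrac1p t\left[\begin{smallmatrix}1&0\\-x&p\end{smallmatrix}\right];f\right)+p^{k-2}\sum_{y}a\!\left(\tfrac1p t\left[\begin{smallmatrix}p&NMy\\0&1\end{smallmatrix}\right];f\right)\\&\quad+p^{2k-3}a\!\left(\tfrac1pt;f\right)+p^{k-3}\chi_p(2t_{12})\,a\!\left(\tfrac1p t\left[\begin{smallmatrix}ap&N\\c&p\end{smallmatrix}\right];f\right),\end{aligned}$$ $$\begin{aligned}a(t;f|T_0(p^2))&=p^{k-3}\sum_{x}a\!\left(t\left[\begin{smallmatrix}1&0\\-x&p\end{smallmatrix}\right];f\right)+p^{3k-6}\sum_{y}a\!\left(t\left[\begin{smallmatrix}1&NMy/p\\0&1/p\end{smallmatrix}\right];f\right)\\&\quad+p^{2k-6}\sum_{y}\chi_p\!\left(2t_{12}(1+2cN/p+2cy)+2t_{22}c/p\right)a\!\left(t\left[\begin{smallmatrix}(cN+p+cNMy)/p&N+NMy\\c/p&1\end{smallmatrix}\right];f\right)\\&\quad+p^{2k-6}\sum_{x,y}\chi_p\!\left(2t_{12}My+t_{22}/N\right)a\!\left(t\left[\begin{smallmatrix}1+NMxy/p&NMy\\x/p&1\end{smallmatrix}\right];f\right).\end{aligned}$$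 -/

import Mathlib

open Matrix Filter Topology

noncomputable section

namespace Paramodular

/-- `4 × 4` rational matrices, written in `2 × 2` blocks. -/
abbrev Mat4 : Type := Matrix (Fin 2 ⊕ Fin 2) (Fin 2 ⊕ Fin 2) ℚ

/-- `2 × 2` rational matrices (indices of Fourier coefficients). -/
abbrev Mat2 : Type := Matrix (Fin 2) (Fin 2) ℚ

/-! ### The paramodular group -/

/-- The lattice `ℤ ⊕ ℤ ⊕ ℤ ⊕ Nℤ` of column vectors. -/
def lattice (N : ℕ) : Set (Fin 2 ⊕ Fin 2 → ℚ) :=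
  {v | ∃ a b c d : ℤ, v = Sum.elim ![(a : ℚ), b] ![(c : ℚ), N * d]}

/-- The paramodular group `K(N)`: the rational symplectic matrices `g` that stabilize the lattice
`L = ℤ ⊕ ℤ ⊕ ℤ ⊕ Nℤ`. As `g` is invertible, `g L = L` says that `g v ∈ L ↔ v ∈ L` for all `v`. -/
def paramodularGroup (N : ℕ) : Subgroup (symplecticGroup (Fin 2) ℚ) where
  carrier := {g | ∀ v, (g : Mat4) *ᵥ v ∈ lattice N ↔ v ∈ lattice N}
  mul_mem' := by
    intro a b ha hb v
    have h : ((a * b : symplecticGroup (Fin 2) ℚ) : Mat4) *ᵥ v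
        = (a : Mat4) *ᵥ ((b : Mat4) *ᵥ v) := by
      rw [Matrix.mulVec_mulVec]; rfl
    rw [h, ha, hb]
  one_mem' := by
    intro v
    have h : ((1 : symplecticGroup (Fin 2) ℚ) : Mat4) *ᵥ v = v := by
      rw [show ((1 : symplecticGroup (Fin 2) ℚ) : Mat4) = 1 from rfl, Matrix.one_mulVec]
    rw [h]
  inv_mem' := by
    intro a ha v
    have h : (a : Mat4) *ᵥ (((a⁻¹ : symplecticGroup (Fin 2) ℚ) : Mat4) *ᵥ v) = v := by
      rw [Matrix.mulVec_mulVec,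
        show (a : Mat4) * ((a⁻¹ : symplecticGroup (Fin 2) ℚ) : Mat4)
          = ((a * a⁻¹ : symplecticGroup (Fin 2) ℚ) : Mat4) from rfl,
        mul_inv_cancel, show ((1 : symplecticGroup (Fin 2) ℚ) : Mat4) = 1 from rfl,
        Matrix.one_mulVec]
    rw [← ha, h]

/-! ### The Siegel upper half space and the slash operator -/

/-- The Siegel upper half space: symmetric complex `2 × 2` matrices with positive definite
imaginary part. -/
def siegelSet : Set (Matrix (Fin 2) (Fin 2) ℂ) :=
  {Z | Z.IsSymm ∧ (Z.map Complex.im).PosDef}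

/-- The Siegel upper half space as a type. -/
abbrev Siegel : Type := siegelSet

open Classical in
/-- Extension by zero of a function on the Siegel upper half space to all matrices. -/
def extend (f : Siegel → ℂ) (Z : Matrix (Fin 2) (Fin 2) ℂ) : ℂ :=
  if h : Z ∈ siegelSet then f ⟨Z, h⟩ else 0

/-- The multiplier `m(g)` of a similitude, `gᵀ J g = m(g) J`, read off from the entry at which
`J = [0, -1; 1, 0]` is `1`. -/
def multiplier (g : Mat4) : ℚ :=
  (gᵀ * Matrix.J (Fin 2) ℚ * g) (Sum.inr 0) (Sum.inl 0)

/-- The weight `k` slash operator in the arithmetic normalization,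
`(f | g)(Ω) = m(g) ^ (2k - 3) det(cΩ + d) ^ (-k) f((aΩ + b)(cΩ + d)⁻¹)` for `g = [a, b; c, d]`.
It is only used for similitudes `g` with `m(g) > 0`; these map the Siegel upper half space to
itself, so that the extension by zero plays no role. -/
def slash (k : ℤ) (f : Siegel → ℂ) (g : Mat4) : Siegel → ℂ := fun Ω =>
  let h : Matrix (Fin 2 ⊕ Fin 2) (Fin 2 ⊕ Fin 2) ℂ := g.map (fun x : ℚ => (x : ℂ))
  let den := h.toBlocks₂₁ * Ω.1 + h.toBlocks₂₂
  (multiplier g : ℂ) ^ (2 * k - 3) * den.det ^ (-k) *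
    extend f ((h.toBlocks₁₁ * Ω.1 + h.toBlocks₁₂) * den⁻¹)

/-! ### Paramodular forms and cusp forms -/

/-- The matrix `Ω = [τ, z; z, ω]`. -/
def coordMatrix (w : ℂ × ℂ × ℂ) : Matrix (Fin 2) (Fin 2) ℂ :=
  !![w.1, w.2.1; w.2.1, w.2.2]

/-- Paramodular forms of weight `k` and level `N`: holomorphic functions (in the three coordinates
`τ, z, ω`) on the Siegel upper half space, invariant under the slash action of `K(N)`. -/
structure IsParamodularForm (k : ℤ) (N : ℕ) (f : Siegel → ℂ) : Prop where
  holomorphic : DifferentiableOn ℂ (fun w => extend f (coordMatrix w))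
    {w | coordMatrix w ∈ siegelSet}
  invariant : ∀ g ∈ paramodularGroup N, slash k f (g : Mat4) = f

/-- Paramodular cusp forms: paramodular forms `f` such that `Φ(f | g) = 0` for all rational
symplectic `g`, where `(Φ F)(τ) = lim F([τ, 0; 0, iy])` as `y → +∞`. -/
structure IsCuspForm (k : ℤ) (N : ℕ) (f : Siegel → ℂ) : Prop extends
    IsParamodularForm k N f where
  cuspidal : ∀ g : symplecticGroup (Fin 2) ℚ, ∀ τ : ℂ, 0 < τ.im →
    Tendsto (fun y : ℝ => extend (slash k f (g : Mat4)) (coordMatrix (τ, 0, Complex.I * y)))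
      atTop (𝓝 0)

/-! ### Fourier coefficients -/

/-- The index matrix `[n, r/2; r/2, mN]`. -/
def indexMatrix (N : ℕ) (n r m : ℤ) : Mat2 :=
  !![(n : ℚ), r / 2; r / 2, m * N]

/-- The matrices `[n, r/2; r/2, mN]` with integers `n, m ≥ 0` and `r`, and `4nmN - r² ≥ 0`. -/
def indexSemi (N : ℕ) : Set Mat2 :=
  {t | ∃ n r m : ℤ, 0 ≤ n ∧ 0 ≤ m ∧ 0 ≤ 4 * n * m * N - r ^ 2 ∧ t = indexMatrix N n r m}

/-- The matrices `[n, r/2; r/2, mN]` with integers `n, m ≥ 0` and `r`, and `4nmN - r² > 0`. -/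
def indexPos (N : ℕ) : Set Mat2 :=
  {t | ∃ n r m : ℤ, 0 ≤ n ∧ 0 ≤ m ∧ 0 < 4 * n * m * N - r ^ 2 ∧ t = indexMatrix N n r m}

/-- The exponential `exp(2πi tr(tΩ))`. -/
def expTrace (t : Mat2) (Ω : Siegel) : ℂ :=
  Complex.exp (2 * Real.pi * Complex.I * (t.map (fun x : ℚ => (x : ℂ)) * Ω.1).trace)

/-- `f(Ω) = ∑ a(t) exp(2πi tr(tΩ))`, where `t` runs over `indexSemi N`; the coefficient function
is extended by zero to all rational matrices. -/
structure IsFourierExpansion (N : ℕ) (f : Siegel → ℂ) (a : Mat2 → ℂ) : Prop where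
  support : ∀ t, t ∉ indexSemi N → a t = 0
  hasSum : ∀ Ω, HasSum (fun t : indexSemi N => a t * expTrace t Ω) (f Ω)

open Classical in
/-- The Fourier coefficients `a(t; f)` of a function with a Fourier expansion over `indexSemi N`;
they are `0` for all `t` outside `indexSemi N`. -/
def fourierCoeff (N : ℕ) (f : Siegel → ℂ) : Mat2 → ℂ :=
  if h : ∃ a, IsFourierExpansion N f a then h.choose else 0

/-! ### Hecke operators -/

/-- The double coset `K(N) δ K(N)`. -/
def heckeCoset (N : ℕ) (δ : Mat4) : Set Mat4 :=
  {g | ∃ κ₁ ∈ paramodularGroup N, ∃ κ₂ ∈ paramodularGroup N, g = (κ₁ : Mat4) * δ * (κ₂ : Mat4)}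

/-- Two elements of `K(N) δ K(N)` are equivalent if they lie in the same coset `K(N) g`. -/
def cosetSetoid (N : ℕ) (δ : Mat4) : Setoid (heckeCoset N δ) where
  r g h := ∃ κ ∈ paramodularGroup N, (h : Mat4) = (κ : Mat4) * (g : Mat4)
  iseqv :=
    { refl := fun g => ⟨1, one_mem _, (one_mul (g : Mat4)).symm⟩
      symm := by
        rintro g h ⟨κ, hκ, e⟩
        refine ⟨κ⁻¹, inv_mem hκ, ?_⟩
        rw [e, ← mul_assoc,
          show ((κ⁻¹ : symplecticGroup (Fin 2) ℚ) : Mat4) * (κ : Mat4)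
            = ((κ⁻¹ * κ : symplecticGroup (Fin 2) ℚ) : Mat4) from rfl, inv_mul_cancel]
        exact (one_mul (g : Mat4)).symm
      trans := by
        rintro g h l ⟨κ, hκ, e⟩ ⟨κ', hκ', e'⟩
        refine ⟨κ' * κ, mul_mem hκ' hκ, ?_⟩
        rw [e', e, ← mul_assoc]
        rfl }

/-- The Hecke operator of the double coset `K(N) δ K(N)`: `f ↦ ∑ f | g`, where `g` runs over
representatives of the (finitely many) cosets in `K(N) \ K(N) δ K(N)`. -/
def heckeOp (k : ℤ) (N : ℕ) (δ : Mat4) (f : Siegel → ℂ) : Siegel → ℂ :=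
  ∑ᶠ q : Quotient (cosetSetoid N δ), slash k f (q.out : Mat4)

/-- The diagonal matrix `diag(a, b, c, d)`. -/
def diag4 (a b c d : ℚ) : Mat4 :=
  Matrix.diagonal (Sum.elim ![a, b] ![c, d])

/-- `T(p)` is the Hecke operator of `diag(1, 1, p, p)`. -/
def deltaT (p : ℕ) : Mat4 := diag4 1 1 p p

/-- `T₁(p²)` is the Hecke operator of `diag(1, p, p², p)`. -/
def deltaT1 (p : ℕ) : Mat4 := diag4 1 p (p ^ 2) p

/-- `T₀(p²)` is the Hecke operator of `diag(p, p², p, 1)`. -/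
def deltaT0 (p : ℕ) : Mat4 := diag4 p (p ^ 2) p 1

/-! ### Ingredients of the explicit formulas -/

/-- `t[u] = uᵀ t u`. -/
def act (t u : Mat2) : Mat2 := uᵀ * t * u

open Classical in
/-- `p - 1` if the rational number `x` is an integer multiple of `p`, and `-1` otherwise. -/
def charSum (p : ℕ) (x : ℚ) : ℂ :=
  if ∃ j : ℤ, x = p * j then (p : ℂ) - 1 else -1

end Paramodular

end

open Paramodular

/-!
The coefficients of `f | T` can be read off once the double coset `K(N) δ K(N)` is written as a
disjoint union of left cosets `K(N) S` with `S = [A, B; 0, D]` block upper triangular: then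
`(f | S)(Ω) = m ^ (2k - 3) det(D) ^ (-k) f((AΩ + B) D⁻¹)`, and inserting the Fourier expansion of
`f` shows that the coefficient of `f | S` at `t` is
`m ^ (2k - 3) det(D) ^ (-k) exp(2πi tr(t DᵀB) / m) a(t[Dᵀ] / m; f)`.
Summing over the representatives with the same `D`, the exponentials become full sums, or sums over
the nonzero elements, of additive characters of `ℤ/p`; the latter are the values of `charSum`.

Fourier expansions. A paramodular form is holomorphic and periodic on the tube over the cone of
positive definite matrices, so it has an absolutely convergent Fourier series, whose normalized
coefficients do not depend on the height by Cauchy's theorem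
(`hasSum_of_isPeriodicOnTube_cone`). If `t[v] < 0` for an integral vector `v`, then the coefficients
at the infinitely many indices equivalent to `t` under transvections fixing `v` are equal, although
their exponentials are unbounded at a point of the half space (`eq_zero_of_quadratic_neg`). So
only positive semidefinite `t` occur (`exists_isFourierExpansion`). Since `f | S` is only periodic
under a smaller lattice, uniqueness is proved for expansions with bounded denominators
(`HasExpansion.unique`). Cusp forms are preserved because `S g = h diag(1, 1, m, m)` with `h` rational
symplectic if `g` is, and the diagonal factor only rescales the limit (`tendsto_slash_slash`).

Coset decompositions. As `δ` is diagonal, the cosets in `K(N) δ K(N)` correspond to the cosets of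
`K(N) ∩ δ⁻¹ K(N) δ` in `K(N)`. A family `S i` with `S i * Q i ∈ K(N) δ` and `Q i ∈ K(N)` is a
system of representatives as soon as for each `κ ∈ K(N)` there is exactly one `i` with
`δ κ Q i δ⁻¹ ∈ K(N)` (`isRepSystem_of_forall_existsUnique`). In integral coordinates (`Entries`)
this condition is a system of congruences modulo `p` and `p²` on a few entries of `κ Q i`
(`isAdmissible_deltaT_iff` and its analogues), which is solved by a distinction of cases
according to which entries of `κ` are divisible by `p`. Each case is one of the summands of the
index types `IndexT`, `IndexT0`, `IndexGoodT`, `IndexT1`, and contributes one term to the formula.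
-/

namespace Paramodular

section SiegelAction

open scoped ComplexOrder

/-! ### The action of similitudes on the Siegel upper half space -/

/-- Rational symplectic similitudes with positive multiplier `m`. -/
structure IsSimilitude (g : Mat4) (m : ℚ) : Prop where
  pos : 0 < m
  eq : gᵀ * J (Fin 2) ℚ * g = m • J (Fin 2) ℚ

lemma IsSimilitude.multiplier_eq {g : Mat4} {m : ℚ} (h : IsSimilitude g m) : multiplier g = m := by
  rw [multiplier, h.eq]
  simp [J]

lemma IsSimilitude.mul {g h : Mat4} {m n : ℚ} (hg : IsSimilitude g m) (hh : IsSimilitude h n) :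
    IsSimilitude (g * h) (m * n) := by
  refine ⟨mul_pos hg.pos hh.pos, ?_⟩
  calc (g * h)ᵀ * J (Fin 2) ℚ * (g * h) = hᵀ * (gᵀ * J (Fin 2) ℚ * g) * h := by
        simp only [Matrix.transpose_mul, Matrix.mul_assoc]
    _ = (m * n) • J (Fin 2) ℚ := by
        rw [hg.eq, Matrix.mul_smul, Matrix.smul_mul, hh.eq, smul_smul]

lemma isSimilitude_of_mem {g : Mat4} (h : g ∈ symplecticGroup (Fin 2) ℚ) : IsSimilitude g 1 :=
  ⟨one_pos, by rw [one_smul]; exact SymplecticGroup.mem_iff'.1 h⟩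

lemma IsSimilitude.mem_symplecticGroup {g : Mat4} (h : IsSimilitude g 1) :
    g ∈ symplecticGroup (Fin 2) ℚ :=
  SymplecticGroup.mem_iff'.2 (by simpa using h.eq)

/-- The complexification of a rational `4 × 4` matrix. -/
noncomputable def cplx (g : Mat4) : Matrix (Fin 2 ⊕ Fin 2) (Fin 2 ⊕ Fin 2) ℂ :=
  g.map (fun x : ℚ => (x : ℂ))

lemma cplx_mul (g h : Mat4) : cplx (g * h) = cplx g * cplx h :=
  Matrix.map_mul (f := Rat.castHom ℂ)

/-- The numerator `AZ + B` of the action of `g = [A, B; C, D]`. -/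
noncomputable def num (g : Mat4) (Z : Matrix (Fin 2) (Fin 2) ℂ) : Matrix (Fin 2) (Fin 2) ℂ :=
  (cplx g).toBlocks₁₁ * Z + (cplx g).toBlocks₁₂

/-- The denominator `CZ + D` of the action of `g = [A, B; C, D]`. -/
noncomputable def den (g : Mat4) (Z : Matrix (Fin 2) (Fin 2) ℂ) : Matrix (Fin 2) (Fin 2) ℂ :=
  (cplx g).toBlocks₂₁ * Z + (cplx g).toBlocks₂₂

lemma slash_apply (k : ℤ) (f : Siegel → ℂ) (g : Mat4) (Ω : Siegel) :
    slash k f g Ω = (multiplier g : ℂ) ^ (2 * k - 3) * (den g Ω.1).det ^ (-k) *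
      extend f (num g Ω.1 * (den g Ω.1)⁻¹) := rfl

lemma extend_of_mem (f : Siegel → ℂ) {Z : Matrix (Fin 2) (Fin 2) ℂ} (h : Z ∈ siegelSet) :
    extend f Z = f ⟨Z, h⟩ := by
  simp [extend, h]

lemma num_mul (g h : Mat4) (Z : Matrix (Fin 2) (Fin 2) ℂ) :
    num (g * h) Z = (cplx g).toBlocks₁₁ * num h Z + (cplx g).toBlocks₁₂ * den h Z := by
  rw [num, num, den, cplx_mul]
  conv_lhs => rw [← fromBlocks_toBlocks (cplx g), ← fromBlocks_toBlocks (cplx h),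
    fromBlocks_multiply]
  simp only [toBlocks_fromBlocks₁₁, toBlocks_fromBlocks₁₂]
  noncomm_ring

lemma den_mul (g h : Mat4) (Z : Matrix (Fin 2) (Fin 2) ℂ) :
    den (g * h) Z = (cplx g).toBlocks₂₁ * num h Z + (cplx g).toBlocks₂₂ * den h Z := by
  rw [den, num, den, cplx_mul]
  conv_lhs => rw [← fromBlocks_toBlocks (cplx g), ← fromBlocks_toBlocks (cplx h),
    fromBlocks_multiply]
  simp only [toBlocks_fromBlocks₂₁, toBlocks_fromBlocks₂₂]
  noncomm_ring

/-- The relations between the blocks of a similitude. -/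
lemma IsSimilitude.block_relations {g : Mat4} {m : ℚ} (h : IsSimilitude g m) :
    (cplx g).toBlocks₂₁ᵀ * (cplx g).toBlocks₁₁ = (cplx g).toBlocks₁₁ᵀ * (cplx g).toBlocks₂₁ ∧
    (cplx g).toBlocks₁₁ᵀ * (cplx g).toBlocks₂₂ - (cplx g).toBlocks₂₁ᵀ * (cplx g).toBlocks₁₂
      = (m : ℂ) • 1 ∧
    (cplx g).toBlocks₂₂ᵀ * (cplx g).toBlocks₁₁ - (cplx g).toBlocks₁₂ᵀ * (cplx g).toBlocks₂₁
      = (m : ℂ) • 1 ∧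
    (cplx g).toBlocks₂₂ᵀ * (cplx g).toBlocks₁₂ = (cplx g).toBlocks₁₂ᵀ * (cplx g).toBlocks₂₂ := by
  have e : (cplx g)ᵀ * J (Fin 2) ℂ * cplx g = (m : ℂ) • J (Fin 2) ℂ := by
    have h1 := congrArg cplx h.eq
    rw [cplx_mul, cplx_mul] at h1
    have h2 : cplx (J (Fin 2) ℚ) = J (Fin 2) ℂ := map_J (Fin 2) (Rat.castHom ℂ)
    have h3 : cplx (m • J (Fin 2) ℚ) = (m : ℂ) • J (Fin 2) ℂ := by
      rw [← h2]; ext i j; simp [cplx]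
    rw [h2, h3] at h1
    exact h1
  rw [← fromBlocks_toBlocks (cplx g), J, fromBlocks_transpose, fromBlocks_multiply,
    fromBlocks_multiply, fromBlocks_smul, fromBlocks_inj] at e
  obtain ⟨e1, e2, e3, e4⟩ := e
  simp only [Matrix.mul_zero, zero_add, add_zero, Matrix.mul_one, Matrix.mul_neg, smul_neg,
    smul_zero, Matrix.neg_mul] at e1 e2 e3 e4
  refine ⟨?_, ?_, ?_, ?_⟩
  · rw [← sub_eq_zero, ← e1]; abel
  · rw [← neg_inj, ← e2]; abel
  · rw [← e3]; abel
  · rw [← sub_eq_zero, ← e4]; abel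

lemma conj_block (M : Matrix (Fin 2) (Fin 2) ℂ) (h : ∀ i j, star (M i j) = M i j) : Mᴴ = Mᵀ := by
  ext i j
  simp [h]

/-- A real positive definite matrix is positive definite as a complex matrix. -/
lemma posDef_ofReal {Y : Matrix (Fin 2) (Fin 2) ℝ} (hY : Y.PosDef) :
    (Y.map (fun x : ℝ => (x : ℂ))).PosDef := by
  have hs : Y 1 0 = Y 0 1 := by simpa using congrFun (congrFun hY.isHermitian 0) 1
  refine PosDef.of_dotProduct_mulVec_pos ?_ ?_
  · ext i j
    have := congrFun (congrFun hY.isHermitian i) j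
    simp only [conjTranspose_apply, star_trivial, map_apply] at this ⊢
    rw [this]; simp
  · intro x hx
    have key : star x ⬝ᵥ (Y.map (fun x : ℝ => (x : ℂ)) *ᵥ x) =
        (((fun i => (x i).re) ⬝ᵥ (Y *ᵥ fun i => (x i).re)
          + (fun i => (x i).im) ⬝ᵥ (Y *ᵥ fun i => (x i).im) : ℝ) : ℂ) := by
      apply Complex.ext
      · simp [dotProduct, mulVec, Fin.sum_univ_two]; ring
      · simp [dotProduct, mulVec, Fin.sum_univ_two, hs]; ring
    rw [key]
    have h1 := fun v : Fin 2 → ℝ => hY.posSemidef.dotProduct_mulVec_nonneg v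
    simp only [star_trivial] at h1
    have h2 := fun (v : Fin 2 → ℝ) (hv : v ≠ 0) => hY.dotProduct_mulVec_pos hv
    simp only [star_trivial] at h2
    norm_cast
    by_cases hr : (fun i => (x i).re) = 0
    · have hi : (fun i => (x i).im) ≠ 0 := by
        intro hi
        apply hx
        ext i
        exact Complex.ext (congrFun hr i) (congrFun hi i)
      exact add_pos_of_nonneg_of_pos (h1 _) (h2 _ hi)
    · exact add_pos_of_pos_of_nonneg (h2 _ hr) (h1 _)

/-- A real matrix is positive definite if it is so as a complex matrix. -/
lemma posDef_of_ofReal {Y : Matrix (Fin 2) (Fin 2) ℝ}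
    (hY : (Y.map (fun x : ℝ => (x : ℂ))).PosDef) : Y.PosDef := by
  refine PosDef.of_dotProduct_mulVec_pos ?_ ?_
  · ext i j
    have := congrFun (congrFun hY.isHermitian i) j
    simpa using this
  · intro x hx
    have h0 : (fun i => (x i : ℂ)) ≠ 0 := by
      intro h; apply hx; ext i; simpa using congrFun h i
    have h1 := hY.dotProduct_mulVec_pos h0
    have key : star (fun i => (x i : ℂ)) ⬝ᵥ (Y.map (fun x : ℝ => (x : ℂ)) *ᵥ fun i => (x i : ℂ)) =
        ((star x ⬝ᵥ (Y *ᵥ x) : ℝ) : ℂ) := by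
      simp [dotProduct, mulVec]
    rw [key] at h1
    exact_mod_cast h1

lemma conjTranspose_sub_of_isSymm {Z : Matrix (Fin 2) (Fin 2) ℂ} (hZ : Z.IsSymm) :
    Zᴴ - Z = (-2 * Complex.I) • (Z.map Complex.im).map (fun x : ℝ => (x : ℂ)) := by
  ext i j
  have h : Z j i = Z i j := congrFun (congrFun hZ i) j
  simp only [Matrix.sub_apply, conjTranspose_apply, Matrix.smul_apply, map_apply, h, smul_eq_mul]
  apply Complex.ext <;> simp
  ring


lemma conjTranspose_cplx_block (g : Mat4) :
    (cplx g).toBlocks₁₁ᴴ = (cplx g).toBlocks₁₁ᵀ ∧ (cplx g).toBlocks₁₂ᴴ = (cplx g).toBlocks₁₂ᵀ ∧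
    (cplx g).toBlocks₂₁ᴴ = (cplx g).toBlocks₂₁ᵀ ∧ (cplx g).toBlocks₂₂ᴴ = (cplx g).toBlocks₂₂ᵀ := by
  refine ⟨?_, ?_, ?_, ?_⟩ <;>
  · apply conj_block
    intro i j
    simp [cplx, toBlocks₁₁, toBlocks₁₂, toBlocks₂₁, toBlocks₂₂]

/-- With `P = AZ + B` and `Q = CZ + D`, one has `PᴴQ - QᴴP = m (Zᴴ - Z)`. -/
lemma IsSimilitude.hermitian_relation {g : Mat4} {m : ℚ} (hg : IsSimilitude g m)
    (Z : Matrix (Fin 2) (Fin 2) ℂ) :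
    (num g Z)ᴴ * den g Z - (den g Z)ᴴ * num g Z = (m : ℂ) • (Zᴴ - Z) := by
  obtain ⟨r1, r2, r3, r4⟩ := hg.block_relations
  obtain ⟨c1, c2, c3, c4⟩ := conjTranspose_cplx_block g
  simp only [num, den, conjTranspose_add, conjTranspose_mul, c1, c2, c3, c4]
  set a := (cplx g).toBlocks₁₁
  set b := (cplx g).toBlocks₁₂
  set c := (cplx g).toBlocks₂₁
  set d := (cplx g).toBlocks₂₂
  calc _ = Zᴴ * (aᵀ * c - cᵀ * a) * Z + Zᴴ * (aᵀ * d - cᵀ * b) - (dᵀ * a - bᵀ * c) * Z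
        + (bᵀ * d - dᵀ * b) := by noncomm_ring
    _ = _ := by rw [r1, r2, r3, r4]; simp [smul_sub]

/-- With `P = AZ + B` and `Q = CZ + D`, the matrix `PᵀQ` is symmetric. -/
lemma IsSimilitude.symmetric_relation {g : Mat4} {m : ℚ} (hg : IsSimilitude g m)
    {Z : Matrix (Fin 2) (Fin 2) ℂ} (hZ : Z.IsSymm) :
    (num g Z)ᵀ * den g Z = (den g Z)ᵀ * num g Z := by
  obtain ⟨r1, r2, r3, r4⟩ := hg.block_relations
  simp only [num, den, transpose_add, transpose_mul, hZ.eq]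
  set a := (cplx g).toBlocks₁₁
  set b := (cplx g).toBlocks₁₂
  set c := (cplx g).toBlocks₂₁
  set d := (cplx g).toBlocks₂₂
  rw [← sub_eq_zero]
  calc _ = Z * (aᵀ * c - cᵀ * a) * Z + Z * (aᵀ * d - cᵀ * b) - (dᵀ * a - bᵀ * c) * Z
        + (bᵀ * d - dᵀ * b) := by noncomm_ring
    _ = _ := by rw [r1, r2, r3, r4]; simp

lemma IsSimilitude.isUnit_det_den {g : Mat4} {m : ℚ} (hg : IsSimilitude g m)
    {Z : Matrix (Fin 2) (Fin 2) ℂ} (hZ : Z ∈ siegelSet) : IsUnit (den g Z).det := by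
  rw [isUnit_iff_ne_zero]
  intro h0
  obtain ⟨v, hv, hQ⟩ := Matrix.exists_mulVec_eq_zero_iff.2 h0
  have h1 := hg.hermitian_relation Z
  rw [conjTranspose_sub_of_isSymm hZ.1, smul_smul] at h1
  have h2 := congrArg (fun M => star v ⬝ᵥ (M *ᵥ v)) h1
  simp only [sub_mulVec, smul_mulVec, dotProduct_smul, dotProduct_sub] at h2
  rw [← mulVec_mulVec, hQ, ← mulVec_mulVec, dotProduct_mulVec (star v) ((den g Z)ᴴ),
    ← star_mulVec, hQ] at h2
  have h3 := (posDef_ofReal hZ.2).dotProduct_mulVec_pos hv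
  have hm : (m : ℂ) ≠ 0 := by exact_mod_cast hg.pos.ne'
  rw [mulVec_zero, dotProduct_zero, star_zero, zero_dotProduct, sub_zero, smul_eq_mul] at h2
  exact mul_ne_zero (mul_ne_zero hm (by simp)) h3.ne' h2.symm

/-- Similitudes with positive multiplier map the Siegel upper half space to itself. -/
lemma IsSimilitude.action_mem {g : Mat4} {m : ℚ} (hg : IsSimilitude g m)
    {Z : Matrix (Fin 2) (Fin 2) ℂ} (hZ : Z ∈ siegelSet) :
    num g Z * (den g Z)⁻¹ ∈ siegelSet := by
  have hu := hg.isUnit_det_den hZ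
  have hs := hg.symmetric_relation hZ.1
  have hh := hg.hermitian_relation Z
  rw [conjTranspose_sub_of_isSymm hZ.1] at hh
  set P := num g Z
  set Q := den g Z
  have hu' : IsUnit Qᵀ.det := by rwa [det_transpose]
  have huH : IsUnit Qᴴ.det := by rw [det_conjTranspose]; exact hu.star
  have hsym : (P * Q⁻¹).IsSymm := by
    rw [IsSymm, transpose_mul, transpose_nonsing_inv]
    have : Qᵀ⁻¹ * (Pᵀ * Q) * Q⁻¹ = Qᵀ⁻¹ * (Qᵀ * P) * Q⁻¹ := by rw [hs]
    rwa [← Matrix.mul_assoc, Matrix.mul_nonsing_inv_cancel_right _ _ hu, ← Matrix.mul_assoc,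
      Matrix.nonsing_inv_mul _ hu', Matrix.one_mul] at this
  refine ⟨hsym, posDef_of_ofReal ?_⟩
  set W := P * Q⁻¹ with hW
  have hP : P = W * Q := by rw [hW, Matrix.nonsing_inv_mul_cancel_right _ _ hu]
  have h1 := conjTranspose_sub_of_isSymm hsym
  have h2 : Qᴴ * (Wᴴ - W) * Q = (m : ℂ) • (-2 * Complex.I) •
      (Z.map Complex.im).map (fun x : ℝ => (x : ℂ)) := by
    rw [← hh]; clear_value W; rw [hP, conjTranspose_mul]; noncomm_ring
  have hI : (-2 * Complex.I) ≠ 0 := by simp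
  have h3 : Qᴴ * ((W.map Complex.im).map (fun x : ℝ => (x : ℂ))) * Q =
      (m : ℂ) • (Z.map Complex.im).map (fun x : ℝ => (x : ℂ)) := by
    rw [h1, smul_comm, Matrix.mul_smul, Matrix.smul_mul] at h2
    exact smul_right_injective _ hI h2
  have hm : (0 : ℂ) < (m : ℂ) := by
    rw [← Complex.ofReal_ratCast]
    exact Complex.zero_lt_real.2 (by exact_mod_cast hg.pos)
  have h4 : (Qᴴ * ((W.map Complex.im).map (fun x : ℝ => (x : ℂ))) * Q).PosDef := by
    rw [h3]; exact (posDef_ofReal hZ.2).smul hm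
  have hQ : IsUnit Q := (Matrix.isUnit_iff_isUnit_det _).2 hu
  have h5 := (Matrix.IsUnit.posDef_star_left_conjugate_iff hQ).1 h4
  exact h5

/-- The cocycle relation of the slash operator. -/
lemma slash_slash (k : ℤ) (f : Siegel → ℂ) {g h : Mat4} {m n : ℚ} (hg : IsSimilitude g m)
    (hh : IsSimilitude h n) : slash k (slash k f g) h = slash k f (g * h) := by
  funext Ω
  have hu := hh.isUnit_det_den Ω.2
  have hu2 := hg.isUnit_det_den (hh.action_mem Ω.2)
  rw [slash_apply, extend_of_mem _ (hh.action_mem Ω.2), slash_apply, slash_apply,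
    hg.multiplier_eq, hh.multiplier_eq, (hg.mul hh).multiplier_eq]
  set W := num h Ω.1 * (den h Ω.1)⁻¹ with hW
  have hP : num h Ω.1 = W * den h Ω.1 := by
    rw [hW, Matrix.nonsing_inv_mul_cancel_right _ _ hu]
  have e1 : num (g * h) Ω.1 = num g W * den h Ω.1 := by
    clear_value W; rw [num_mul, hP, num]; noncomm_ring
  have e2 : den (g * h) Ω.1 = den g W * den h Ω.1 := by
    clear_value W; rw [den_mul, hP, den.eq_def g W]; noncomm_ring
  have e3 : num (g * h) Ω.1 * (den (g * h) Ω.1)⁻¹ = num g W * (den g W)⁻¹ := by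
    rw [e1, e2, Matrix.mul_inv_rev, ← Matrix.mul_assoc,
      Matrix.mul_nonsing_inv_cancel_right _ _ hu]
  rw [e3, e2, det_mul, mul_zpow, Rat.cast_mul, mul_zpow]
  ring

lemma slash_add (k : ℤ) (f₁ f₂ : Siegel → ℂ) (g : Mat4) :
    slash k (f₁ + f₂) g = slash k f₁ g + slash k f₂ g := by
  funext Ω
  simp only [slash_apply, Pi.add_apply, extend]
  split_ifs <;> simp [mul_add]

lemma slash_sum (k : ℤ) {ι : Type*} (s : Finset ι) (f : ι → Siegel → ℂ) (g : Mat4) :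
    slash k (∑ i ∈ s, f i) g = ∑ i ∈ s, slash k (f i) g := by
  classical
  induction s using Finset.induction_on with
  | empty => funext Ω; simp [slash_apply, extend]
  | insert i s hi ih => rw [Finset.sum_insert hi, Finset.sum_insert hi, slash_add, ih]

end SiegelAction

/-! ### Fourier expansion of periodic holomorphic functions on tube domains -/

section Tube

open MeasureTheory UnitAddTorus

variable {d : Type*}

/-- The point `x + iy`. -/
noncomputable def tubePoint (x y : d → ℝ) : d → ℂ := fun j => (x j : ℂ) + (y j : ℂ) * Complex.I

/-- Holomorphic functions on the tube `ℝᵈ + iV`, periodic with respect to `ℤᵈ`. -/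
structure IsPeriodicOnTube (V : Set (d → ℝ)) (G : (d → ℂ) → ℂ) : Prop where
  holomorphic : ∀ w : d → ℂ, (fun j => (w j).im) ∈ V → DifferentiableAt ℂ G w
  periodic : ∀ (x y : d → ℝ), y ∈ V → ∀ n : d → ℤ,
    G (tubePoint (fun j => x j + n j) y) = G (tubePoint x y)

/-- The function on the torus induced by `x ↦ G (x + iy)`. -/
noncomputable def torusLift (G : (d → ℂ) → ℂ) (y : d → ℝ) : UnitAddTorus d → ℂ := fun t =>
  G (tubePoint (fun j => ((AddCircle.equivIco 1 0 (t j)).1 : ℝ)) y)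

variable {V : Set (d → ℝ)} {G : (d → ℂ) → ℂ}

/-- The projection from `ℝᵈ` to the torus. -/
def torusMk (x : d → ℝ) : UnitAddTorus d := fun j => (x j : UnitAddCircle)

lemma isOpenQuotientMap_torusMk : IsOpenQuotientMap (torusMk (d := d)) :=
  IsOpenQuotientMap.piMap (fun _ : d => QuotientAddGroup.isOpenQuotientMap_mk
    (N := AddSubgroup.zmultiples (1 : ℝ)))

lemma torusLift_mk (hG : IsPeriodicOnTube V G) {y : d → ℝ} (hy : y ∈ V) (x : d → ℝ) :
    torusLift G y (torusMk x) = G (tubePoint x y) := by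
  have h : ∀ j, ∃ n : ℤ, ((AddCircle.equivIco 1 0 (x j : UnitAddCircle)).1 : ℝ) = x j + n := by
    intro j
    have h1 : (((AddCircle.equivIco 1 0 (x j : UnitAddCircle)).1 - x j : ℝ) : UnitAddCircle) = 0 := by
      rw [AddCircle.coe_sub, AddCircle.coe_equivIco, sub_self]
    obtain ⟨n, hn⟩ := (AddCircle.coe_eq_zero_iff 1).1 h1
    refine ⟨n, ?_⟩
    rw [zsmul_one] at hn
    rw [hn]; ring
  choose n hn using h
  rw [torusLift, ← hG.periodic x y hy n]
  congr 2
  funext j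
  exact hn j

lemma continuous_slice (hG : IsPeriodicOnTube V G) {y : d → ℝ} (hy : y ∈ V) :
    Continuous fun x : d → ℝ => G (tubePoint x y) := by
  rw [continuous_iff_continuousAt]
  intro x
  have h1 : DifferentiableAt ℂ G (tubePoint x y) := hG.holomorphic _ (by simpa [tubePoint] using hy)
  exact ContinuousAt.comp (f := fun x => tubePoint x y) h1.continuousAt
    (continuous_pi fun j =>
      (Complex.continuous_ofReal.comp (continuous_apply j)).add continuous_const).continuousAt

lemma continuous_torusLift (hG : IsPeriodicOnTube V G) {y : d → ℝ} (hy : y ∈ V) :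
    Continuous (torusLift G y) := by
  rw [isOpenQuotientMap_torusMk.isQuotientMap.continuous_iff]
  refine (continuous_slice hG hy).congr fun x => ?_
  rw [Function.comp_apply, torusLift_mk hG hy]

/-- Cauchy's theorem for a `1`-periodic function on a horizontal strip. -/
lemma integral_shift {φ : ℂ → ℂ} {s : ℝ}
    (hφ : ∀ z : ℂ, z.im ∈ Set.uIcc 0 s → DifferentiableAt ℂ φ z)
    (hper : ∀ z : ℂ, z.im ∈ Set.uIcc 0 s → φ (z + 1) = φ z) :
    ∫ u : ℝ in (0 : ℝ)..1, φ (u + s * Complex.I) = ∫ u : ℝ in (0 : ℝ)..1, φ u := by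
  have h := Complex.integral_boundary_rect_eq_zero_of_differentiableOn φ 0 (1 + s * Complex.I)
    (fun z hz => by
      have h2 : z.im ∈ Set.uIcc 0 s := by
        have := hz.2
        simpa using this
      exact (hφ z h2).differentiableWithinAt)
  simp only [Complex.zero_re, Complex.zero_im, Complex.add_re, Complex.one_re, Complex.mul_re,
    Complex.ofReal_re, Complex.I_re, mul_zero, Complex.ofReal_im, Complex.I_im, mul_one, sub_self,
    add_zero, Complex.add_im, Complex.one_im, Complex.mul_im, zero_add, Complex.ofReal_zero,
    zero_mul, Complex.ofReal_one] at h
  have h2 : ∫ v : ℝ in (0 : ℝ)..s, φ (1 + v * Complex.I) = ∫ v : ℝ in (0 : ℝ)..s, φ (v * Complex.I) := by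
    refine intervalIntegral.integral_congr fun v hv => ?_
    rw [add_comm, hper _ (by simpa using hv)]
  rw [h2] at h
  linear_combination -h

/-- The exponential `exp (2πi ν·w)`. -/
noncomputable def expLin [Fintype d] (ν : d → ℤ) (w : d → ℂ) : ℂ :=
  Complex.exp (2 * Real.pi * Complex.I * ∑ j, ν j * w j)

lemma mFourier_torusMk [Fintype d] (ν : d → ℤ) (x : d → ℝ) :
    mFourier ν (torusMk x) = expLin ν (fun j => (x j : ℂ)) := by
  simp only [mFourier, ContinuousMap.coe_mk, torusMk, expLin, fourier_coe_apply]
  rw [← Complex.exp_sum, Finset.mul_sum]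
  congr 1
  refine Finset.sum_congr rfl fun j _ => ?_
  simp; ring

lemma expLin_add [Fintype d] (ν : d → ℤ) (w w' : d → ℂ) : expLin ν (w + w') = expLin ν w * expLin ν w' := by
  rw [expLin, expLin, expLin, ← Complex.exp_add, ← mul_add, ← Finset.sum_add_distrib]
  simp [mul_add]

lemma expLin_neg [Fintype d] (ν : d → ℤ) (w : d → ℂ) : expLin (-ν) w = (expLin ν w)⁻¹ := by
  rw [expLin, expLin, ← Complex.exp_neg]
  simp

lemma expLin_int [Fintype d] (ν : d → ℤ) (n : d → ℤ) : expLin ν (fun j => (n j : ℂ)) = 1 := by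
  rw [expLin, Complex.exp_eq_one_iff]
  exact ⟨∑ j, ν j * n j, by push_cast; ring⟩

lemma expLin_ne_zero [Fintype d] (ν : d → ℤ) (w : d → ℂ) : expLin ν w ≠ 0 := Complex.exp_ne_zero _

lemma differentiable_expLin [Fintype d] (ν : d → ℤ) : Differentiable ℂ (expLin ν) := by
  unfold expLin; fun_prop

lemma tubePoint_eq (x y : d → ℝ) :
    tubePoint x y = (fun j => (x j : ℂ)) + fun j => (y j : ℂ) * Complex.I := rfl

/-- The Fourier coefficient at height `y`, normalized to be independent of `y`. -/
noncomputable def tubeCoeff [Fintype d] (G : (d → ℂ) → ℂ) (y : d → ℝ) (ν : d → ℤ) : ℂ :=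
  mFourierCoeff (torusLift G y) ν * expLin (-ν) (fun j => (y j : ℂ) * Complex.I)

/-- The normalized coefficient does not change if one coordinate of the height moves within the
tube: for the integral over that coordinate this is Cauchy's theorem. -/
lemma tubeCoeff_shift [Fintype d] [DecidableEq d] (hG : IsPeriodicOnTube V G) {y : d → ℝ} (j : d) (s : ℝ)
    (hs : ∀ u ∈ Set.uIcc 0 s, y + Pi.single j u ∈ V) (ν : d → ℤ) :
    tubeCoeff G (y + Pi.single j s) ν = tubeCoeff G y ν := by
  set μ : Measure UnitAddCircle := AddCircle.haarAddCircle
  set μT : Measure (UnitAddTorus d) := Measure.pi fun _ : d => μ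
  -- the integrals over the torus as averages over circles in the direction `j`
  have average : ∀ h : UnitAddTorus d → ℂ, Continuous h →
      ∫ t, h t ∂μT = ∫ t, (∫ u, h (t + Pi.single j u) ∂μ) ∂μT := by
    intro h hh
    have hcont : Continuous (Function.uncurry fun (t : UnitAddTorus d) (u : UnitAddCircle) =>
        h (t + Pi.single j u)) := by
      apply hh.comp
      exact continuous_fst.add ((continuous_single j).comp continuous_snd)
    have hint : Integrable (Function.uncurry fun (t : UnitAddTorus d) (u : UnitAddCircle) =>
        h (t + Pi.single j u)) (μT.prod μ) :=
      hcont.integrable_of_hasCompactSupport (HasCompactSupport.of_compactSpace _)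
    rw [integral_integral_swap hint]
    simp_rw [integral_add_right_eq_self (μ := μT) h]
    simp
  have coeff : ∀ y' ∈ V, tubeCoeff G y' ν =
      ∫ t, expLin (-ν) (fun j => (y' j : ℂ) * Complex.I) * (mFourier (-ν) t * torusLift G y' t) ∂μT := by
    intro y' hy'
    rw [tubeCoeff, mul_comm, integral_const_mul]
    rfl
  have hy0 : y ∈ V := by simpa using hs 0 Set.left_mem_uIcc
  have hy1 : y + Pi.single j s ∈ V := hs s Set.right_mem_uIcc
  have hc : ∀ y' ∈ V, Continuous fun t : UnitAddTorus d =>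
      expLin (-ν) (fun j => (y' j : ℂ) * Complex.I) * (mFourier (-ν) t * torusLift G y' t) := by
    intro y' hy'
    exact continuous_const.mul ((ContinuousMap.continuous _).mul (continuous_torusLift hG hy'))
  rw [coeff _ hy0, coeff _ hy1, average _ (hc _ hy0), average _ (hc _ hy1)]
  congr 1
  funext t
  obtain ⟨x, rfl⟩ := isOpenQuotientMap_torusMk.surjective t
  -- along a circle, the integrand is the restriction of a periodic holomorphic function
  set φ : ℂ → ℂ := fun z => expLin (-ν) (tubePoint x y + Pi.single j z) *
    G (tubePoint x y + Pi.single j z) with hφdef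
  have key : ∀ v : ℝ, y + Pi.single j v ∈ V →
      ∫ u, expLin (-ν) (fun i => (((y + (Pi.single j v : d → ℝ)) i : ℝ) : ℂ) * Complex.I) *
        (mFourier (-ν) (torusMk x + Pi.single j u) *
          torusLift G (y + Pi.single j v) (torusMk x + Pi.single j u)) ∂μ =
      ∫ u : ℝ in (0 : ℝ)..1, φ (u + v * Complex.I) := by
    intro v hv
    have hvol : (volume : Measure UnitAddCircle) = μ := by
      rw [AddCircle.volume_eq_smul_haarAddCircle]; simp [μ]
    rw [← hvol, ← UnitAddCircle.intervalIntegral_preimage 0]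
    rw [zero_add]
    refine intervalIntegral.integral_congr fun u _ => ?_
    have e1 : torusMk x + Pi.single j (u : UnitAddCircle) = torusMk (x + Pi.single j u) := by
      funext i
      by_cases hi : i = j
      · subst hi; simp [torusMk]
      · simp [torusMk, hi]
    have e2 : tubePoint (x + Pi.single j u) (y + Pi.single j v) =
        tubePoint x y + Pi.single j (u + v * Complex.I) := by
      funext i
      by_cases hi : i = j
      · subst hi; simp [tubePoint]; ring
      · simp [tubePoint, hi]
    rw [e1, torusLift_mk hG hv, mFourier_torusMk, ← mul_assoc, ← expLin_add, e2, hφdef]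
    simp only
    rw [← e2, tubePoint_eq, add_comm]
  have k0 := key 0 (by simpa using hy0)
  have k1 := key s hy1
  simp only [Pi.single_zero, add_zero, Complex.ofReal_zero, zero_mul] at k0
  rw [k0, k1]
  have im_mem : ∀ z : ℂ, z.im ∈ Set.uIcc 0 s →
      (fun i => ((tubePoint x y + (Pi.single j z : d → ℂ)) i).im) ∈ V := by
    intro z hz
    convert! hs _ hz using 1
    funext i
    by_cases hi : i = j
    · subst hi; simp [tubePoint]
    · simp [tubePoint, hi]
  refine integral_shift ?_ ?_
  · intro z hz
    have hl : DifferentiableAt ℂ (fun z : ℂ => tubePoint x y + Pi.single j z) z := by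
      refine DifferentiableAt.const_add _ ?_
      exact ((ContinuousLinearMap.single ℂ (fun _ : d => ℂ) j).differentiableAt (x := z))
    exact (((differentiable_expLin (-ν)) _).comp z hl).mul
      ((hG.holomorphic _ (im_mem z hz)).comp z hl)
  · intro z hz
    have e3 : tubePoint x y + Pi.single j z =
        tubePoint (x + Pi.single j z.re) (y + Pi.single j z.im) := by
      funext i
      by_cases hi : i = j
      · subst hi
        apply Complex.ext <;> simp [tubePoint]
      · simp [tubePoint, hi]
    have e4 : tubePoint x y + Pi.single j (z + 1) =
        tubePoint (fun i => (x + (Pi.single j z.re : d → ℝ)) i + ((Pi.single j 1 : d → ℤ) i : ℝ))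
          (y + Pi.single j z.im) := by
      funext i
      by_cases hi : i = j
      · subst hi
        apply Complex.ext <;> simp [tubePoint]
        ring
      · simp [tubePoint, hi]
    have e5 : tubePoint x y + Pi.single j (z + 1) = (tubePoint x y + Pi.single j z) +
        fun i => ((Pi.single j 1 : d → ℤ) i : ℂ) := by
      funext i
      by_cases hi : i = j
      · subst hi; simp; ring
      · simp [hi]
    simp only [hφdef]
    rw [show G (tubePoint x y + Pi.single j (z + 1)) = G (tubePoint x y + Pi.single j z) by
      rw [e4, hG.periodic _ _ (hs _ hz), e3]]
    rw [e5, expLin_add, expLin_int, mul_one]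

/-- The reconstruction of `G` from its Fourier coefficients. -/
lemma hasSum_tubeCoeff [Fintype d] (hG : IsPeriodicOnTube V G) {x y : d → ℝ} (hy : y ∈ V)
    (hs : Summable fun ν => ‖mFourierCoeff (torusLift G y) ν‖) :
    HasSum (fun ν => tubeCoeff G y ν * expLin ν (tubePoint x y)) (G (tubePoint x y)) := by
  have h := hasSum_mFourier_series_apply_of_summable
    (f := (⟨torusLift G y, continuous_torusLift hG hy⟩ : C(UnitAddTorus d, ℂ))) hs.of_norm
    (torusMk x)
  simp only [ContinuousMap.coe_mk] at h
  rw [torusLift_mk hG hy] at h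
  refine h.congr_fun fun ν => ?_
  rw [mFourier_torusMk, tubePoint_eq, expLin_add, tubeCoeff, expLin_neg, smul_eq_mul]
  have hB := expLin_ne_zero ν (fun j => (y j : ℂ) * Complex.I)
  generalize (expLin ν fun j => (y j : ℂ) * Complex.I) = B at *
  field_simp

lemma norm_expLin_I [Fintype d] (ν : d → ℤ) (y : d → ℝ) :
    ‖expLin ν (fun j => (y j : ℂ) * Complex.I)‖ = Real.exp (-(2 * Real.pi * ∑ j, ν j * y j)) := by
  rw [expLin, Complex.norm_exp]
  congr 1
  have : 2 * (Real.pi : ℂ) * Complex.I * ∑ j, (ν j : ℂ) * ((y j : ℂ) * Complex.I) =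
      ((-(2 * Real.pi * ∑ j, ν j * y j) : ℝ) : ℂ) := by
    push_cast
    rw [Finset.mul_sum, Finset.mul_sum, ← Finset.sum_neg_distrib]
    refine Finset.sum_congr rfl fun j _ => ?_
    linear_combination (2 * Real.pi * (ν j : ℂ) * y j) * Complex.I_mul_I
  rw [this, Complex.ofReal_re]

lemma exists_bound_mFourierCoeff [Fintype d] (hG : IsPeriodicOnTube V G) {y : d → ℝ} (hy : y ∈ V) :
    ∃ C, ∀ ν, ‖mFourierCoeff (torusLift G y) ν‖ ≤ C := by
  obtain ⟨C, hC⟩ := isCompact_univ.exists_bound_of_continuousOn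
    (continuous_torusLift hG hy).continuousOn
  refine ⟨C, fun ν => ?_⟩
  set μT : Measure (UnitAddTorus d) := Measure.pi fun _ : d => AddCircle.haarAddCircle
  have : mFourierCoeff (torusLift G y) ν = ∫ t, mFourier (-ν) t • torusLift G y t ∂μT := rfl
  rw [this]
  refine (norm_integral_le_of_norm_le_const (C := C) (Eventually.of_forall fun t => ?_)).trans ?_
  · rw [norm_smul]
    have h1 : ‖mFourier (-ν) t‖ ≤ 1 := by
      simpa [mFourier_norm] using (mFourier (-ν)).norm_coe_le_norm t
    calc _ ≤ 1 * C := mul_le_mul h1 (hC t trivial) (norm_nonneg _) zero_le_one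
      _ = C := one_mul C
  · simp

lemma summable_exp_neg_abs {c : ℝ} (hc : 0 < c) :
    Summable fun ν : Fin 3 → ℤ => Real.exp (-(c * ∑ j, |(ν j : ℝ)|)) := by
  have h1 : Summable fun n : ℤ => Real.exp (-(c * |(n : ℝ)|)) := by
    have h0 : Summable fun n : ℕ => Real.exp (-(c * |((n : ℤ) : ℝ)|)) := by
      have := Real.summable_exp_nat_mul_iff.2 (neg_lt_zero.2 hc)
      refine this.congr fun n => ?_
      simp; ring_nf
    refine Summable.of_nat_of_neg h0 (h0.congr fun n => by simp)
  have h2 := (h1.mul_of_nonneg (h1.mul_of_nonneg h1 (fun _ => (Real.exp_pos _).le)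
    (fun _ => (Real.exp_pos _).le)) (fun _ => (Real.exp_pos _).le)
    (fun _ => mul_nonneg (Real.exp_pos _).le (Real.exp_pos _).le))
  let e : (Fin 3 → ℤ) ≃ ℤ × ℤ × ℤ :=
    { toFun := fun ν => (ν 0, ν 1, ν 2)
      invFun := fun t => ![t.1, t.2.1, t.2.2]
      left_inv := fun ν => by ext i; fin_cases i <;> rfl
      right_inv := fun t => rfl }
  rw [← e.summable_iff] at h2
  refine h2.congr fun ν => ?_
  change Real.exp (-(c * |(ν 0 : ℝ)|)) *
    (Real.exp (-(c * |(ν 1 : ℝ)|)) * Real.exp (-(c * |(ν 2 : ℝ)|))) = _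
  simp only [Fin.sum_univ_three, ← Real.exp_add]
  congr 1; ring

/-- If the normalized coefficients do not depend on the height, then they decay exponentially, as
the height may be moved by `ε` against the signs of `ν`. -/
lemma summable_mFourierCoeff {V : Set (Fin 3 → ℝ)} {G : (Fin 3 → ℂ) → ℂ}
    (hG : IsPeriodicOnTube V G) (hV : IsOpen V)
    (hconst : ∀ y ∈ V, ∀ y' ∈ V, ∀ ν, tubeCoeff G y ν = tubeCoeff G y' ν) {y : Fin 3 → ℝ}
    (hy : y ∈ V) : Summable fun ν => ‖mFourierCoeff (torusLift G y) ν‖ := by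
  obtain ⟨ε, hε, hball⟩ := Metric.isOpen_iff.1 hV y hy
  -- the eight points around `y`
  let pt : (Fin 3 → Bool) → Fin 3 → ℝ := fun σ j => y j + (if σ j then ε / 2 else -(ε / 2))
  have hpt : ∀ σ, pt σ ∈ V := by
    intro σ
    apply hball
    rw [Metric.mem_ball, dist_pi_lt_iff hε]
    intro j
    simp only [pt, Real.dist_eq]
    split_ifs <;> simp only [add_sub_cancel_left, abs_neg, abs_of_pos (half_pos hε), half_lt_self hε]
  choose C hC using fun σ => exists_bound_mFourierCoeff hG (hpt σ)
  have hC0 : ∀ σ, 0 ≤ C σ := fun σ => (norm_nonneg _).trans (hC σ 0)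
  have hc : 0 < 2 * Real.pi * (ε / 2) := by positivity
  refine Summable.of_nonneg_of_le (fun _ => norm_nonneg _) (fun ν => ?_)
    ((summable_exp_neg_abs hc).mul_left (∑ σ, C σ))
  let σ : Fin 3 → Bool := fun j => decide (ν j < 0)
  have h1 := hconst y hy _ (hpt σ) ν
  have h2 : mFourierCoeff (torusLift G y) ν = mFourierCoeff (torusLift G (pt σ)) ν *
      (expLin (-ν) (fun j => (pt σ j : ℂ) * Complex.I) *
        expLin ν (fun j => (y j : ℂ) * Complex.I)) := by
    rw [← mul_assoc]
    change _ = tubeCoeff G (pt σ) ν * _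
    rw [← h1, tubeCoeff, expLin_neg, mul_assoc, inv_mul_cancel₀ (expLin_ne_zero _ _), mul_one]
  rw [h2, norm_mul, norm_mul, norm_expLin_I, norm_expLin_I, ← Real.exp_add]
  have h3 : -(2 * Real.pi * ∑ j, ((-ν) j : ℤ) * pt σ j) + -(2 * Real.pi * ∑ j, (ν j : ℝ) * y j) =
      -(2 * Real.pi * (ε / 2) * ∑ j, |(ν j : ℝ)|) := by
    have h4 : ∀ j, ((-ν) j : ℤ) * pt σ j = - (ν j * y j) + ε / 2 * |(ν j : ℝ)| := by
      intro j
      simp only [pt, σ, decide_eq_true_eq, Pi.neg_apply, Int.cast_neg]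
      split_ifs with h
      · rw [abs_of_neg (by exact_mod_cast h)]; ring
      · rw [abs_of_nonneg (by exact_mod_cast not_lt.1 h)]; ring
    simp_rw [h4, Finset.sum_add_distrib, Finset.sum_neg_distrib, ← Finset.mul_sum]
    ring
  rw [h3]
  refine mul_le_mul_of_nonneg_right ((hC σ ν).trans ?_) (Real.exp_pos _).le
  exact Finset.single_le_sum (fun σ _ => hC0 σ) (Finset.mem_univ σ)

/-- The cone `y₀ > 0`, `y₀ y₂ > c y₁²`. -/
def cone (c : ℝ) : Set (Fin 3 → ℝ) := {y | 0 < y 0 ∧ c * y 1 ^ 2 < y 0 * y 2}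

lemma isOpen_cone (c : ℝ) : IsOpen (cone c) := by
  have h0 : ∀ i : Fin 3, Continuous fun y : Fin 3 → ℝ => y i := fun i => continuous_apply i
  exact (isOpen_lt continuous_const (h0 0)).inter
    (isOpen_lt (continuous_const.mul ((h0 1).pow 2)) ((h0 0).mul (h0 2)))

/-- On the cone the coefficients do not depend on the height: two points are joined by increasing
the outer coordinates, changing the middle one, and decreasing the outer ones. -/
lemma tubeCoeff_eq_of_mem_cone {c : ℝ} (hc : 0 < c) {G : (Fin 3 → ℂ) → ℂ}
    (hG : IsPeriodicOnTube (cone c) G) {y y' : Fin 3 → ℝ} (hy : y ∈ cone c) (hy' : y' ∈ cone c)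
    (ν : Fin 3 → ℤ) : tubeCoeff G y ν = tubeCoeff G y' ν := by
  have pos2 : ∀ {y : Fin 3 → ℝ}, y ∈ cone c → 0 < y 2 := by
    intro y hy
    have h1 : 0 ≤ c * y 1 ^ 2 := by positivity
    exact (mul_pos_iff_of_pos_left hy.1).1 (h1.trans_lt hy.2)
  have mem_of_le : ∀ {a b a' b' v : ℝ}, ![a, v, b] ∈ cone c → a ≤ a' → b ≤ b' →
      ![a', v, b'] ∈ cone c := by
    intro a b a' b' v h ha hb
    have hb0 := pos2 h
    have h0 : 0 < a := h.1
    have h1 : c * v ^ 2 < a * b := h.2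
    refine ⟨h0.trans_le ha, ?_⟩
    change c * v ^ 2 < a' * b'
    exact h1.trans_le (mul_le_mul ha hb (le_of_lt hb0) (h0.le.trans ha))
  -- raising the outer coordinates
  have raise : ∀ {a b a' b' v : ℝ}, ![a, v, b] ∈ cone c → a ≤ a' → b ≤ b' →
      tubeCoeff G ![a', v, b'] ν = tubeCoeff G ![a, v, b] ν := by
    intro a b a' b' v h ha hb
    have e1 : ∀ u : ℝ, (![a, v, b] : Fin 3 → ℝ) + Pi.single 0 u = ![a + u, v, b] := by
      intro u; ext i; fin_cases i <;> simp
    have e2 : ∀ u : ℝ, (![a', v, b] : Fin 3 → ℝ) + Pi.single 2 u = ![a', v, b + u] := by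
      intro u; ext i; fin_cases i <;> simp
    have s1 := tubeCoeff_shift hG (y := ![a, v, b]) 0 (a' - a) (fun u hu => by
      rw [Set.uIcc_of_le (by linarith)] at hu
      rw [e1]; exact mem_of_le h (by linarith [hu.1]) le_rfl) ν
    have s2 := tubeCoeff_shift hG (y := ![a', v, b]) 2 (b' - b) (fun u hu => by
      rw [Set.uIcc_of_le (by linarith)] at hu
      rw [e2]; exact mem_of_le h ha (by linarith [hu.1])) ν
    rw [e1, add_sub_cancel] at s1
    rw [e2, add_sub_cancel] at s2
    rw [s2, s1]
  have eta : ∀ y : Fin 3 → ℝ, y = ![y 0, y 1, y 2] := by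
    intro y; ext i; fin_cases i <;> rfl
  set A := max (y 0) (y' 0)
  set B := max (y 2) (y' 2)
  rw [eta y] at hy ⊢
  rw [eta y'] at hy' ⊢
  rw [← raise hy (le_max_left (y 0) (y' 0)) (le_max_left (y 2) (y' 2)),
    ← raise hy' (le_max_right (y 0) (y' 0)) (le_max_right (y 2) (y' 2))]
  have m1 : ![A, y 1, B] ∈ cone c := mem_of_le hy (le_max_left _ _) (le_max_left _ _)
  have m2 : ![A, y' 1, B] ∈ cone c := mem_of_le hy' (le_max_right _ _) (le_max_right _ _)
  have e : ∀ u : ℝ, (![A, y 1, B] : Fin 3 → ℝ) + Pi.single 1 u = ![A, y 1 + u, B] := by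
    intro u; ext i; fin_cases i <;> simp
  have s := tubeCoeff_shift hG (y := ![A, y 1, B]) 1 (y' 1 - y 1) (fun u hu => by
    rw [e]
    refine ⟨m1.1, ?_⟩
    have h1 : c * y 1 ^ 2 < A * B := m1.2
    have h2 : c * y' 1 ^ 2 < A * B := m2.2
    change c * (y 1 + u) ^ 2 < A * B
    have h3 : (y 1 + u) ^ 2 ≤ max (y 1 ^ 2) (y' 1 ^ 2) := by
      rcases Set.mem_uIcc.1 hu with h | h
      · rcases le_total 0 (y 1 + u) with h0 | h0
        · exact le_max_of_le_right (by nlinarith)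
        · exact le_max_of_le_left (by nlinarith)
      · rcases le_total 0 (y 1 + u) with h0 | h0
        · exact le_max_of_le_left (by nlinarith)
        · exact le_max_of_le_right (by nlinarith)
    rcases max_cases (y 1 ^ 2) (y' 1 ^ 2) with h | h <;> rw [h.1] at h3 <;> nlinarith) ν
  rw [e, add_sub_cancel] at s
  exact s.symm

/-- The Fourier expansion of a periodic holomorphic function on the tube over a cone. -/
theorem hasSum_of_isPeriodicOnTube_cone {c : ℝ} (hc : 0 < c) {G : (Fin 3 → ℂ) → ℂ}
    (hG : IsPeriodicOnTube (cone c) G) :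
    ∃ b : (Fin 3 → ℤ) → ℂ, ∀ x y, y ∈ cone c →
      HasSum (fun ν => b ν * expLin ν (tubePoint x y)) (G (tubePoint x y)) := by
  have h1 : (![1, 0, 1] : Fin 3 → ℝ) ∈ cone c := by
    refine ⟨?_, ?_⟩ <;> simp
  refine ⟨tubeCoeff G ![1, 0, 1], fun x y hy => ?_⟩
  have h := hasSum_tubeCoeff hG (x := x) hy (summable_mFourierCoeff hG (isOpen_cone c)
    (fun y hy y' hy' ν => tubeCoeff_eq_of_mem_cone hc hG hy hy' ν) hy)
  refine h.congr_fun fun ν => ?_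
  rw [tubeCoeff_eq_of_mem_cone hc hG hy h1]

noncomputable local instance : MeasureSpace UnitAddCircle := ⟨AddCircle.haarAddCircle⟩

local instance : IsProbabilityMeasure (volume : Measure UnitAddCircle) :=
  inferInstanceAs (IsProbabilityMeasure AddCircle.haarAddCircle)

/-- The coefficients of an absolutely convergent Fourier series are determined by its values. -/
lemma eq_zero_of_hasSum_expLin [Fintype d] {b : (d → ℤ) → ℂ} (hb : Summable fun ν => ‖b ν‖)
    (h : ∀ x : d → ℝ, HasSum (fun ν => b ν * expLin ν (fun j => (x j : ℂ))) 0) (ν : d → ℤ) :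
    b ν = 0 := by
  have hs : Summable fun ν => b ν • (mFourier ν : C(UnitAddTorus d, ℂ)) := by
    refine Summable.of_norm ?_
    simpa only [norm_smul, mFourier_norm, mul_one] using hb
  obtain ⟨g, hg⟩ := hs
  have hg0 : g = 0 := by
    ext t
    obtain ⟨x, rfl⟩ := isOpenQuotientMap_torusMk.surjective t
    have h1 := (ContinuousMap.evalCLM ℂ (torusMk x)).hasSum hg
    refine h1.unique ?_
    refine (h x).congr_fun fun ν => ?_
    rw [← mFourier_torusMk]; rfl
  rw [hg0] at hg
  have h2 := (ContinuousMap.toLp (E := ℂ) 2 (volume : Measure (UnitAddTorus d)) ℂ).hasSum hg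
  have h3 := (innerSL ℂ (mFourierLp (d := d) 2 ν)).hasSum h2
  have h4 : (fun n => (innerSL ℂ (mFourierLp (d := d) 2 ν))
      ((ContinuousMap.toLp (E := ℂ) 2 (volume : Measure (UnitAddTorus d)) ℂ)
        (b n • (mFourier n : C(UnitAddTorus d, ℂ))))) = fun n => if n = ν then b ν else 0 := by
    funext n
    rw [map_smul, innerSL_apply_apply, inner_smul_right]
    have := (orthonormal_iff_ite.1 (orthonormal_mFourier (d := d))) ν n
    rw [this]
    split_ifs with h5 h6 h6
    · rw [h5, mul_one]
    · exact absurd h5.symm h6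
    · exact absurd h6.symm h5
    · rw [mul_zero]
  rw [show (fun n => if n = ν then b ν else 0) = fun n => if n = ν then b ν else 0 from rfl] at h4
  have h5 : HasSum (fun n => if n = ν then b ν else 0) (0 : ℂ) := by
    rw [← h4]; simpa [Function.comp_def] using! h3
  exact (hasSum_ite_eq ν (b ν)).unique h5

end Tube

/-! ### The entries of elements of the paramodular group -/

/-- The generators of the fractional ideals containing the entries of the elements of `K(N)`. -/
def entryScale (N : ℕ) : Mat4 :=
  fromBlocks !![1, (N : ℚ); 1, 1] !![1, 1; 1, 1 / (N : ℚ)]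
    !![1, (N : ℚ); (N : ℚ), (N : ℚ)] !![1, 1; (N : ℚ), 1]

/-- All entries of `g` lie in the fractional ideals prescribed by `entryScale`. -/
def IsIntegralAt (N : ℕ) (g : Mat4) : Prop := ∀ i j, ∃ z : ℤ, g i j = entryScale N i j * z

/-- A matrix is the matrix of an element of `K(N)`, in terms of its entries. -/
structure InK (N : ℕ) (g : Mat4) : Prop where
  mem : g ∈ symplecticGroup (Fin 2) ℚ
  integral : IsIntegralAt N g

/-- The inverse of a symplectic matrix in terms of its blocks. -/
lemma coe_inv_eq_fromBlocks (g : symplecticGroup (Fin 2) ℚ) :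
    ((g⁻¹ : symplecticGroup (Fin 2) ℚ) : Mat4) =
      fromBlocks (g : Mat4).toBlocks₂₂ᵀ (-(g : Mat4).toBlocks₁₂ᵀ)
        (-(g : Mat4).toBlocks₂₁ᵀ) (g : Mat4).toBlocks₁₁ᵀ := by
  rw [SymplecticGroup.coe_inv]
  conv_lhs => rw [← fromBlocks_toBlocks (g : Mat4), J, fromBlocks_transpose, fromBlocks_neg,
    fromBlocks_multiply, fromBlocks_multiply]
  simp

lemma mulVec_mem_lattice {N : ℕ} (hN : 0 < N) {g : Mat4} (hg : IsIntegralAt N g)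
    {v : Fin 2 ⊕ Fin 2 → ℚ} (hv : v ∈ lattice N) : g *ᵥ v ∈ lattice N := by
  choose z hz using hg
  obtain ⟨a, b, c, d, rfl⟩ := hv
  have hN' : (N : ℚ) ≠ 0 := by exact_mod_cast hN.ne'
  refine ⟨z (.inl 0) (.inl 0) * a + N * z (.inl 0) (.inl 1) * b + z (.inl 0) (.inr 0) * c
      + N * z (.inl 0) (.inr 1) * d,
    z (.inl 1) (.inl 0) * a + z (.inl 1) (.inl 1) * b + z (.inl 1) (.inr 0) * c
      + z (.inl 1) (.inr 1) * d,
    z (.inr 0) (.inl 0) * a + N * z (.inr 0) (.inl 1) * b + z (.inr 0) (.inr 0) * c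
      + N * z (.inr 0) (.inr 1) * d,
    z (.inr 1) (.inl 0) * a + z (.inr 1) (.inl 1) * b + z (.inr 1) (.inr 0) * c
      + z (.inr 1) (.inr 1) * d, ?_⟩
  funext i
  rcases i with i | i <;> fin_cases i <;>
  · simp [mulVec, dotProduct, Fintype.sum_sum_type, Fin.sum_univ_two, hz, entryScale]
    field_simp
    try ring

lemma isIntegralAt_inv {N : ℕ} {g : symplecticGroup (Fin 2) ℚ} (hg : IsIntegralAt N g) :
    IsIntegralAt N ((g⁻¹ : symplecticGroup (Fin 2) ℚ) : Mat4) := by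
  choose z hz using hg
  rw [coe_inv_eq_fromBlocks]
  intro i j
  rcases i with i | i <;> rcases j with j | j
  · refine ⟨z (.inr j) (.inr i), ?_⟩
    fin_cases i <;> fin_cases j <;> simp [toBlocks₂₂, hz, entryScale]
  · refine ⟨-z (.inl j) (.inr i), ?_⟩
    fin_cases i <;> fin_cases j <;> simp [toBlocks₁₂, hz, entryScale]
  · refine ⟨-z (.inr j) (.inl i), ?_⟩
    fin_cases i <;> fin_cases j <;> simp [toBlocks₂₁, hz, entryScale]
  · refine ⟨z (.inl j) (.inl i), ?_⟩
    fin_cases i <;> fin_cases j <;> simp [toBlocks₁₁, hz, entryScale]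

lemma mem_paramodularGroup_of_isIntegralAt {N : ℕ} (hN : 0 < N) {g : symplecticGroup (Fin 2) ℚ}
    (hg : IsIntegralAt N g) : g ∈ paramodularGroup N := by
  intro v
  refine ⟨fun h => ?_, fun h => mulVec_mem_lattice hN hg h⟩
  have h1 := mulVec_mem_lattice hN (isIntegralAt_inv hg) h
  rwa [mulVec_mulVec, show ((g⁻¹ : symplecticGroup (Fin 2) ℚ) : Mat4) * (g : Mat4)
    = ((g⁻¹ * g : symplecticGroup (Fin 2) ℚ) : Mat4) from rfl, inv_mul_cancel,
    show ((1 : symplecticGroup (Fin 2) ℚ) : Mat4) = 1 from rfl, one_mulVec] at h1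

/-- The integrality of the columns that comes from the lattice alone. -/
lemma columns_of_mem {N : ℕ} (hN : 0 < N) {g : symplecticGroup (Fin 2) ℚ}
    (hg : g ∈ paramodularGroup N) :
    (∀ i j, ∃ z : ℤ, (g : Mat4) (.inl i) (.inl j) = z) ∧
    (∀ i, ∃ z : ℤ, (g : Mat4) (.inl i) (.inr 0) = z) ∧
    (∀ i, ∃ z : ℤ, (g : Mat4) (.inl i) (.inr 1) = 1 / N * z) ∧
    (∀ j, ∃ z : ℤ, (g : Mat4) (.inr 0) (.inl j) = z) ∧
    (∀ j, ∃ z : ℤ, (g : Mat4) (.inr 1) (.inl j) = N * z) ∧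
    (∃ z : ℤ, (g : Mat4) (.inr 0) (.inr 0) = z) ∧
    (∃ z : ℤ, (g : Mat4) (.inr 1) (.inr 0) = N * z) ∧
    (∃ z : ℤ, (g : Mat4) (.inr 1) (.inr 1) = z) := by
  have hN' : (N : ℚ) ≠ 0 := by exact_mod_cast hN.ne'
  have col : ∀ a b c d : ℤ, (g : Mat4) *ᵥ (Sum.elim ![(a : ℚ), b] ![(c : ℚ), N * d]) ∈ lattice N :=
    fun a b c d => (hg _).2 ⟨a, b, c, d, rfl⟩
  obtain ⟨a1, b1, c1, d1, h1⟩ := col 1 0 0 0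
  obtain ⟨a2, b2, c2, d2, h2⟩ := col 0 1 0 0
  obtain ⟨a3, b3, c3, d3, h3⟩ := col 0 0 1 0
  obtain ⟨a4, b4, c4, d4, h4⟩ := col 0 0 0 1
  have e1 : ∀ i, (g : Mat4) i (.inl 0) = Sum.elim ![(a1 : ℚ), b1] ![(c1 : ℚ), N * d1] i :=
    fun i => by
      simpa [mulVec, dotProduct, Fintype.sum_sum_type, Fin.sum_univ_two] using congrFun h1 i
  have e2 : ∀ i, (g : Mat4) i (.inl 1) = Sum.elim ![(a2 : ℚ), b2] ![(c2 : ℚ), N * d2] i :=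
    fun i => by
      simpa [mulVec, dotProduct, Fintype.sum_sum_type, Fin.sum_univ_two] using congrFun h2 i
  have e3 : ∀ i, (g : Mat4) i (.inr 0) = Sum.elim ![(a3 : ℚ), b3] ![(c3 : ℚ), N * d3] i :=
    fun i => by
      simpa [mulVec, dotProduct, Fintype.sum_sum_type, Fin.sum_univ_two] using congrFun h3 i
  have e4 : ∀ i, (g : Mat4) i (.inr 1) * N = Sum.elim ![(a4 : ℚ), b4] ![(c4 : ℚ), N * d4] i :=
    fun i => by
      simpa [mulVec, dotProduct, Fintype.sum_sum_type, Fin.sum_univ_two] using congrFun h4 i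
  refine ⟨?_, ?_, ?_, ?_, ?_, ?_, ?_, ?_⟩
  · intro i j
    fin_cases i <;> fin_cases j
    exacts [⟨a1, e1 _⟩, ⟨a2, e2 _⟩, ⟨b1, e1 _⟩, ⟨b2, e2 _⟩]
  · intro i
    fin_cases i
    exacts [⟨a3, e3 _⟩, ⟨b3, e3 _⟩]
  · intro i
    fin_cases i
    · exact ⟨a4, by have := e4 (.inl 0); simp at this ⊢; field_simp; linarith⟩
    · exact ⟨b4, by have := e4 (.inl 1); simp at this ⊢; field_simp; linarith⟩
  · intro j
    fin_cases j
    exacts [⟨c1, e1 _⟩, ⟨c2, e2 _⟩]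
  · intro j
    fin_cases j
    exacts [⟨d1, e1 _⟩, ⟨d2, e2 _⟩]
  · exact ⟨c3, e3 _⟩
  · exact ⟨d3, e3 _⟩
  · refine ⟨d4, ?_⟩
    have := e4 (.inr 1)
    simp only [Sum.elim_inr, cons_val_one, cons_val_fin_one] at this
    exact mul_right_cancel₀ hN' (this.trans (mul_comm _ _))

lemma isIntegralAt_of_mem {N : ℕ} (hN : 0 < N) {g : symplecticGroup (Fin 2) ℚ}
    (hg : g ∈ paramodularGroup N) : IsIntegralAt N g := by
  obtain ⟨p1, p2, p3, p4, p5, p6, p7, p8⟩ := columns_of_mem hN hg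
  -- the inverse preserves the lattice as well, so that `g` preserves the dual lattice
  obtain ⟨q1, q2, q3, q4, q5, q6, q7, q8⟩ := columns_of_mem hN (inv_mem hg)
  rw [coe_inv_eq_fromBlocks] at q1 q2 q3 q4 q5 q6 q7 q8
  simp only [fromBlocks_apply₁₁, fromBlocks_apply₁₂, fromBlocks_apply₂₁, fromBlocks_apply₂₂,
    transpose_apply, Matrix.neg_apply, toBlocks₁₁, toBlocks₁₂, toBlocks₂₁, toBlocks₂₂, of_apply]
    at q1 q2 q3 q4 q5 q6 q7 q8
  intro i j
  rcases i with i | i <;> rcases j with j | j <;> fin_cases i <;> fin_cases j <;>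
    simp only [entryScale, fromBlocks_apply₁₁, fromBlocks_apply₁₂, fromBlocks_apply₂₁,
      fromBlocks_apply₂₂, Fin.zero_eta, Fin.mk_one, of_apply, cons_val_zero, cons_val_one,
      cons_val_fin_one, one_mul, Fin.isValue]
  · exact p1 0 0
  · exact q7
  · exact p1 1 0
  · exact p1 1 1
  · exact p2 0
  · obtain ⟨z, hz⟩ := q2 1
    exact ⟨-z, by push_cast; linarith⟩
  · exact p2 1
  · exact p3 1
  · exact p4 0
  · obtain ⟨z, hz⟩ := q5 0
    exact ⟨-z, by push_cast; linarith⟩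
  · exact p5 0
  · exact p5 1
  · exact p6
  · exact q1 1 0
  · exact p7
  · exact p8

lemma inK_iff {N : ℕ} (hN : 0 < N) {g : Mat4} :
    InK N g ↔ ∃ κ ∈ paramodularGroup N, (κ : Mat4) = g :=
  ⟨fun h => ⟨⟨g, h.mem⟩, mem_paramodularGroup_of_isIntegralAt hN h.integral, rfl⟩,
    by rintro ⟨κ, hκ, rfl⟩; exact ⟨κ.2, isIntegralAt_of_mem hN hκ⟩⟩

lemma InK.mul {N : ℕ} (hN : 0 < N) {g h : Mat4} (hg : InK N g) (hh : InK N h) : InK N (g * h) := by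
  obtain ⟨κ, hκ, rfl⟩ := (inK_iff hN).1 hg
  obtain ⟨κ', hκ', rfl⟩ := (inK_iff hN).1 hh
  exact (inK_iff hN).2 ⟨κ * κ', mul_mem hκ hκ', rfl⟩

lemma InK.isUnit_det {N : ℕ} {g : Mat4} (hg : InK N g) : IsUnit g.det :=
  SymplecticGroup.symplectic_det hg.mem

lemma InK.inv {N : ℕ} (hN : 0 < N) {g : Mat4} (hg : InK N g) : InK N g⁻¹ := by
  obtain ⟨κ, hκ, rfl⟩ := (inK_iff hN).1 hg
  refine (inK_iff hN).2 ⟨κ⁻¹, inv_mem hκ, ?_⟩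
  refine (Matrix.inv_eq_left_inv ?_).symm
  exact congrArg Subtype.val (inv_mul_cancel κ)

lemma slash_eq_of_inK {k : ℤ} {N : ℕ} (hN : 0 < N) {f : Siegel → ℂ} (hf : IsParamodularForm k N f)
    {g : Mat4} (hg : InK N g) : slash k f g = f := by
  obtain ⟨κ, hκ, rfl⟩ := (inK_iff hN).1 hg
  exact hf.invariant κ hκ

/-- Symplecticity of a matrix with zero lower left block. -/
lemma isSimilitude_fromBlocks {A B D : Mat2} {m : ℚ} (hm : 0 < m) (h1 : Aᵀ * D = m • 1)
    (h2 : Dᵀ * B = Bᵀ * D) : IsSimilitude (fromBlocks A B 0 D) m := by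
  refine ⟨hm, ?_⟩
  have h3 : Dᵀ * A = m • 1 := by
    have := congrArg transpose h1
    simpa using this
  rw [J, fromBlocks_transpose, fromBlocks_multiply, fromBlocks_multiply, fromBlocks_smul]
  simp [h1, h2, h3]

/-! ### Coordinates on the Siegel upper half space -/

lemma posDef_fin_two_iff {Y : Matrix (Fin 2) (Fin 2) ℝ} (hs : Y 1 0 = Y 0 1) :
    Y.PosDef ↔ 0 < Y 0 0 ∧ Y 0 1 ^ 2 < Y 0 0 * Y 1 1 := by
  have form : ∀ x : Fin 2 → ℝ, star x ⬝ᵥ (Y *ᵥ x) =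
      Y 0 0 * x 0 ^ 2 + 2 * Y 0 1 * x 0 * x 1 + Y 1 1 * x 1 ^ 2 := by
    intro x
    simp [dotProduct, mulVec, Fin.sum_univ_two, hs]; ring
  constructor
  · intro h
    have h0 : 0 < Y 0 0 := h.diag_pos
    refine ⟨h0, ?_⟩
    have h1 := h.dotProduct_mulVec_pos (x := ![-Y 0 1, Y 0 0]) (by
      intro h2; have := congrFun h2 1; simp at this; exact h0.ne' this)
    rw [form] at h1
    simp only [cons_val_zero, cons_val_one, cons_val_fin_one] at h1
    have h2 : 0 < Y 0 0 * (Y 0 0 * Y 1 1 - Y 0 1 ^ 2) := by linarith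
    linarith [(mul_pos_iff_of_pos_left h0).1 h2]
  · rintro ⟨h0, h1⟩
    refine PosDef.of_dotProduct_mulVec_pos ?_ ?_
    · ext i j
      fin_cases i <;> fin_cases j <;> simp [hs]
    · intro x hx
      rw [form]
      have e : Y 0 0 * (Y 0 0 * x 0 ^ 2 + 2 * Y 0 1 * x 0 * x 1 + Y 1 1 * x 1 ^ 2) =
          (Y 0 0 * x 0 + Y 0 1 * x 1) ^ 2 + (Y 0 0 * Y 1 1 - Y 0 1 ^ 2) * x 1 ^ 2 := by ring
      refine (mul_pos_iff_of_pos_left h0).1 ?_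
      rw [e]
      by_cases hx1 : x 1 = 0
      · have hx0 : x 0 ≠ 0 := by
          intro hx0; apply hx; ext i; fin_cases i <;> assumption
        rw [hx1]
        have : 0 < (Y 0 0 * x 0) ^ 2 := by positivity
        simpa using this
      · have h2 : 0 < Y 0 0 * Y 1 1 - Y 0 1 ^ 2 := by linarith
        have h3 : 0 < x 1 ^ 2 := by positivity
        nlinarith [sq_nonneg (Y 0 0 * x 0 + Y 0 1 * x 1), mul_pos h2 h3]

lemma coordMatrix_mem_iff (w : ℂ × ℂ × ℂ) :
    coordMatrix w ∈ siegelSet ↔ 0 < w.1.im ∧ w.2.1.im ^ 2 < w.1.im * w.2.2.im := by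
  have h1 : (coordMatrix w).IsSymm := by
    ext i j; fin_cases i <;> fin_cases j <;> simp [coordMatrix]
  have h2 : ((coordMatrix w).map Complex.im) 1 0 = ((coordMatrix w).map Complex.im) 0 1 := by
    simp [coordMatrix]
  simp only [siegelSet, Set.mem_ofPred_eq, h1, true_and]
  rw [posDef_fin_two_iff h2]
  simp [coordMatrix]

lemma eq_coordMatrix {Z : Matrix (Fin 2) (Fin 2) ℂ} (hZ : Z.IsSymm) :
    Z = coordMatrix (Z 0 0, Z 0 1, Z 1 1) := by
  have h : Z 1 0 = Z 0 1 := congrFun (congrFun hZ 0) 1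
  ext i j; fin_cases i <;> fin_cases j <;> simp [coordMatrix, h]

lemma isOpen_coord : IsOpen {w : ℂ × ℂ × ℂ | coordMatrix w ∈ siegelSet} := by
  have e : {w : ℂ × ℂ × ℂ | coordMatrix w ∈ siegelSet} =
      {w | 0 < w.1.im} ∩ {w | w.2.1.im ^ 2 < w.1.im * w.2.2.im} := by
    ext w; exact coordMatrix_mem_iff w
  rw [e]
  have c1 : Continuous fun w : ℂ × ℂ × ℂ => w.1.im := Complex.continuous_im.comp continuous_fst
  have c2 : Continuous fun w : ℂ × ℂ × ℂ => w.2.1.im :=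
    Complex.continuous_im.comp (continuous_fst.comp continuous_snd)
  have c3 : Continuous fun w : ℂ × ℂ × ℂ => w.2.2.im :=
    Complex.continuous_im.comp (continuous_snd.comp continuous_snd)
  exact (isOpen_lt continuous_const c1).inter (isOpen_lt (c2.pow 2) (c1.mul c3))

/-! ### The slash operator for block upper triangular matrices -/

/-- The complexification of a rational `2 × 2` matrix. -/
noncomputable def cplx2 (A : Mat2) : Matrix (Fin 2) (Fin 2) ℂ := A.map (fun x : ℚ => (x : ℂ))

lemma cplx2_mul (A B : Mat2) : cplx2 (A * B) = cplx2 A * cplx2 B :=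
  Matrix.map_mul (f := Rat.castHom ℂ)

lemma cplx2_one : cplx2 1 = 1 := Matrix.map_one _ Rat.cast_zero Rat.cast_one

lemma cplx2_smul (m : ℚ) (A : Mat2) : cplx2 (m • A) = (m : ℂ) • cplx2 A := by
  ext i j; simp [cplx2]

lemma det_cplx2 (A : Mat2) : (cplx2 A).det = (A.det : ℂ) :=
  (RingHom.map_det (Rat.castHom ℂ) A).symm

lemma trace_cplx2 (A : Mat2) : (cplx2 A).trace = (A.trace : ℂ) := by
  simp [cplx2, Matrix.trace]

lemma num_fromBlocks (A B C D : Mat2) (Z : Matrix (Fin 2) (Fin 2) ℂ) :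
    num (fromBlocks A B C D) Z = cplx2 A * Z + cplx2 B := by
  rw [num, cplx, fromBlocks_map]; rfl

lemma den_fromBlocks (A B C D : Mat2) (Z : Matrix (Fin 2) (Fin 2) ℂ) :
    den (fromBlocks A B C D) Z = cplx2 C * Z + cplx2 D := by
  rw [den, cplx, fromBlocks_map]; rfl

lemma den_fromBlocks_zero (A B D : Mat2) (Z : Matrix (Fin 2) (Fin 2) ℂ) :
    den (fromBlocks A B 0 D) Z = cplx2 D := by
  rw [den_fromBlocks]
  simp [cplx2]

lemma slash_fromBlocks (k : ℤ) (f : Siegel → ℂ) {A B D : Mat2} {m : ℚ}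
    (h : IsSimilitude (fromBlocks A B 0 D) m) (Ω : Siegel) :
    slash k f (fromBlocks A B 0 D) Ω = (m : ℂ) ^ (2 * k - 3) * (D.det : ℂ) ^ (-k) *
      extend f ((cplx2 A * Ω.1 + cplx2 B) * (cplx2 D)⁻¹) := by
  rw [slash_apply, h.multiplier_eq, num_fromBlocks, den_fromBlocks_zero, det_cplx2]

lemma IsSimilitude.blocks {A B D : Mat2} {m : ℚ} (h : IsSimilitude (fromBlocks A B 0 D) m) :
    Aᵀ * D = m • 1 ∧ Dᵀ * A = m • 1 := by
  have e := h.eq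
  rw [J, fromBlocks_transpose, fromBlocks_multiply, fromBlocks_multiply, fromBlocks_smul,
    fromBlocks_inj] at e
  obtain ⟨-, e2, e3, -⟩ := e
  simp at e2 e3
  exact ⟨e2, e3⟩

/-! ### Expansions with bounded denominators -/

/-- The expansion `f(Ω) = ∑ a(t) exp(2πi tr(tΩ))`, where `t` runs over all symmetric matrices with
some common denominator. -/
structure HasExpansion (f : Siegel → ℂ) (a : Mat2 → ℂ) : Prop where
  support : ∃ Q : ℕ, 0 < Q ∧ ∀ t, a t ≠ 0 → t 1 0 = t 0 1 ∧ ∀ i j, ∃ z : ℤ, (Q : ℚ) * t i j = z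
  hasSum : ∀ Ω, HasSum (fun t : Mat2 => a t * expTrace t Ω) (f Ω)

lemma HasExpansion.add {f g : Siegel → ℂ} {a b : Mat2 → ℂ} (hf : HasExpansion f a)
    (hg : HasExpansion g b) : HasExpansion (f + g) (a + b) := by
  obtain ⟨Q, hQ, h1⟩ := hf.support
  obtain ⟨R, hR, h2⟩ := hg.support
  refine ⟨⟨Q * R, mul_pos hQ hR, fun t ht => ?_⟩, fun Ω => ?_⟩
  · by_cases ha : a t = 0
    · have hb : b t ≠ 0 := by simpa [ha] using ht
      refine ⟨(h2 t hb).1, fun i j => ?_⟩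
      obtain ⟨z, hz⟩ := (h2 t hb).2 i j
      exact ⟨Q * z, by push_cast; rw [mul_assoc, hz]⟩
    · refine ⟨(h1 t ha).1, fun i j => ?_⟩
      obtain ⟨z, hz⟩ := (h1 t ha).2 i j
      exact ⟨R * z, by push_cast; rw [← hz]; ring⟩
  · refine ((hf.hasSum Ω).add (hg.hasSum Ω)).congr_fun fun t => ?_
    rw [Pi.add_apply, add_mul]

lemma hasExpansion_zero : HasExpansion 0 0 :=
  ⟨⟨1, one_pos, fun t ht => absurd rfl ht⟩, fun Ω => by simp⟩

lemma HasExpansion.sum {ι : Type*} (s : Finset ι) {f : ι → Siegel → ℂ} {a : ι → Mat2 → ℂ}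
    (h : ∀ i ∈ s, HasExpansion (f i) (a i)) : HasExpansion (∑ i ∈ s, f i) (∑ i ∈ s, a i) := by
  classical
  induction s using Finset.induction_on with
  | empty => exact hasExpansion_zero
  | insert i s hi ih =>
    rw [Finset.sum_insert hi, Finset.sum_insert hi]
    exact (h i (Finset.mem_insert_self i s)).add
      (ih fun j hj => h j (Finset.mem_insert_of_mem hj))

/-- The additive character `x ↦ exp(2πix)`. -/
noncomputable def expRat (x : ℚ) : ℂ := Complex.exp (2 * Real.pi * Complex.I * x)

/-- The expansion of `f | g` for a block upper triangular similitude `g = [A, B; 0, D]`. -/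
lemma HasExpansion.slash {k : ℤ} {f : Siegel → ℂ} {a : Mat2 → ℂ} (hf : HasExpansion f a)
    {A B D : Mat2} {m : ℕ} (h : IsSimilitude (fromBlocks A B 0 D) m)
    (hA : ∀ i j, ∃ z : ℤ, A i j = z) :
    HasExpansion (slash k f (fromBlocks A B 0 D)) (fun s => (m : ℂ) ^ (2 * k - 3) *
      (D.det : ℂ) ^ (-k) * expRat ((s * (Dᵀ * B)).trace / m) * a ((1 / m : ℚ) • act s Dᵀ)) := by
  have hm : (m : ℚ) ≠ 0 := h.pos.ne'
  have hmC : (m : ℂ) ≠ 0 := by exact_mod_cast hm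
  obtain ⟨hAD, hDA⟩ := h.blocks
  have hAD' : A * Dᵀ = (m : ℚ) • 1 := by
    have h1 : ((m : ℚ)⁻¹ • Dᵀ) * A = 1 := by
      rw [Matrix.smul_mul, hDA, smul_smul, inv_mul_cancel₀ hm, one_smul]
    have h2 := mul_eq_one_comm.1 h1
    rw [Matrix.mul_smul] at h2
    rw [← h2, smul_smul, mul_inv_cancel₀ hm, one_smul]
  have hDA' : D * Aᵀ = (m : ℚ) • 1 := by
    have := congrArg transpose hAD'
    simpa using this
  let e : Mat2 ≃ Mat2 :=
    { toFun := fun s => (1 / m : ℚ) • act s Dᵀ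
      invFun := fun t => (1 / m : ℚ) • act t A
      left_inv := fun s => by
        simp only [act, transpose_transpose]
        rw [Matrix.mul_smul, Matrix.smul_mul, smul_smul]
        calc _ = (1 / (m : ℚ) * (1 / m)) • ((Aᵀ * D) * s * (Dᵀ * A)) := by
              simp only [Matrix.mul_assoc]
          _ = s := by
              simp only [hAD, hDA, Matrix.smul_mul, Matrix.mul_smul, smul_smul, Matrix.one_mul,
                Matrix.mul_one]
              convert one_smul ℚ s using 2
              field_simp
      right_inv := fun t => by
        simp only [act, transpose_transpose]
        rw [Matrix.mul_smul, Matrix.smul_mul, smul_smul]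
        calc _ = (1 / (m : ℚ) * (1 / m)) • ((D * Aᵀ) * t * (A * Dᵀ)) := by
              simp only [Matrix.mul_assoc]
          _ = t := by
              simp only [hAD', hDA', Matrix.smul_mul, Matrix.mul_smul, smul_smul, Matrix.one_mul,
                Matrix.mul_one]
              convert one_smul ℚ t using 2
              field_simp }
  constructor
  · obtain ⟨Q, hQ, h1⟩ := hf.support
    have hm0 : 0 < m := by exact_mod_cast h.pos
    refine ⟨Q * m, mul_pos hQ hm0, fun s hs => ?_⟩
    have ha : a (e s) ≠ 0 := fun h0 => hs (mul_eq_zero_of_right _ h0)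
    obtain ⟨hsym, hint⟩ := h1 _ ha
    have hs' : s = (1 / m : ℚ) • act (e s) A := (e.symm_apply_apply s).symm
    choose z hz using hA
    choose y hy using hint
    generalize e s = t at *
    constructor
    · rw [hs']
      simp only [act, Matrix.mul_apply, Fin.sum_univ_two, Matrix.smul_apply, smul_eq_mul,
        transpose_apply, hsym]
      ring
    · intro i j
      refine ⟨z 0 i * y 0 0 * z 0 j + z 0 i * y 0 1 * z 1 j + z 1 i * y 1 0 * z 0 j
        + z 1 i * y 1 1 * z 1 j, ?_⟩
      rw [hs']
      simp only [act, Matrix.mul_apply, Fin.sum_univ_two, Matrix.smul_apply, smul_eq_mul,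
        transpose_apply, hz]
      push_cast
      rw [← hy, ← hy, ← hy, ← hy]
      field_simp
      ring
  · intro Ω
    have hΩ' := h.action_mem Ω.2
    rw [num_fromBlocks, den_fromBlocks_zero] at hΩ'
    have hu : IsUnit (cplx2 D).det := by
      have := h.isUnit_det_den Ω.2
      rwa [den_fromBlocks_zero] at this
    rw [slash_fromBlocks k f h, extend_of_mem f hΩ']
    have h1 := (e.hasSum_iff.2 (hf.hasSum ⟨_, hΩ'⟩)).mul_left
      ((m : ℂ) ^ (2 * k - 3) * (D.det : ℂ) ^ (-k))
    rw [Rat.cast_natCast]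
    refine h1.congr_fun fun s => ?_
    have key : expTrace (e s) ⟨_, hΩ'⟩ = expRat ((s * (Dᵀ * B)).trace / m) * expTrace s Ω := by
      rw [expTrace, expTrace, expRat, ← Complex.exp_add]
      congr 1
      change 2 * Real.pi * Complex.I * (cplx2 ((1 / m : ℚ) • act s Dᵀ) *
        ((cplx2 A * Ω.1 + cplx2 B) * (cplx2 D)⁻¹)).trace = _ +
          2 * Real.pi * Complex.I * (cplx2 s * Ω.1).trace
      have t1 : (cplx2 ((1 / m : ℚ) • act s Dᵀ) *
          ((cplx2 A * Ω.1 + cplx2 B) * (cplx2 D)⁻¹)).trace =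
          (cplx2 s * Ω.1).trace + ((s * (Dᵀ * B)).trace : ℂ) / m := by
        rw [← trace_cplx2, ← Matrix.mul_assoc, Matrix.trace_mul_comm, act, transpose_transpose,
          cplx2_smul, Matrix.smul_mul, Matrix.mul_smul, cplx2_mul, cplx2_mul, ← Matrix.mul_assoc,
          ← Matrix.mul_assoc, ← Matrix.mul_assoc, Matrix.nonsing_inv_mul _ hu, Matrix.one_mul,
          Matrix.mul_add, Matrix.mul_assoc (cplx2 s), ← Matrix.mul_assoc (cplx2 Dᵀ), ← cplx2_mul Dᵀ A,
          hDA, cplx2_smul, cplx2_one, Matrix.smul_mul, Matrix.one_mul, Matrix.mul_smul,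
          cplx2_mul, cplx2_mul, Matrix.mul_assoc, smul_add, smul_smul, trace_add, trace_smul,
          trace_smul]
        push_cast
        rw [one_div, inv_mul_cancel₀ hmC, one_smul, smul_eq_mul, div_eq_inv_mul]
      rw [t1]
      push_cast
      ring
    simp only [Function.comp_apply]
    rw [key]
    change _ * _ * _ * a (e s) * _ = _
    ring

/-! ### Uniqueness of expansions -/

/-- The symmetric matrix with entries `ν₀/Q, ν₁/Q, ν₂/Q`. -/
def fineIndex (Q : ℕ) (ν : Fin 3 → ℤ) : Mat2 :=
  !![(ν 0 : ℚ) / Q, ν 1 / Q; ν 1 / Q, ν 2 / Q]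

lemma transpose_fin_two {R : Type*} (a b c d : R) : !![a, b; c, d]ᵀ = !![a, c; b, d] := by
  ext i j; fin_cases i <;> fin_cases j <;> rfl

lemma fineIndex_injective {Q : ℕ} (hQ : 0 < Q) : Function.Injective (fineIndex Q) := by
  intro ν μ h
  have hQ' : (Q : ℚ) ≠ 0 := by exact_mod_cast hQ.ne'
  have h0 := congrFun (congrFun h 0) 0
  have h1 := congrFun (congrFun h 0) 1
  have h2 := congrFun (congrFun h 1) 1
  simp only [fineIndex, of_apply, cons_val_zero, cons_val_one, cons_val_fin_one,
    div_left_inj' hQ'] at h0 h1 h2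
  ext i
  fin_cases i
  exacts [by exact_mod_cast h0, by exact_mod_cast h1, by exact_mod_cast h2]

lemma expTrace_coord (t : Mat2) (ht : t 1 0 = t 0 1) (w : ℂ × ℂ × ℂ) (hw : coordMatrix w ∈ siegelSet) :
    expTrace t ⟨coordMatrix w, hw⟩ = Complex.exp (2 * Real.pi * Complex.I *
      (t 0 0 * w.1 + 2 * t 0 1 * w.2.1 + t 1 1 * w.2.2)) := by
  rw [expTrace]
  congr 2
  simp [coordMatrix, Matrix.trace, Matrix.mul_apply, Fin.sum_univ_two, ht]
  ring

theorem HasExpansion.unique {f : Siegel → ℂ} {a b : Mat2 → ℂ} (ha : HasExpansion f a)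
    (hb : HasExpansion f b) : a = b := by
  obtain ⟨Q, hQ, h1⟩ := ha.support
  obtain ⟨R, hR, h2⟩ := hb.support
  have hc : HasExpansion (f + (-1 : ℂ) • f) (a + (-1 : ℂ) • b) := by
    refine ha.add ⟨⟨R, hR, fun t ht => h2 t fun h0 => ht (by simp [h0])⟩, fun Ω => ?_⟩
    have := (hb.hasSum Ω).mul_left (-1)
    refine this.congr_fun fun t => ?_
    simp
  rw [show f + (-1 : ℂ) • f = 0 by simp] at hc
  suffices h : ∀ t, (a + (-1 : ℂ) • b) t = 0 by
    funext t
    have := h t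
    simp only [Pi.add_apply, Pi.smul_apply, smul_eq_mul, neg_mul, one_mul] at this
    exact sub_eq_zero.1 (by rw [sub_eq_add_neg]; exact this)
  obtain ⟨Q, hQ, h1⟩ := hc.support
  set c := a + (-1 : ℂ) • b
  have hQ' : (Q : ℚ) ≠ 0 := by exact_mod_cast hQ.ne'
  have hQC : (Q : ℂ) ≠ 0 := by exact_mod_cast hQ.ne'
  have hrange : ∀ t, t ∉ Set.range (fineIndex Q) → c t = 0 := by
    intro t ht
    by_contra h0
    obtain ⟨hs, hz⟩ := h1 t h0
    choose z hz using hz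
    apply ht
    refine ⟨![z 0 0, z 0 1, z 1 1], ?_⟩
    ext i j
    fin_cases i <;> fin_cases j <;> simp [fineIndex, ← hz, hs, hQ']
  -- evaluate at the points with imaginary part `1`
  have hmem : ∀ x : Fin 3 → ℝ, coordMatrix ((Q * x 0 : ℂ) + Complex.I, (Q * x 1 / 2 : ℂ),
      (Q * x 2 : ℂ) + Complex.I) ∈ siegelSet := by
    intro x
    rw [coordMatrix_mem_iff]
    have : ((Q : ℂ) * x 1 / 2) = ((Q * x 1 / 2 : ℝ) : ℂ) := by push_cast; ring
    simp only
    rw [this, Complex.ofReal_im]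
    simp
  let W : (Fin 3 → ℤ) → ℂ := fun ν => c (fineIndex Q ν) *
    Complex.exp (2 * Real.pi * Complex.I * ((ν 0 / Q + ν 2 / Q) * Complex.I))
  have hW : ∀ x : Fin 3 → ℝ, HasSum (fun ν => W ν * expLin ν (fun j => (x j : ℂ))) 0 := by
    intro x
    have h3 := hc.hasSum ⟨_, hmem x⟩
    rw [← (fineIndex_injective hQ).hasSum_iff] at h3
    · refine h3.congr_fun fun ν => ?_
      simp only [Function.comp_apply, W]
      rw [expTrace_coord _ (by simp [fineIndex]), mul_assoc, expLin, ← Complex.exp_add]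
      congr 2
      simp only [fineIndex, of_apply, cons_val_zero, cons_val_one, cons_val_fin_one,
        Fin.sum_univ_three]
      push_cast
      field_simp
      ring
    · intro t ht
      rw [hrange t ht, zero_mul]
  have hsum : Summable fun ν => ‖W ν‖ := by
    have h4 := (hW 0).summable.norm
    refine h4.congr fun ν => ?_
    simp [expLin]
  intro t
  by_cases ht : t ∈ Set.range (fineIndex Q)
  · obtain ⟨ν, rfl⟩ := ht
    have := eq_zero_of_hasSum_expLin hsum hW ν
    exact (mul_eq_zero.1 this).resolve_right (Complex.exp_ne_zero _)
  · exact hrange t ht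

lemma IsFourierExpansion.hasExpansion {N : ℕ} {f : Siegel → ℂ} {a : Mat2 → ℂ}
    (h : IsFourierExpansion N f a) : HasExpansion f a := by
  refine ⟨⟨2, two_pos, fun t ht => ?_⟩, fun Ω => ?_⟩
  · have hmem : t ∈ indexSemi N := by
      by_contra h0; exact ht (h.support t h0)
    obtain ⟨n, r, m, -, -, -, rfl⟩ := hmem
    refine ⟨by simp [indexMatrix], fun i j => ?_⟩
    fin_cases i <;> fin_cases j
    · exact ⟨2 * n, by simp [indexMatrix]⟩
    · exact ⟨r, by simp [indexMatrix]; ring⟩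
    · exact ⟨r, by simp [indexMatrix]; ring⟩
    · exact ⟨2 * (m * N), by simp [indexMatrix]⟩
  · have := h.hasSum Ω
    rwa [← Function.comp_def (fun t : Mat2 => a t * expTrace t Ω) ((↑) : indexSemi N → Mat2),
      hasSum_subtype_iff_of_support_subset] at this
    intro t ht
    by_contra h0
    exact ht (by simp [h.support t h0])

/-- The sum may be taken over all matrices. -/
lemma HasExpansion.isFourierExpansion {N : ℕ} {f : Siegel → ℂ} {a : Mat2 → ℂ}
    (h : HasExpansion f a) (hs : ∀ t, t ∉ indexSemi N → a t = 0) : IsFourierExpansion N f a := by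
  refine ⟨hs, fun Ω => ?_⟩
  rw [← Function.comp_def (fun t : Mat2 => a t * expTrace t Ω) ((↑) : indexSemi N → Mat2),
    hasSum_subtype_iff_of_support_subset]
  · exact h.hasSum Ω
  · intro t ht
    by_contra h0
    exact ht (by simp [hs t h0])

lemma IsFourierExpansion.fourierCoeff_eq {N : ℕ} {f : Siegel → ℂ} {a : Mat2 → ℂ}
    (h : IsFourierExpansion N f a) : fourierCoeff N f = a := by
  have hex : ∃ a, IsFourierExpansion N f a := ⟨a, h⟩
  rw [fourierCoeff, dif_pos hex]
  exact hex.choose_spec.hasExpansion.unique h.hasExpansion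

/-! ### Fourier expansions of paramodular forms and the Koecher principle -/

lemma inK_unipotent (N : ℕ) (b₁ b₂ b₃ : ℤ) :
    InK N (fromBlocks 1 !![(b₁ : ℚ), b₂; b₂, b₃ / N] 0 1) := by
  refine ⟨IsSimilitude.mem_symplecticGroup (isSimilitude_fromBlocks one_pos (by simp) ?_), ?_⟩
  · ext i j; fin_cases i <;> fin_cases j <;> simp
  · intro i j
    rcases i with i | i <;> rcases j with j | j <;> fin_cases i <;> fin_cases j <;>
      simp only [entryScale, fromBlocks_apply₁₁, fromBlocks_apply₁₂, fromBlocks_apply₂₁,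
        fromBlocks_apply₂₂, Fin.zero_eta, Fin.mk_one, of_apply, cons_val_zero, cons_val_one,
        cons_val_fin_one, one_mul, Fin.isValue, Matrix.zero_apply, Matrix.one_apply_eq]
    exacts [⟨1, by simp⟩, ⟨0, by simp⟩, ⟨0, by simp⟩, ⟨1, by simp⟩, ⟨b₁, rfl⟩, ⟨b₂, rfl⟩, ⟨b₂, rfl⟩,
      ⟨b₃, by ring⟩, ⟨0, by simp⟩, ⟨0, by simp⟩, ⟨0, by simp⟩, ⟨0, by simp⟩, ⟨1, by simp⟩,
      ⟨0, by simp⟩, ⟨0, by simp⟩, ⟨1, by simp⟩]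

lemma extend_translate {k : ℤ} {N : ℕ} (hN : 0 < N) {f : Siegel → ℂ} (hf : IsParamodularForm k N f)
    (b : Fin 3 → ℤ) {w : ℂ × ℂ × ℂ} (hw : coordMatrix w ∈ siegelSet) :
    extend f (coordMatrix (w.1 + b 0, w.2.1 + b 1, w.2.2 + b 2 / N)) = extend f (coordMatrix w) := by
  have hK := inK_unipotent N (b 0) (b 1) (b 2)
  have h1 := congrFun (slash_eq_of_inK hN hf hK) ⟨_, hw⟩
  rw [slash_fromBlocks k f (isSimilitude_of_mem hK.mem)] at h1
  rw [extend_of_mem f hw, ← h1]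
  simp only [Rat.cast_one, _root_.one_zpow, det_one, one_mul, cplx2_one, inv_one, Matrix.mul_one]
  congr 1
  ext i j
  fin_cases i <;> fin_cases j <;> simp [coordMatrix, cplx2]

lemma isPeriodicOnTube_extend {k : ℤ} {N : ℕ} (hN : 0 < N) {f : Siegel → ℂ}
    (hf : IsParamodularForm k N f) :
    IsPeriodicOnTube (cone N) (fun w => extend f (coordMatrix (w 0, w 1, w 2 / N))) := by
  have hN' : (0 : ℝ) < N := by exact_mod_cast hN
  have hNC : (N : ℂ) ≠ 0 := by exact_mod_cast hN.ne'
  have hmem : ∀ w : Fin 3 → ℂ, (fun j => (w j).im) ∈ cone N →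
      coordMatrix (w 0, w 1, w 2 / N) ∈ siegelSet := by
    intro w hw
    rw [coordMatrix_mem_iff]
    refine ⟨hw.1, ?_⟩
    have h2 : (N : ℝ) * (w 1).im ^ 2 < (w 0).im * (w 2).im := hw.2
    have h3 : (w 2 / N).im = (w 2).im / N := by
      rw [← Complex.ofReal_natCast, Complex.div_ofReal_im]
    simp only [h3]
    rw [← mul_div_assoc, lt_div_iff₀ hN']
    linarith
  constructor
  · intro w hw
    have h1 := (hf.holomorphic.differentiableAt (isOpen_coord.mem_nhds (hmem w hw)))
    have hp : ∀ i : Fin 3, Differentiable ℂ fun w : Fin 3 → ℂ => w i := fun i => differentiable_apply i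
    have h2 : Differentiable ℂ fun w : Fin 3 → ℂ => ((w 0, w 1, w 2 / N) : ℂ × ℂ × ℂ) :=
      (hp 0).prodMk ((hp 1).prodMk (by
        simpa only [div_eq_mul_inv] using (hp 2).mul_const ((N : ℂ)⁻¹)))
    exact DifferentiableAt.comp w h1 h2.differentiableAt
  · intro x y hy n
    have hw := hmem (tubePoint x y) (by convert! hy using 1; funext j; simp [tubePoint])
    rw [← extend_translate hN hf n hw]
    congr 2
    simp only [tubePoint, Prod.mk.injEq]
    push_cast
    refine ⟨by ring, by ring, by ring⟩

/-- The index matrix with integral coordinates `ν = (n, r, m)`. -/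
def indexOf (N : ℕ) (ν : Fin 3 → ℤ) : Mat2 := indexMatrix N (ν 0) (ν 1) (ν 2)

lemma indexOf_injective {N : ℕ} (hN : 0 < N) : Function.Injective (indexOf N) := by
  intro ν μ h
  have hN' : (N : ℚ) ≠ 0 := by exact_mod_cast hN.ne'
  have h0 := congrFun (congrFun h 0) 0
  have h1 := congrFun (congrFun h 0) 1
  have h2 := congrFun (congrFun h 1) 1
  simp only [indexOf, indexMatrix, of_apply, cons_val_zero, cons_val_one, cons_val_fin_one,
    mul_left_inj' hN', div_left_inj' (two_ne_zero (α := ℚ))] at h0 h1 h2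
  ext i
  fin_cases i
  exacts [by exact_mod_cast h0, by exact_mod_cast h1, by exact_mod_cast h2]

lemma exists_hasExpansion {k : ℤ} {N : ℕ} (hN : 0 < N) {f : Siegel → ℂ}
    (hf : IsParamodularForm k N f) :
    ∃ a, HasExpansion f a ∧ ∀ t, a t ≠ 0 → t ∈ Set.range (indexOf N) := by
  have hN' : (0 : ℝ) < N := by exact_mod_cast hN
  have hNC : (N : ℂ) ≠ 0 := by exact_mod_cast hN.ne'
  obtain ⟨b, hb⟩ := hasSum_of_isPeriodicOnTube_cone hN' (isPeriodicOnTube_extend hN hf)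
  have hsupp : ∀ t, Function.extend (indexOf N) b 0 t ≠ 0 → t ∈ Set.range (indexOf N) := by
    intro t ht
    by_contra h0
    exact ht (Function.extend_apply' _ _ _ h0)
  refine ⟨Function.extend (indexOf N) b 0, ⟨⟨2, two_pos, fun t ht => ?_⟩, fun Ω => ?_⟩, hsupp⟩
  · obtain ⟨ν, rfl⟩ := hsupp t ht
    refine ⟨by simp [indexOf, indexMatrix], fun i j => ?_⟩
    fin_cases i <;> fin_cases j
    · exact ⟨2 * ν 0, by simp [indexOf, indexMatrix]⟩
    · exact ⟨ν 1, by simp [indexOf, indexMatrix]; ring⟩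
    · exact ⟨ν 1, by simp [indexOf, indexMatrix]; ring⟩
    · exact ⟨2 * (ν 2 * N), by simp [indexOf, indexMatrix]⟩
  · rw [← (indexOf_injective hN).hasSum_iff]
    · obtain ⟨Z, hZ⟩ := Ω
      have e := eq_coordMatrix hZ.1
      have hZ' := hZ
      rw [e, coordMatrix_mem_iff] at hZ'
      let x : Fin 3 → ℝ := ![(Z 0 0).re, (Z 0 1).re, N * (Z 1 1).re]
      let y : Fin 3 → ℝ := ![(Z 0 0).im, (Z 0 1).im, N * (Z 1 1).im]
      have hy : y ∈ cone N := by
        refine ⟨hZ'.1, ?_⟩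
        have := mul_lt_mul_of_pos_left hZ'.2 hN'
        change (N : ℝ) * (Z 0 1).im ^ 2 < (Z 0 0).im * (N * (Z 1 1).im)
        simp only at this
        linarith
      have h0 : tubePoint x y 0 = Z 0 0 := by simp [tubePoint, x, y]
      have h1 : tubePoint x y 1 = Z 0 1 := by simp [tubePoint, x, y]
      have h2 : tubePoint x y 2 = N * Z 1 1 := by
        apply Complex.ext <;> simp [tubePoint, x, y]
      have h := hb x y hy
      rw [h0, h1, h2, mul_div_cancel_left₀ _ hNC, ← e, extend_of_mem f hZ] at h
      refine h.congr_fun fun ν => ?_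
      rw [Function.comp_apply, (indexOf_injective hN).extend_apply]
      congr 1
      have e2 : (⟨Z, hZ⟩ : Siegel) = ⟨coordMatrix (Z 0 0, Z 0 1, Z 1 1), e ▸ hZ⟩ :=
        Subtype.ext e
      rw [e2, expTrace_coord _ (by simp [indexOf, indexMatrix]), expLin]
      congr 2
      rw [Fin.sum_univ_three, h0, h1, h2]
      simp [indexOf, indexMatrix]
      ring
    · intro t ht
      rw [Function.extend_apply' _ _ _ ht]
      simp

/-- The element `[U, 0; 0, (Uᵀ)⁻¹]` of `K(N)` for the transvection `U = 1 - jN v wᵀ`, where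
`w = (-v₂, v₁)`. -/
lemma inK_transvection {N : ℕ} (hN : 0 < N) (v₁ v₂ j : ℤ) :
    InK N (fromBlocks !![1 + j * N * v₁ * v₂, -(j * N * v₁ ^ 2); j * N * v₂ ^ 2, 1 - j * N * v₁ * v₂]
      0 0 !![1 - j * N * v₁ * v₂, -(j * N * v₂ ^ 2); j * N * v₁ ^ 2, (1 + j * N * v₁ * v₂ : ℚ)]) := by
  have hN' : (N : ℚ) ≠ 0 := by exact_mod_cast hN.ne'
  refine ⟨IsSimilitude.mem_symplecticGroup (isSimilitude_fromBlocks one_pos ?_ (by simp)), ?_⟩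
  · ext i j; fin_cases i <;> fin_cases j <;> simp [Matrix.mul_apply, Fin.sum_univ_two] <;> ring
  · intro i j
    rcases i with i | i <;> rcases j with j | j <;> fin_cases i <;> fin_cases j <;>
      simp only [entryScale, fromBlocks_apply₁₁, fromBlocks_apply₁₂, fromBlocks_apply₂₁,
        fromBlocks_apply₂₂, Fin.zero_eta, Fin.mk_one, of_apply, cons_val_zero, cons_val_one,
        cons_val_fin_one, one_mul, Fin.isValue, Matrix.zero_apply]
    exacts [⟨1 + j * N * v₁ * v₂, by push_cast; ring⟩, ⟨-(j * v₁ ^ 2), by push_cast; ring⟩,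
      ⟨j * N * v₂ ^ 2, by push_cast; ring⟩, ⟨1 - j * N * v₁ * v₂, by push_cast; ring⟩,
      ⟨0, by simp⟩, ⟨0, by simp⟩, ⟨0, by simp⟩, ⟨0, by simp⟩, ⟨0, by simp⟩, ⟨0, by simp⟩,
      ⟨0, by simp⟩, ⟨0, by simp⟩, ⟨1 - j * N * v₁ * v₂, by push_cast; ring⟩,
      ⟨-(j * N * v₂ ^ 2), by push_cast; ring⟩,
      ⟨j * v₁ ^ 2, by push_cast; ring⟩, ⟨1 + j * N * v₁ * v₂, by push_cast; ring⟩]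

/-- A quadratic polynomial with positive leading coefficient is unbounded on the integers. -/
lemma exists_int_quadratic_gt {γ : ℝ} (hγ : 0 < γ) (β α K : ℝ) :
    ∃ j : ℤ, K < γ * j ^ 2 + β * j + α := by
  obtain ⟨n, hn⟩ := exists_nat_gt ((|β| + |K - α| + 1) / γ)
  refine ⟨n + 1, ?_⟩
  rw [div_lt_iff₀ hγ] at hn
  have h1 := neg_abs_le β
  have h2 := le_abs_self (K - α)
  have h3 := abs_nonneg (K - α)
  have hn0 : (0 : ℝ) ≤ n := n.cast_nonneg
  push_cast
  have h4 : |K - α| + 1 ≤ γ * (n + 1) + β := by nlinarith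
  have h5 : (γ * (n + 1) + β) * 1 ≤ (γ * (n + 1) + β) * (n + 1) :=
    mul_le_mul_of_nonneg_left (by linarith) (by linarith)
  nlinarith

/-- The Koecher principle: if `t[v] < 0`, then the coefficients at the equivalent indices
`t[1 + jN v wᵀ]` are all equal, while their traces tend to `-∞`. -/
lemma eq_zero_of_quadratic_neg {k : ℤ} {N : ℕ} (hN : 0 < N) {f : Siegel → ℂ}
    (hf : IsParamodularForm k N f) {a : Mat2 → ℂ} (ha : HasExpansion f a) {t : Mat2}
    (hsym : t 1 0 = t 0 1) (v₁ v₂ : ℤ)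
    (hv : t 0 0 * v₁ ^ 2 + 2 * t 0 1 * v₁ * v₂ + t 1 1 * v₂ ^ 2 < 0) : a t = 0 := by
  by_contra h0
  have hmem : coordMatrix (Complex.I, 0, Complex.I) ∈ siegelSet := by
    rw [coordMatrix_mem_iff]; simp
  have hbound := (ha.hasSum ⟨_, hmem⟩).summable.norm
  set C := ∑' t : Mat2, ‖a t * expTrace t ⟨_, hmem⟩‖
  have hC : ∀ s : Mat2, ‖a s * expTrace s ⟨_, hmem⟩‖ ≤ C := fun s =>
    hbound.le_tsum s fun _ _ => norm_nonneg _
  have hinv : ∀ j : ℤ, a (act t !![1 - j * N * v₁ * v₂, j * N * v₁ ^ 2;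
      -(j * N * v₂ ^ 2), (1 + j * N * v₁ * v₂ : ℚ)]) = a t := by
    intro j
    have hK := inK_transvection hN v₁ v₂ j
    have h1 := ha.slash (k := k) (m := 1) (by simpa using isSimilitude_of_mem hK.mem) (by
      intro i l
      obtain ⟨z, hz⟩ := hK.integral (.inl i) (.inl l)
      fin_cases i <;> fin_cases l <;>
        simp only [entryScale, fromBlocks_apply₁₁, Fin.zero_eta, Fin.mk_one, of_apply,
          cons_val_zero, cons_val_one, cons_val_fin_one, one_mul, Fin.isValue] at hz ⊢
      exacts [⟨z, hz⟩, ⟨N * z, by rw [hz]; push_cast; ring⟩, ⟨z, hz⟩, ⟨z, hz⟩])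
    rw [slash_eq_of_inK hN hf hK] at h1
    have h2 := congrFun (ha.unique h1) t
    rw [h2]
    have hdet : (!![1 - j * N * v₁ * v₂, -(j * N * v₂ ^ 2); j * N * v₁ ^ 2,
      (1 + j * N * v₁ * v₂ : ℚ)] : Mat2).det = 1 := by
      rw [det_fin_two_of]; ring
    rw [hdet]
    simp only [Matrix.mul_zero, Matrix.trace_zero, expRat]
    norm_num
    rw [transpose_fin_two]
  have hnorm : ∀ s : Mat2, s 1 0 = s 0 1 → ‖expTrace s ⟨_, hmem⟩‖ =
      Real.exp (-(2 * Real.pi * ((s 0 0 + s 1 1 : ℚ) : ℝ))) := by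
    intro s hs
    rw [expTrace_coord s hs, Complex.norm_exp]
    congr 1
    have : 2 * (Real.pi : ℂ) * Complex.I * (s 0 0 * Complex.I + 2 * s 0 1 * 0 + s 1 1 * Complex.I) =
      ((-(2 * Real.pi * ((s 0 0 + s 1 1 : ℚ) : ℝ)) : ℝ) : ℂ) := by
      push_cast
      linear_combination (2 * Real.pi * (s 0 0 + s 1 1 : ℂ)) * Complex.I_mul_I
    simp only
    rw [this, Complex.ofReal_re]
  set γ : ℚ := -(t 0 0 * v₁ ^ 2 + 2 * t 0 1 * v₁ * v₂ + t 1 1 * v₂ ^ 2) * N ^ 2 * (v₁ ^ 2 + v₂ ^ 2)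
    with hγdef
  have hγ : 0 < γ := by
    have h1 : (0 : ℚ) < N := by exact_mod_cast hN
    have h2 : (0 : ℚ) < v₁ ^ 2 + v₂ ^ 2 := by
      by_contra h3
      have h4 : (v₁ : ℚ) = 0 := by nlinarith [sq_nonneg (v₁ : ℚ), sq_nonneg (v₂ : ℚ)]
      have h5 : (v₂ : ℚ) = 0 := by nlinarith [sq_nonneg (v₁ : ℚ), sq_nonneg (v₂ : ℚ)]
      rw [h4, h5] at hv
      simp at hv
    rw [hγdef]
    have h3 := neg_pos.2 hv
    positivity
  set β : ℚ := -(2 * N * (t 0 1 * (v₁ ^ 2 - v₂ ^ 2) + (t 1 1 - t 0 0) * v₁ * v₂)) with hβdef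
  have htr : ∀ j : ℤ, let s := act t !![1 - j * N * v₁ * v₂, j * N * v₁ ^ 2;
      -(j * N * v₂ ^ 2), (1 + j * N * v₁ * v₂ : ℚ)]
      s 1 0 = s 0 1 ∧ -(s 0 0 + s 1 1) = γ * j ^ 2 + β * j + -(t 0 0 + t 1 1) := by
    intro j
    simp only [act, Matrix.mul_apply, Fin.sum_univ_two, transpose_apply, of_apply, cons_val_zero,
      cons_val_one, cons_val_fin_one, hsym, hγdef, hβdef]
    constructor <;> ring
  obtain ⟨j, hj⟩ := exists_int_quadratic_gt (γ := γ) (by exact_mod_cast hγ) β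
    (((-(t 0 0 + t 1 1) : ℚ)) : ℝ) (C / ‖a t‖ / (2 * Real.pi))
  have h1 := hC (act t !![1 - j * N * v₁ * v₂, j * N * v₁ ^ 2;
      -(j * N * v₂ ^ 2), (1 + j * N * v₁ * v₂ : ℚ)])
  obtain ⟨h2, h3⟩ := htr j
  rw [norm_mul, hinv j, hnorm _ h2] at h1
  have h4 : 0 < ‖a t‖ := norm_pos_iff.2 h0
  rw [mul_comm, ← le_div_iff₀ h4] at h1
  rw [div_lt_iff₀ (by positivity)] at hj
  have h5 := Real.add_one_le_exp (-(2 * Real.pi * (((act t !![1 - j * N * v₁ * v₂, j * N * v₁ ^ 2;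
      -(j * N * v₂ ^ 2), (1 + j * N * v₁ * v₂ : ℚ)]) 0 0 + (act t !![1 - j * N * v₁ * v₂,
      j * N * v₁ ^ 2; -(j * N * v₂ ^ 2), (1 + j * N * v₁ * v₂ : ℚ)]) 1 1 : ℚ) : ℝ)))
  have h6 : ((-((act t !![1 - j * N * v₁ * v₂, j * N * v₁ ^ 2;
      -(j * N * v₂ ^ 2), (1 + j * N * v₁ * v₂ : ℚ)]) 0 0 + (act t !![1 - j * N * v₁ * v₂,
      j * N * v₁ ^ 2; -(j * N * v₂ ^ 2), (1 + j * N * v₁ * v₂ : ℚ)]) 1 1) : ℚ) : ℝ) =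
      ((γ * j ^ 2 + β * j + -(t 0 0 + t 1 1) : ℚ) : ℝ) := congrArg _ h3
  push_cast at h5 h6 h1 hj
  nlinarith [Real.pi_pos]

/-- The Fourier expansion of a paramodular form. -/
theorem exists_isFourierExpansion {k : ℤ} {N : ℕ} (hN : 0 < N) {f : Siegel → ℂ}
    (hf : IsParamodularForm k N f) : ∃ a, IsFourierExpansion N f a := by
  obtain ⟨a, ha, hs⟩ := exists_hasExpansion hN hf
  refine ⟨a, ha.isFourierExpansion fun t ht => ?_⟩
  by_contra h0
  obtain ⟨ν, rfl⟩ := hs t h0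
  have hsym : indexOf N ν 1 0 = indexOf N ν 0 1 := by simp [indexOf, indexMatrix]
  have key := fun v₁ v₂ hv => h0 (eq_zero_of_quadratic_neg hN hf ha hsym v₁ v₂ hv)
  simp only [indexOf, indexMatrix, of_apply, cons_val_zero, cons_val_one, cons_val_fin_one] at key
  have hN' : (0 : ℚ) < N := by exact_mod_cast hN
  apply ht
  refine ⟨ν 0, ν 1, ν 2, ?_, ?_, ?_, rfl⟩
  · by_contra h
    have h' : (ν 0 : ℚ) < 0 := by exact_mod_cast not_le.1 h
    exact key 1 0 (by push_cast; nlinarith)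
  · by_contra h
    have h' : (ν 2 : ℚ) < 0 := by exact_mod_cast not_le.1 h
    exact key 0 1 (by push_cast; nlinarith)
  · by_contra h
    have h' : (4 * ν 0 * ν 2 * N - ν 1 ^ 2 : ℚ) < 0 := by exact_mod_cast not_le.1 h
    rcases lt_trichotomy (ν 0) 0 with h1 | h1 | h1
    · have h' : (ν 0 : ℚ) < 0 := by exact_mod_cast h1
      exact key 1 0 (by push_cast; nlinarith)
    · rw [h1] at h' key
      refine key (-(ν 1 * (ν 2 * N + 1))) 1 ?_
      have h2 : (0 : ℚ) < ν 1 ^ 2 := by simpa using h'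
      have h2' : 0 < ν 1 ^ 2 := by exact_mod_cast h2
      have h3 : (1 : ℚ) ≤ ν 1 ^ 2 := by exact_mod_cast h2'
      have h4 : (0 : ℚ) ≤ ν 2 * N := by
        by_contra h5
        exact key 0 1 (by push_cast; nlinarith)
      push_cast
      nlinarith
    · have h2 : (0 : ℚ) < ν 0 := by exact_mod_cast h1
      refine key (-ν 1) (2 * ν 0) ?_
      push_cast
      have : (ν 0 : ℚ) * (-ν 1) ^ 2 + 2 * (ν 1 / 2) * (-ν 1) * (2 * ν 0) + ν 2 * N * (2 * ν 0) ^ 2 =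
        ν 0 * (4 * ν 0 * ν 2 * N - ν 1 ^ 2) := by ring
      rw [this]
      exact mul_neg_of_pos_of_neg h2 h'

theorem isFourierExpansion_fourierCoeff {k : ℤ} {N : ℕ} (hN : 0 < N) {f : Siegel → ℂ}
    (hf : IsParamodularForm k N f) : IsFourierExpansion N f (fourierCoeff N f) := by
  obtain ⟨a, ha⟩ := exists_isFourierExpansion hN hf
  rw [ha.fourierCoeff_eq]
  exact ha

/-! ### Hecke operators in terms of representatives -/

lemma mem_heckeCoset_iff {N : ℕ} (hN : 0 < N) {δ g : Mat4} :
    g ∈ heckeCoset N δ ↔ ∃ κ₁ κ₂, InK N κ₁ ∧ InK N κ₂ ∧ g = κ₁ * δ * κ₂ := by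
  constructor
  · rintro ⟨κ₁, h₁, κ₂, h₂, rfl⟩
    exact ⟨_, _, (inK_iff hN).2 ⟨κ₁, h₁, rfl⟩, (inK_iff hN).2 ⟨κ₂, h₂, rfl⟩, rfl⟩
  · rintro ⟨κ₁, κ₂, h₁, h₂, rfl⟩
    obtain ⟨x, hx, rfl⟩ := (inK_iff hN).1 h₁
    obtain ⟨y, hy, rfl⟩ := (inK_iff hN).1 h₂
    exact ⟨x, hx, y, hy, rfl⟩

lemma quotient_mk_eq_iff {N : ℕ} (hN : 0 < N) {δ : Mat4} (g h : heckeCoset N δ) :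
    Quotient.mk (cosetSetoid N δ) g = Quotient.mk (cosetSetoid N δ) h ↔
      ∃ κ, InK N κ ∧ (h : Mat4) = κ * g := by
  rw [Quotient.eq]
  constructor
  · rintro ⟨κ, hκ, e⟩
    exact ⟨κ, (inK_iff hN).2 ⟨κ, hκ, rfl⟩, e⟩
  · rintro ⟨κ, hκ, e⟩
    obtain ⟨x, hx, rfl⟩ := (inK_iff hN).1 hκ
    exact ⟨x, hx, e⟩

lemma isSimilitude_of_mem_heckeCoset {N : ℕ} (hN : 0 < N) {δ g : Mat4} {m : ℚ}
    (hδ : IsSimilitude δ m) (hg : g ∈ heckeCoset N δ) : IsSimilitude g m := by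
  obtain ⟨κ₁, κ₂, h₁, h₂, rfl⟩ := (mem_heckeCoset_iff hN).1 hg
  have := ((isSimilitude_of_mem h₁.mem).mul hδ).mul (isSimilitude_of_mem h₂.mem)
  rwa [one_mul, mul_one] at this

/-- The family `S` is a system of representatives of `K(N) \ K(N) δ K(N)`. -/
structure IsRepSystem (N : ℕ) (δ : Mat4) {ι : Type*} (S : ι → Mat4) : Prop where
  mem : ∀ i, S i ∈ heckeCoset N δ
  bijective : Function.Bijective fun i => Quotient.mk (cosetSetoid N δ) ⟨S i, mem i⟩

/-- A criterion for systems of representatives. For a diagonal matrix `δ`, the coset of `δ Q⁻¹`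
with `Q ∈ K(N)` contains `S` if `S Q δ⁻¹ ∈ K(N)`, and all cosets arise from the `Q i` if for each
`κ ∈ K(N)` there is exactly one `i` with `δ κ Q i δ⁻¹ ∈ K(N)`. -/
theorem isRepSystem_of_forall_existsUnique {N : ℕ} (hN : 0 < N) {d : Fin 2 ⊕ Fin 2 → ℚ} {m : ℚ}
    (hd : ∀ i, d i ≠ 0) (hδ : IsSimilitude (diagonal d) m) {ι : Type*} {S Q : ι → Mat4}
    (hS : ∀ i, IsSimilitude (S i) m) (hQ : ∀ i, InK N (Q i))
    (hSQ : ∀ i a b, ∃ z : ℤ, (S i * Q i) a b = entryScale N a b * d b * z)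
    (hex : ∀ κ, InK N κ → ∃! i, ∀ a b, ∃ z : ℤ, d a * (κ * Q i) a b = entryScale N a b * d b * z) :
    IsRepSystem N (diagonal d) S := by
  set δ : Mat4 := diagonal d with hδdef
  set ε : Mat4 := diagonal fun i => (d i)⁻¹ with hε
  have hδε : δ * ε = 1 := by
    rw [hδdef, hε, diagonal_mul_diagonal]
    simp [hd]
  have hεδ : ε * δ = 1 := mul_eq_one_comm.1 hδε
  have hεsim : IsSimilitude ε m⁻¹ := by
    refine ⟨inv_pos.2 hδ.pos, ?_⟩
    have e := hδ.eq
    have hdt : δᵀ = δ := diagonal_transpose d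
    have het : εᵀ = ε := diagonal_transpose _
    rw [hdt] at e
    have h1 : ε * (δ * J (Fin 2) ℚ * δ) * ε = J (Fin 2) ℚ := by
      calc _ = (ε * δ) * J (Fin 2) ℚ * (δ * ε) := by simp only [Matrix.mul_assoc]
        _ = _ := by rw [hεδ, hδε]; simp
    rw [e, Matrix.mul_smul, Matrix.smul_mul] at h1
    rw [het]
    have := congrArg (fun M => m⁻¹ • M) h1
    simpa [smul_smul, hδ.pos.ne'] using this
  have integral : ∀ M : Mat4, (∀ a b, ∃ z : ℤ, M a b = entryScale N a b * d b * z) ↔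
      IsIntegralAt N (M * ε) := by
    intro M
    refine forall_congr' fun a => forall_congr' fun b => exists_congr fun z => ?_
    rw [hε, mul_diagonal, mul_inv_eq_iff_eq_mul₀ (hd b)]
    constructor <;> intro h <;> rw [h] <;> ring
  have sim : ∀ M : Mat4, IsSimilitude M m → IsIntegralAt N (M * ε) → InK N (M * ε) := by
    intro M hM hi
    refine ⟨IsSimilitude.mem_symplecticGroup ?_, hi⟩
    have := hM.mul hεsim
    rwa [mul_inv_cancel₀ hδ.pos.ne'] at this
  -- the criterion, and the elements relating `S i` to `δ (Q i)⁻¹`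
  have hP : ∀ κ, InK N κ → ∀ i, (∀ a b, ∃ z : ℤ, d a * (κ * Q i) a b =
      entryScale N a b * d b * z) ↔ InK N (δ * (κ * Q i) * ε) := by
    intro κ hκ i
    have e : ∀ a b, d a * (κ * Q i) a b = (δ * (κ * Q i)) a b := by
      intro a b; rw [hδdef, diagonal_mul]
    simp only [e]
    rw [integral]
    refine ⟨fun h => sim _ ?_ h, fun h => h.integral⟩
    have := hδ.mul (isSimilitude_of_mem (hκ.mul hN (hQ i)).mem)
    rwa [mul_one] at this
  have hT : ∀ i, InK N (S i * Q i * ε) := by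
    intro i
    refine sim _ ?_ ((integral _).1 (hSQ i))
    have := (hS i).mul (isSimilitude_of_mem (hQ i).mem)
    rwa [mul_one] at this
  have hSeq : ∀ i, S i = (S i * Q i * ε) * δ * (Q i)⁻¹ := by
    intro i
    rw [Matrix.mul_assoc (S i * Q i), hεδ, Matrix.mul_one,
      Matrix.mul_nonsing_inv_cancel_right _ _ (hQ i).isUnit_det]
  have hmem : ∀ i, S i ∈ heckeCoset N δ := fun i =>
    (mem_heckeCoset_iff hN).2 ⟨_, _, hT i, (hQ i).inv hN, hSeq i⟩
  refine ⟨hmem, ?_, ?_⟩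
  · intro i j hij
    obtain ⟨κ, hκ, e⟩ := (quotient_mk_eq_iff hN _ _).1 hij
    simp only at e
    have hi : InK N (Q i)⁻¹ := (hQ i).inv hN
    refine (hex _ hi).unique ((hP _ hi i).2 ?_) ((hP _ hi j).2 ?_)
    · rw [Matrix.nonsing_inv_mul _ (hQ i).isUnit_det, Matrix.mul_one, hδε]
      simpa [Matrix.nonsing_inv_mul _ (hQ i).isUnit_det] using hi.mul hN (hQ i)
    · have hu := (hκ.mul hN (hT i))
      have e1 : δ * ((Q i)⁻¹ * Q j) * ε = (κ * (S i * Q i * ε))⁻¹ * (S j * Q j * ε) := by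
        have e2 : (κ * (S i * Q i * ε)) * (δ * ((Q i)⁻¹ * Q j) * ε) = S j * Q j * ε := by
          calc _ = κ * (S i * Q i * ε * δ * (Q i)⁻¹) * Q j * ε := by simp only [Matrix.mul_assoc]
            _ = _ := by rw [← hSeq, e]
        rw [← e2, Matrix.nonsing_inv_mul_cancel_left _ _ hu.isUnit_det]
      rw [e1]
      exact (hu.inv hN).mul hN (hT j)
  · intro q
    obtain ⟨⟨g, hg⟩, rfl⟩ := Quotient.exists_rep q
    obtain ⟨κ₁, κ₂, h₁, h₂, rfl⟩ := (mem_heckeCoset_iff hN).1 hg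
    obtain ⟨i, hi, -⟩ := hex κ₂ h₂
    have hi' := (hP κ₂ h₂ i).1 hi
    refine ⟨i, (quotient_mk_eq_iff hN _ _).2
      ⟨κ₁ * (δ * (κ₂ * Q i) * ε) * (S i * Q i * ε)⁻¹,
        (h₁.mul hN hi').mul hN ((hT i).inv hN), ?_⟩⟩
    simp only
    have e1 : (S i * Q i * ε)⁻¹ * S i = δ * (Q i)⁻¹ := by
      calc (S i * Q i * ε)⁻¹ * S i = (S i * Q i * ε)⁻¹ * ((S i * Q i * ε) * δ * (Q i)⁻¹) := by
            rw [← hSeq i]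
        _ = δ * (Q i)⁻¹ := by
            rw [Matrix.mul_assoc (S i * Q i * ε),
              Matrix.nonsing_inv_mul_cancel_left _ _ (hT i).isUnit_det]
    rw [Matrix.mul_assoc _ _ (S i), e1]
    calc κ₁ * δ * κ₂ = κ₁ * δ * (κ₂ * Q i * (Q i)⁻¹) := by
          rw [Matrix.mul_nonsing_inv_cancel_right _ _ (hQ i).isUnit_det]
      _ = κ₁ * δ * (κ₂ * Q i) * (ε * δ) * (Q i)⁻¹ := by
          rw [hεδ, Matrix.mul_one]; simp only [Matrix.mul_assoc]
      _ = _ := by simp only [Matrix.mul_assoc]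

lemma heckeOp_eq_sum {k : ℤ} {N : ℕ} (hN : 0 < N) {δ : Mat4} {m : ℚ} (hδ : IsSimilitude δ m)
    {f : Siegel → ℂ} (hf : IsParamodularForm k N f) {ι : Type*} [Fintype ι] {S : ι → Mat4}
    (hS : IsRepSystem N δ S) : heckeOp k N δ f = ∑ i, slash k f (S i) := by
  have hF : ∀ g : heckeCoset N δ,
      slash k f ((Quotient.mk (cosetSetoid N δ) g).out : Mat4) = slash k f (g : Mat4) := by
    intro g
    obtain ⟨κ, hκ, e⟩ := (quotient_mk_eq_iff hN _ _).1
      (Quotient.out_eq (Quotient.mk (cosetSetoid N δ) g))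
    rw [e, ← slash_slash k f (isSimilitude_of_mem hκ.mem)
      (isSimilitude_of_mem_heckeCoset hN hδ (Subtype.prop _)), slash_eq_of_inK hN hf hκ]
  rw [heckeOp, ← finsum_eq_sum_of_fintype]
  refine (finsum_eq_of_bijective _ hS.bijective fun i => ?_).symm
  rw [hF]

lemma IsRepSystem.mul_right {N : ℕ} (hN : 0 < N) {δ : Mat4} {ι : Type*} {S : ι → Mat4}
    (hS : IsRepSystem N δ S) {κ : Mat4} (hκ : InK N κ) : IsRepSystem N δ (fun i => S i * κ) := by
  have mul_mem : ∀ {g κ : Mat4}, g ∈ heckeCoset N δ → InK N κ → g * κ ∈ heckeCoset N δ := by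
    intro g κ hg hκ
    obtain ⟨κ₁, κ₂, h₁, h₂, rfl⟩ := (mem_heckeCoset_iff hN).1 hg
    exact (mem_heckeCoset_iff hN).2 ⟨κ₁, κ₂ * κ, h₁, h₂.mul hN hκ, by rw [Matrix.mul_assoc]⟩
  refine ⟨fun i => mul_mem (hS.mem i) hκ, ?_, ?_⟩
  · intro i j hij
    obtain ⟨x, hx, e⟩ := (quotient_mk_eq_iff hN _ _).1 hij
    apply hS.bijective.1
    refine (quotient_mk_eq_iff hN _ _).2 ⟨x, hx, ?_⟩
    have := congrArg (fun M => M * κ⁻¹) e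
    simpa [← Matrix.mul_assoc, Matrix.mul_nonsing_inv_cancel_right _ _ hκ.isUnit_det] using this
  · intro q
    obtain ⟨⟨g, hg⟩, rfl⟩ := Quotient.exists_rep q
    obtain ⟨i, hi⟩ := hS.bijective.2 (Quotient.mk _ ⟨g * κ⁻¹, mul_mem hg (hκ.inv hN)⟩)
    obtain ⟨x, hx, e⟩ := (quotient_mk_eq_iff hN _ _).1 hi
    refine ⟨i, (quotient_mk_eq_iff hN _ _).2 ⟨x, hx, ?_⟩⟩
    have := congrArg (fun M => M * κ) e
    simpa [Matrix.mul_assoc, Matrix.nonsing_inv_mul_cancel_right _ _ hκ.isUnit_det] using this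

lemma extend_sum {ι : Type*} (s : Finset ι) (F : ι → Siegel → ℂ) (Z : Matrix (Fin 2) (Fin 2) ℂ) :
    extend (∑ i ∈ s, F i) Z = ∑ i ∈ s, extend (F i) Z := by
  unfold extend
  split_ifs <;> simp

lemma differentiableOn_slash {k : ℤ} {N : ℕ} {f : Siegel → ℂ} (hf : IsParamodularForm k N f)
    {A B D : Mat2} {m : ℚ} (h : IsSimilitude (fromBlocks A B 0 D) m) :
    DifferentiableOn ℂ (fun w => extend (slash k f (fromBlocks A B 0 D)) (coordMatrix w))
      {w | coordMatrix w ∈ siegelSet} := by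
  set W : ℂ × ℂ × ℂ → Matrix (Fin 2) (Fin 2) ℂ := fun w =>
    (cplx2 A * coordMatrix w + cplx2 B) * (cplx2 D)⁻¹ with hW
  have hmem : ∀ w, coordMatrix w ∈ siegelSet → W w ∈ siegelSet := by
    intro w hw
    have := h.action_mem hw
    rwa [num_fromBlocks, den_fromBlocks_zero] at this
  have hd : ∀ i j, Differentiable ℂ fun w => W w i j := by
    intro i j
    have hc : ∀ i j, Differentiable ℂ fun w : ℂ × ℂ × ℂ => coordMatrix w i j := by
      intro i j
      fin_cases i <;> fin_cases j <;> simp only [coordMatrix, Fin.zero_eta, Fin.mk_one, of_apply,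
        cons_val_zero, cons_val_one, cons_val_fin_one]
      exacts [differentiable_fst, differentiable_fst.comp differentiable_snd,
        differentiable_fst.comp differentiable_snd, differentiable_snd.comp differentiable_snd]
    simp only [hW, Matrix.mul_apply, Matrix.add_apply, Fin.sum_univ_two]
    exact (((((hc 0 0).const_mul _).add ((hc 1 0).const_mul _)).add_const _).mul_const _).add
      (((((hc 0 1).const_mul _).add ((hc 1 1).const_mul _)).add_const _).mul_const _)
  have hφ : Differentiable ℂ fun w => ((W w 0 0, W w 0 1, W w 1 1) : ℂ × ℂ × ℂ) :=
    (hd 0 0).prodMk ((hd 0 1).prodMk (hd 1 1))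
  have h1 : DifferentiableOn ℂ (fun w => (m : ℂ) ^ (2 * k - 3) * (D.det : ℂ) ^ (-k) *
      extend f (coordMatrix (W w 0 0, W w 0 1, W w 1 1))) {w | coordMatrix w ∈ siegelSet} := by
    refine DifferentiableOn.const_mul ?_ _
    refine hf.holomorphic.comp hφ.differentiableOn fun w hw => ?_
    change coordMatrix _ ∈ siegelSet
    rw [← eq_coordMatrix (hmem w hw).1]
    exact hmem w hw
  refine h1.congr fun w hw => ?_
  rw [extend_of_mem _ hw, slash_fromBlocks k f h, ← eq_coordMatrix (hmem w hw).1]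

lemma tendsto_slash_slash {k : ℤ} {N : ℕ} {f : Siegel → ℂ} (hf : IsCuspForm k N f)
    {S g : Mat4} {m : ℚ} (hS : IsSimilitude S m) (hg : g ∈ symplecticGroup (Fin 2) ℚ) {τ : ℂ}
    (hτ : 0 < τ.im) :
    Tendsto (fun y : ℝ => extend (slash k (slash k f S) g) (coordMatrix (τ, 0, Complex.I * y)))
      atTop (𝓝 0) := by
  have hm := hS.pos
  have hmR : (0 : ℝ) < m := by exact_mod_cast hm
  have hmC : (m : ℂ) ≠ 0 := by exact_mod_cast hm.ne'
  -- `S g = h E` with `h` symplectic and `E = diag(1, 1, m, m)`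
  set E : Mat4 := fromBlocks 1 0 0 (m • 1) with hE
  have hEs : IsSimilitude E m := isSimilitude_fromBlocks hm (by simp) (by simp)
  have hEi : IsSimilitude (fromBlocks 1 0 0 (m⁻¹ • 1)) m⁻¹ :=
    isSimilitude_fromBlocks (inv_pos.2 hm) (by simp) (by simp)
  have hSg : IsSimilitude (S * g) m := by
    simpa using hS.mul (isSimilitude_of_mem hg)
  have hh := hSg.mul hEi
  rw [mul_inv_cancel₀ hm.ne'] at hh
  set h := S * g * fromBlocks 1 0 0 (m⁻¹ • 1) with hdef
  have e : S * g = h * E := by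
    rw [hdef, hE, Matrix.mul_assoc, fromBlocks_multiply]
    simp [smul_smul, hm.ne']
  rw [slash_slash k f hS (isSimilitude_of_mem hg), e, ← slash_slash k f hh hEs]
  have h1 := (hf.cuspidal ⟨h, hh.mem_symplecticGroup⟩ (τ / m) (by
    rw [← Complex.ofReal_ratCast, Complex.div_ofReal_im]; exact div_pos hτ hmR)).comp
    (tendsto_id.atTop_div_const hmR)
  have h2 := h1.const_mul ((m : ℂ) ^ (2 * k - 3) * (((m • 1 : Mat2)).det : ℂ) ^ (-k))
  rw [mul_zero] at h2
  refine h2.congr' ?_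
  filter_upwards [eventually_gt_atTop 0] with y hy
  have hmem : coordMatrix (τ, 0, Complex.I * y) ∈ siegelSet := by
    rw [coordMatrix_mem_iff]; simp [hτ, hy]
  rw [extend_of_mem _ hmem, slash_fromBlocks k _ hEs]
  refine congrArg (fun Z => _ * extend _ Z) ?_
  have hinv : (cplx2 (m • 1))⁻¹ = (m : ℂ)⁻¹ • 1 := by
    refine Matrix.inv_eq_left_inv ?_
    rw [cplx2_smul, cplx2_one, Matrix.smul_mul, Matrix.one_mul, smul_smul, inv_mul_cancel₀ hmC,
      one_smul]
  rw [hinv, cplx2_one]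
  ext i j
  fin_cases i <;> fin_cases j <;> simp [coordMatrix, cplx2, div_eq_mul_inv, mul_assoc, mul_comm]

section HeckeMain

variable {k : ℤ} {N : ℕ} {f : Siegel → ℂ} {δ : Mat4} {m : ℕ} {ι : Type*} [Fintype ι]
  {A B D : ι → Mat2}

/-- Hecke operators preserve cusp forms. -/
theorem isCuspForm_heckeOp (hN : 0 < N) (hδ : IsSimilitude δ m)
    (hS : IsRepSystem N δ fun i => fromBlocks (A i) (B i) 0 (D i)) (hf : IsCuspForm k N f) :
    IsCuspForm k N (heckeOp k N δ f) := by
  have hsim : ∀ i, IsSimilitude (fromBlocks (A i) (B i) 0 (D i)) m := fun i =>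
    isSimilitude_of_mem_heckeCoset hN hδ (hS.mem i)
  have e := heckeOp_eq_sum hN hδ hf.toIsParamodularForm hS
  refine ⟨⟨?_, ?_⟩, ?_⟩
  · rw [e]
    simp only [extend_sum]
    exact DifferentiableOn.fun_sum fun i _ => differentiableOn_slash hf.toIsParamodularForm (hsim i)
  · intro g hg
    have hK := (inK_iff hN).2 ⟨g, hg, rfl⟩
    conv_lhs => rw [e]
    rw [heckeOp_eq_sum hN hδ hf.toIsParamodularForm (hS.mul_right hN hK), slash_sum]
    refine Finset.sum_congr rfl fun i _ => ?_
    rw [slash_slash k f (hsim i) (isSimilitude_of_mem g.2)]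
  · intro g τ hτ
    rw [e, slash_sum]
    simp only [extend_sum]
    have hl : ∀ i, Tendsto (fun y : ℝ => extend (slash k (slash k f
        (fromBlocks (A i) (B i) 0 (D i))) (g : Mat4)) (coordMatrix (τ, 0, Complex.I * y)))
        atTop (𝓝 0) := fun i => tendsto_slash_slash hf (hsim i) g.2 hτ
    have := tendsto_finsetSum Finset.univ fun i _ => hl i
    rwa [Finset.sum_const_zero] at this

/-- The Fourier coefficients of `f | T` in terms of block upper triangular representatives. -/
theorem fourierCoeff_heckeOp (hN : 0 < N) (hδ : IsSimilitude δ m)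
    (hS : IsRepSystem N δ fun i => fromBlocks (A i) (B i) 0 (D i))
    (hA : ∀ i a b, ∃ z : ℤ, A i a b = z) (hf : IsCuspForm k N f) (t : Mat2) :
    fourierCoeff N (heckeOp k N δ f) t = ∑ i, (m : ℂ) ^ (2 * k - 3) * ((D i).det : ℂ) ^ (-k) *
      expRat ((t * ((D i)ᵀ * B i)).trace / m) *
        fourierCoeff N f ((1 / m : ℚ) • act t (D i)ᵀ) := by
  have h1 := (isFourierExpansion_fourierCoeff hN
    (isCuspForm_heckeOp hN hδ hS hf).toIsParamodularForm).hasExpansion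
  have h2 := HasExpansion.sum Finset.univ fun i _ =>
    (isFourierExpansion_fourierCoeff hN hf.toIsParamodularForm).hasExpansion.slash (k := k)
      (isSimilitude_of_mem_heckeCoset hN hδ (hS.mem i)) (hA i)
  rw [← heckeOp_eq_sum hN hδ hf.toIsParamodularForm hS] at h2
  rw [h1.unique h2, Finset.sum_apply]

end HeckeMain

/-! ### Block matrices with explicit entries -/

lemma fin_two_congr {R : Type*} {a b c d a' b' c' d' : R} (h₁ : a = a') (h₂ : b = b')
    (h₃ : c = c') (h₄ : d = d') : !![a, b; c, d] = !![a', b'; c', d'] := by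
  subst h₁ h₂ h₃ h₄; rfl

lemma fin_two_add {R : Type*} [Add R] (a b c d a' b' c' d' : R) :
    !![a, b; c, d] + !![a', b'; c', d'] = !![a + a', b + b'; c + c', d + d'] := by
  simp

lemma fromBlocks_congr {R : Type*} {A B C D A' B' C' D' : Matrix (Fin 2) (Fin 2) R} (h₁ : A = A')
    (h₂ : B = B') (h₃ : C = C') (h₄ : D = D') : fromBlocks A B C D = fromBlocks A' B' C' D' := by
  subst h₁ h₂ h₃ h₄; rfl

lemma J_fin_two : J (Fin 2) ℚ =
    fromBlocks !![0, 0; 0, 0] !![-1, 0; 0, -1] !![1, 0; 0, 1] !![0, 0; 0, 0] := by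
  ext i j
  rcases i with i | i <;> rcases j with j | j <;> fin_cases i <;> fin_cases j <;> simp [J]

/-! ### Integral coordinates of the elements of the paramodular group -/

/-- Integral coordinates of a rational matrix whose entries are multiples of `entryScale N`. -/
structure Entries where
  (k11 k12 k13 k14 k21 k22 k23 k24 k31 k32 k33 k34 k41 k42 k43 k44 : ℤ)

/-- The matrix with given integral coordinates. -/
def Entries.toMat (N : ℕ) (c : Entries) : Mat4 :=
  fromBlocks !![(c.k11 : ℚ), N * c.k12; c.k21, c.k22] !![(c.k13 : ℚ), c.k14; c.k23, c.k24 / N]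
    !![(c.k31 : ℚ), N * c.k32; N * c.k41, N * c.k42] !![(c.k33 : ℚ), c.k34; N * c.k43, c.k44]

/-- The relations between the rows of a symplectic matrix, in integral coordinates. -/
structure Entries.IsSymplectic (N : ℕ) (c : Entries) : Prop where
  r13 : c.k11 * c.k33 + N * c.k12 * c.k34 - c.k13 * c.k31 - N * c.k14 * c.k32 = 1
  r24 : N * c.k21 * c.k43 + c.k22 * c.k44 - N * c.k23 * c.k41 - c.k24 * c.k42 = 1
  r12 : c.k11 * c.k23 + c.k12 * c.k24 - c.k13 * c.k21 - c.k14 * c.k22 = 0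
  r14 : c.k11 * c.k43 + c.k12 * c.k44 - c.k13 * c.k41 - c.k14 * c.k42 = 0
  r23 : c.k21 * c.k33 + c.k22 * c.k34 - c.k23 * c.k31 - c.k24 * c.k32 = 0
  r34 : c.k31 * c.k43 + c.k32 * c.k44 - c.k33 * c.k41 - c.k34 * c.k42 = 0

lemma Entries.isIntegralAt (N : ℕ) (c : Entries) : IsIntegralAt N (c.toMat N) := by
  intro i j
  rcases i with i | i <;> rcases j with j | j <;> fin_cases i <;> fin_cases j
  exacts [⟨c.k11, by simp [toMat, entryScale]⟩, ⟨c.k12, by simp [toMat, entryScale]⟩,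
    ⟨c.k21, by simp [toMat, entryScale]⟩, ⟨c.k22, by simp [toMat, entryScale]⟩,
    ⟨c.k13, by simp [toMat, entryScale]⟩, ⟨c.k14, by simp [toMat, entryScale]⟩,
    ⟨c.k23, by simp [toMat, entryScale]⟩, ⟨c.k24, by simp [toMat, entryScale]; ring⟩,
    ⟨c.k31, by simp [toMat, entryScale]⟩, ⟨c.k32, by simp [toMat, entryScale]⟩,
    ⟨c.k41, by simp [toMat, entryScale]⟩, ⟨c.k42, by simp [toMat, entryScale]⟩,
    ⟨c.k33, by simp [toMat, entryScale]⟩, ⟨c.k34, by simp [toMat, entryScale]⟩,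
    ⟨c.k43, by simp [toMat, entryScale]⟩, ⟨c.k44, by simp [toMat, entryScale]⟩]

lemma IsIntegralAt.exists_entries {N : ℕ} {g : Mat4} (hg : IsIntegralAt N g) :
    ∃ c : Entries, g = c.toMat N := by
  choose z hz using hg
  refine ⟨⟨z (.inl 0) (.inl 0), z (.inl 0) (.inl 1), z (.inl 0) (.inr 0), z (.inl 0) (.inr 1),
    z (.inl 1) (.inl 0), z (.inl 1) (.inl 1), z (.inl 1) (.inr 0), z (.inl 1) (.inr 1),
    z (.inr 0) (.inl 0), z (.inr 0) (.inl 1), z (.inr 0) (.inr 0), z (.inr 0) (.inr 1),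
    z (.inr 1) (.inl 0), z (.inr 1) (.inl 1), z (.inr 1) (.inr 0), z (.inr 1) (.inr 1)⟩, ?_⟩
  ext i j
  rw [hz]
  rcases i with i | i <;> rcases j with j | j <;> fin_cases i <;> fin_cases j <;>
    simp [entryScale, Entries.toMat] <;> ring

lemma Entries.mem_symplecticGroup_iff {N : ℕ} (hN : 0 < N) (c : Entries) :
    c.toMat N ∈ symplecticGroup (Fin 2) ℚ ↔ c.IsSymplectic N := by
  have hN' : (N : ℚ) ≠ 0 := by exact_mod_cast hN.ne'
  rw [SymplecticGroup.mem_iff, toMat, J_fin_two, fromBlocks_transpose, fromBlocks_multiply,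
    fromBlocks_multiply]
  simp only [transpose_fin_two, mul_fin_two, fin_two_add]
  obtain ⟨w, hw⟩ : ∃ w : ℚ, (c.k24 : ℚ) / N = w := ⟨_, rfl⟩
  have hw' : (c.k24 : ℚ) = N * w := by rw [← hw]; field_simp
  rw [hw]
  constructor
  · intro hs
    have entry := fun i j => congrFun (congrFun hs i) j
    have q13 := entry (.inr 0) (.inl 0)
    have q24 := entry (.inr 1) (.inl 1)
    have q12 := entry (.inl 1) (.inl 0)
    have q14 := entry (.inr 1) (.inl 0)
    have q23 := entry (.inr 0) (.inl 1)
    have q34 := entry (.inr 1) (.inr 0)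
    simp only [fromBlocks_apply₁₁, fromBlocks_apply₁₂, fromBlocks_apply₂₁, fromBlocks_apply₂₂,
      of_apply, cons_val_zero, cons_val_one, cons_val_fin_one] at q13 q24 q12 q14 q23 q34
    clear hs entry
    constructor <;> qify <;> try simp only [hw']
    · linear_combination q13
    · linear_combination q24
    · linear_combination q12
    · exact (mul_eq_zero.1 (show (N : ℚ) * (c.k11 * c.k43 + c.k12 * c.k44 - c.k13 * c.k41
        - c.k14 * c.k42) = 0 by linear_combination q14)).resolve_left hN'
    · linear_combination q23
    · exact (mul_eq_zero.1 (show (N : ℚ) * (c.k31 * c.k43 + c.k32 * c.k44 - c.k33 * c.k41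
        - c.k34 * c.k42) = 0 by linear_combination q34)).resolve_left hN'
  · rintro ⟨r13, r24, r12, r14, r23, r34⟩
    qify at r13 r24 r12 r14 r23 r34
    rw [hw'] at r12 r24 r23
    refine fromBlocks_congr (fin_two_congr ?_ ?_ ?_ ?_) (fin_two_congr ?_ ?_ ?_ ?_)
      (fin_two_congr ?_ ?_ ?_ ?_) (fin_two_congr ?_ ?_ ?_ ?_)
    · ring
    · linear_combination -r12
    · linear_combination r12
    · ring
    · linear_combination -r13
    · linear_combination -(N : ℚ) * r14
    · linear_combination -r23
    · linear_combination -r24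
    · linear_combination r13
    · linear_combination r23
    · linear_combination (N : ℚ) * r14
    · linear_combination r24
    · ring
    · linear_combination -(N : ℚ) * r34
    · linear_combination (N : ℚ) * r34
    · ring

lemma Entries.inK {N : ℕ} (hN : 0 < N) {c : Entries} (hc : c.IsSymplectic N) : InK N (c.toMat N) :=
  ⟨(c.mem_symplecticGroup_iff hN).2 hc, c.isIntegralAt N⟩

lemma InK.exists_entries {N : ℕ} (hN : 0 < N) {g : Mat4} (hg : InK N g) :
    ∃ c : Entries, c.IsSymplectic N ∧ g = c.toMat N := by
  obtain ⟨c, rfl⟩ := hg.integral.exists_entries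
  exact ⟨c, (c.mem_symplecticGroup_iff hN).1 hg.mem, rfl⟩

/-- The product of integral coordinates. -/
def Entries.mul (N : ℕ) (c e : Entries) : Entries where
  k11 := c.k11 * e.k11 + N * c.k12 * e.k21 + c.k13 * e.k31 + N * c.k14 * e.k41
  k12 := c.k11 * e.k12 + c.k12 * e.k22 + c.k13 * e.k32 + c.k14 * e.k42
  k13 := c.k11 * e.k13 + N * c.k12 * e.k23 + c.k13 * e.k33 + N * c.k14 * e.k43
  k14 := c.k11 * e.k14 + c.k12 * e.k24 + c.k13 * e.k34 + c.k14 * e.k44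
  k21 := c.k21 * e.k11 + c.k22 * e.k21 + c.k23 * e.k31 + c.k24 * e.k41
  k22 := N * c.k21 * e.k12 + c.k22 * e.k22 + N * c.k23 * e.k32 + c.k24 * e.k42
  k23 := c.k21 * e.k13 + c.k22 * e.k23 + c.k23 * e.k33 + c.k24 * e.k43
  k24 := N * c.k21 * e.k14 + c.k22 * e.k24 + N * c.k23 * e.k34 + c.k24 * e.k44
  k31 := c.k31 * e.k11 + N * c.k32 * e.k21 + c.k33 * e.k31 + N * c.k34 * e.k41
  k32 := c.k31 * e.k12 + c.k32 * e.k22 + c.k33 * e.k32 + c.k34 * e.k42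
  k33 := c.k31 * e.k13 + N * c.k32 * e.k23 + c.k33 * e.k33 + N * c.k34 * e.k43
  k34 := c.k31 * e.k14 + c.k32 * e.k24 + c.k33 * e.k34 + c.k34 * e.k44
  k41 := c.k41 * e.k11 + c.k42 * e.k21 + c.k43 * e.k31 + c.k44 * e.k41
  k42 := N * c.k41 * e.k12 + c.k42 * e.k22 + N * c.k43 * e.k32 + c.k44 * e.k42
  k43 := c.k41 * e.k13 + c.k42 * e.k23 + c.k43 * e.k33 + c.k44 * e.k43
  k44 := N * c.k41 * e.k14 + c.k42 * e.k24 + N * c.k43 * e.k34 + c.k44 * e.k44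

lemma Entries.toMat_mul {N : ℕ} (hN : 0 < N) (c e : Entries) :
    c.toMat N * e.toMat N = (c.mul N e).toMat N := by
  have hN' : (N : ℚ) ≠ 0 := by exact_mod_cast hN.ne'
  rw [toMat, toMat, fromBlocks_multiply]
  simp only [mul_fin_two, fin_two_add]
  refine fromBlocks_congr (fin_two_congr ?_ ?_ ?_ ?_) (fin_two_congr ?_ ?_ ?_ ?_)
    (fin_two_congr ?_ ?_ ?_ ?_) (fin_two_congr ?_ ?_ ?_ ?_) <;> simp only [mul] <;> push_cast <;>
    field_simp <;> ring

lemma Entries.IsSymplectic.mul {N : ℕ} (hN : 0 < N) {c e : Entries} (hc : c.IsSymplectic N)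
    (he : e.IsSymplectic N) : (c.mul N e).IsSymplectic N := by
  rw [← mem_symplecticGroup_iff hN, ← toMat_mul hN]
  exact mul_mem ((mem_symplecticGroup_iff hN c).2 hc) ((mem_symplecticGroup_iff hN e).2 he)

/-! ### Unique solvability of congruences -/

lemma existsUnique_inl {α β : Type*} {P : α ⊕ β → Prop} (h : ∃! a, P (.inl a))
    (h' : ∀ b, ¬ P (.inr b)) : ∃! i, P i := by
  obtain ⟨a, ha, hu⟩ := h
  refine ⟨.inl a, ha, ?_⟩
  rintro (b | b) hb
  · rw [hu b hb]
  · exact (h' b hb).elim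

lemma existsUnique_inr {α β : Type*} {P : α ⊕ β → Prop} (h' : ∀ a, ¬ P (.inl a))
    (h : ∃! b, P (.inr b)) : ∃! i, P i := by
  obtain ⟨a, ha, hu⟩ := h
  refine ⟨.inr a, ha, ?_⟩
  rintro (b | b) hb
  · exact (h' b hb).elim
  · rw [hu b hb]

lemma existsUnique_prod {α β : Type*} {P : α × β → Prop} {Q : α → Prop} {R : α → β → Prop}
    (hP : ∀ a b, P (a, b) ↔ Q a ∧ R a b) (h₁ : ∃! a, Q a) (h₂ : ∀ a, Q a → ∃! b, R a b) :
    ∃! i, P i := by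
  obtain ⟨a, ha, hu⟩ := h₁
  obtain ⟨b, hb, hv⟩ := h₂ a ha
  refine ⟨(a, b), (hP a b).2 ⟨ha, hb⟩, ?_⟩
  rintro ⟨a', b'⟩ h
  obtain ⟨h1, h2⟩ := (hP _ _).1 h
  obtain rfl := hu a' h1
  rw [hv b' h2]

lemma existsUnique_fin_dvd {n : ℕ} (hn : 0 < n) {a : ℤ} (h : IsCoprime a n) (b : ℤ) :
    ∃! x : Fin n, (n : ℤ) ∣ b - a * (x : ℕ) := by
  obtain ⟨u, v, huv⟩ := h
  have hn' : (0 : ℤ) < n := by exact_mod_cast hn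
  refine ⟨⟨(b * u % n).toNat, ?_⟩, ?_, ?_⟩
  · have := Int.emod_lt_of_pos (b * u) hn'
    omega
  · have h0 := Int.emod_nonneg (b * u) hn'.ne'
    have h1 := Int.emod_add_mul_ediv (b * u) n
    simp only [Int.toNat_of_nonneg h0]
    exact ⟨b * v + a * (b * u / n), by linear_combination (-b) * huv - a * h1⟩
  · intro y hy
    obtain ⟨w, hw⟩ := hy
    have : ((y : ℕ) : ℤ) = b * u % n := by
      refine (Int.emod_eq_of_lt (Int.natCast_nonneg _)
        (by exact_mod_cast y.2 : ((y : ℕ) : ℤ) < n)).symm.trans ?_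
      refine Int.ModEq.symm (Int.modEq_iff_dvd.2 ⟨v * (y : ℕ) - u * w, ?_⟩)
      linear_combination (-((y : ℕ) : ℤ)) * huv - u * hw
    apply Fin.ext
    simp only [← this, Int.toNat_natCast]

lemma isCoprime_of_not_dvd {p : ℕ} (hp : p.Prime) {a : ℤ} (ha : ¬ (p : ℤ) ∣ a) :
    IsCoprime a p :=
  ((Nat.prime_iff_prime_int.1 hp).coprime_iff_not_dvd.2 ha).symm

lemma existsUnique_unit_dvd {p : ℕ} (hp : p.Prime) {a b : ℤ} (ha : ¬ (p : ℤ) ∣ a)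
    (hb : ¬ (p : ℤ) ∣ b) : ∃! l : Fin (p - 1), (p : ℤ) ∣ b - a * ((l : ℕ) + 1) := by
  obtain ⟨x, hx, hu⟩ := existsUnique_fin_dvd hp.pos (isCoprime_of_not_dvd hp ha) b
  have h0 : (x : ℕ) ≠ 0 := by
    intro h0
    rw [h0] at hx
    exact hb (by simpa using hx)
  refine ⟨⟨x - 1, by omega⟩, ?_, ?_⟩
  · have : (((x : ℕ) - 1 : ℕ) : ℤ) + 1 = (x : ℕ) := by omega
    simpa only [this] using hx
  · intro y hy
    have := hu ⟨y + 1, by omega⟩ (by simpa using hy)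
    have h1 : (y : ℕ) + 1 = x := congrArg Fin.val this
    apply Fin.ext
    simp only
    omega

lemma not_dvd_succ {p : ℕ} (l : Fin (p - 1)) : ¬ (p : ℤ) ∣ (l : ℕ) + 1 := by
  intro h
  have h1 : (p : ℤ) ≤ (l : ℕ) + 1 := Int.le_of_dvd (by positivity) h
  omega

/-- If `(a, b)` is not zero modulo `p` and `(c, d)` is proportional to it, then the factor of
proportionality is unique. -/
lemma existsUnique_fin_dvd_pair {p : ℕ} (hp : p.Prime) {a b c d : ℤ}
    (h : ¬ ((p : ℤ) ∣ a ∧ (p : ℤ) ∣ b)) (hdet : (p : ℤ) ∣ a * d - b * c) :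
    ∃! x : Fin p, (p : ℤ) ∣ c - a * (x : ℕ) ∧ (p : ℤ) ∣ d - b * (x : ℕ) := by
  have hpp := Nat.prime_iff_prime_int.1 hp
  by_cases ha : (p : ℤ) ∣ a
  · have hb : ¬ (p : ℤ) ∣ b := fun hb => h ⟨ha, hb⟩
    obtain ⟨x, hx, hu⟩ := existsUnique_fin_dvd hp.pos (isCoprime_of_not_dvd hp hb) d
    refine ⟨x, ⟨?_, hx⟩, fun y hy => hu y hy.2⟩
    have : (p : ℤ) ∣ b * (c - a * (x : ℕ)) := by
      have := dvd_sub (hx.mul_left a) hdet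
      refine this.trans (dvd_of_eq ?_); ring
    exact (hpp.dvd_mul.1 this).resolve_left hb
  · obtain ⟨x, hx, hu⟩ := existsUnique_fin_dvd hp.pos (isCoprime_of_not_dvd hp ha) c
    refine ⟨x, ⟨hx, ?_⟩, fun y hy => hu y hy.1⟩
    have : (p : ℤ) ∣ a * (d - b * (x : ℕ)) := by
      have := dvd_add (hx.mul_left b) hdet
      refine this.trans (dvd_of_eq ?_); ring
    exact (hpp.dvd_mul.1 this).resolve_left ha

lemma exists_mul_eq_one_add {p : ℕ} (hp : p.Prime) {a : ℤ} (ha : ¬ (p : ℤ) ∣ a) :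
    ∃ b w : ℤ, a * b = 1 + p * w := by
  obtain ⟨u, v, h⟩ := isCoprime_of_not_dvd hp ha
  exact ⟨u, -v, by linear_combination h⟩

/-! ### Character sums -/

lemma expRat_add (x y : ℚ) : expRat (x + y) = expRat x * expRat y := by
  rw [expRat, expRat, expRat, ← Complex.exp_add]
  push_cast
  ring_nf

lemma expRat_intCast (n : ℤ) : expRat n = 1 := by
  rw [expRat]
  have := Complex.exp_int_mul_two_pi_mul_I n
  rw [← this]
  push_cast
  ring_nf

lemma expRat_eq_of_sub_eq {x y : ℚ} (n : ℤ) (h : x - y = n) : expRat x = expRat y := by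
  rw [show x = y + n by linarith, expRat_add, expRat_intCast, mul_one]

lemma sum_expRat_eq_charSum {p : ℕ} (hp : p.Prime) (x : ℤ) :
    ∑ l : Fin (p - 1), expRat (((l : ℕ) + 1 : ℚ) * x / p) = charSum p x := by
  have hp0 : (p : ℚ) ≠ 0 := by exact_mod_cast hp.ne_zero
  have hpow : ∀ l : ℕ, expRat ((l : ℚ) * x / p) = expRat ((x : ℚ) / p) ^ l := by
    intro l
    rw [expRat, expRat, ← Complex.exp_nat_mul]
    push_cast
    ring_nf
  have hsum : ∑ l : Fin (p - 1), expRat (((l : ℕ) + 1 : ℚ) * x / p) =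
      (∑ l ∈ Finset.range p, expRat ((x : ℚ) / p) ^ l) - 1 := by
    rw [Fin.sum_univ_eq_sum_range (fun l => expRat (((l : ℕ) + 1 : ℚ) * x / p)) (p - 1)]
    obtain ⟨n, hn⟩ : ∃ n, p = n + 1 := ⟨p - 1, (Nat.sub_add_cancel hp.one_le).symm⟩
    rw [show Finset.range p = Finset.range (n + 1) by rw [hn], Finset.sum_range_succ', pow_zero,
      add_sub_cancel_right, show p - 1 = n by omega]
    refine Finset.sum_congr rfl fun l _ => ?_
    rw [← hpow]; push_cast; rfl
  rw [hsum, charSum]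
  split_ifs with h
  · obtain ⟨j, hj⟩ := h
    have : expRat ((x : ℚ) / p) = 1 := by
      rw [hj, mul_div_cancel_left₀ _ hp0, expRat_intCast]
    simp [this]
  · have hne : expRat ((x : ℚ) / p) ≠ 1 := by
      intro h1
      rw [expRat, Complex.exp_eq_one_iff] at h1
      obtain ⟨n, hn⟩ := h1
      apply h
      refine ⟨n, ?_⟩
      have h2 : (((x : ℚ) / p : ℚ) : ℂ) = n :=
        mul_left_cancel₀ Complex.two_pi_I_ne_zero (by rw [hn]; ring)
      have h3 : (x : ℚ) / p = n := by exact_mod_cast h2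
      rw [← h3]; field_simp
    have h1 : expRat ((x : ℚ) / p) ^ p = 1 := by
      rw [← hpow, mul_div_cancel_left₀ _ hp0, expRat_intCast]
    rw [geom_sum_eq hne, h1]; simp

/-! ### Representatives in integral coordinates -/

lemma diag4_eq (a b c d : ℚ) :
    diag4 a b c d = fromBlocks !![a, 0; 0, b] !![0, 0; 0, 0] !![0, 0; 0, 0] !![c, 0; 0, d] := by
  ext i j
  rcases i with i | i <;> rcases j with j | j <;> fin_cases i <;> fin_cases j <;> simp [diag4]

lemma zero_fin_two : (0 : Mat2) = !![0, 0; 0, 0] := by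
  ext i j; fin_cases i <;> fin_cases j <;> rfl

lemma toMat_mul_diag4 (N : ℕ) (c : Entries) (d₁ d₂ d₃ d₄ : ℚ) :
    c.toMat N * diag4 d₁ d₂ d₃ d₄ = fromBlocks
      !![c.k11 * d₁, N * c.k12 * d₂; c.k21 * d₁, c.k22 * d₂]
      !![c.k13 * d₃, c.k14 * d₄; c.k23 * d₃, c.k24 / N * d₄]
      !![c.k31 * d₁, N * c.k32 * d₂; N * c.k41 * d₁, N * c.k42 * d₂]
      !![c.k33 * d₃, c.k34 * d₄; N * c.k43 * d₃, c.k44 * d₄] := by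
  rw [diag4_eq, Entries.toMat, fromBlocks_multiply]
  simp only [mul_fin_two, fin_two_add, mul_zero, add_zero, zero_add]

lemma diag4_mul_toMat (N : ℕ) (c : Entries) (d₁ d₂ d₃ d₄ : ℚ) :
    diag4 d₁ d₂ d₃ d₄ * c.toMat N = fromBlocks
      !![d₁ * c.k11, d₁ * (N * c.k12); d₂ * c.k21, d₂ * c.k22]
      !![d₁ * c.k13, d₁ * c.k14; d₂ * c.k23, d₂ * (c.k24 / N)]
      !![d₃ * c.k31, d₃ * (N * c.k32); d₄ * (N * c.k41), d₄ * (N * c.k42)]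
      !![d₃ * c.k33, d₃ * c.k34; d₄ * (N * c.k43), d₄ * c.k44] := by
  rw [diag4_eq, Entries.toMat, fromBlocks_multiply]
  simp only [mul_fin_two, fin_two_add, zero_mul, add_zero, zero_add]

/-- The matrix `δ x δ⁻¹` has integral coordinates as well. -/
def IsAdmissible (N : ℕ) (δ : Mat4) (x : Entries) : Prop :=
  ∃ y : Entries, δ * x.toMat N = y.toMat N * δ

/-- The block upper triangular matrix `[A, B; 0, D]` of multiplier `m` has integral `A`, and it lies
in the coset `K(N) δ Q⁻¹`. -/
structure IsHeckeRep (N : ℕ) (δ : Mat4) (m : ℚ) (A B D : Mat2) (Q : Entries) : Prop where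
  integral : ∀ i j, ∃ z : ℤ, A i j = z
  similitude : IsSimilitude (fromBlocks A B 0 D) m
  symplectic : Q.IsSymplectic N
  quotient : ∃ y : Entries, fromBlocks A B 0 D * Q.toMat N = y.toMat N * δ

lemma IsHeckeRep.mk' {N : ℕ} {d₁ d₂ d₃ d₄ m : ℚ} {A B D : Mat2} {a₁ a₂ a₃ a₄ : ℤ}
    {b₁ b₂ b₃ b₄ e₁ e₂ e₃ e₄ : ℚ} {Q : Entries} (hQ : Q.IsSymplectic N) (y : Entries) (hm : 0 < m)
    (hA : A = !![(a₁ : ℚ), a₂; a₃, a₄]) (hB : B = !![b₁, b₂; b₃, b₄]) (hD : D = !![e₁, e₂; e₃, e₄])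
    (s₁ : a₁ * e₁ + a₃ * e₃ = m) (s₂ : a₁ * e₂ + a₃ * e₄ = 0) (s₃ : a₂ * e₁ + a₄ * e₃ = 0)
    (s₄ : a₂ * e₂ + a₄ * e₄ = m) (s₅ : e₁ * b₂ + e₃ * b₄ = b₁ * e₂ + b₃ * e₄)
    (r₁₁ : a₁ * Q.k11 + a₂ * Q.k21 + (b₁ * Q.k31 + b₂ * (N * Q.k41)) = y.k11 * d₁)
    (r₁₂ : a₁ * (N * Q.k12) + a₂ * Q.k22 + (b₁ * (N * Q.k32) + b₂ * (N * Q.k42)) =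
      N * y.k12 * d₂)
    (r₂₁ : a₃ * Q.k11 + a₄ * Q.k21 + (b₃ * Q.k31 + b₄ * (N * Q.k41)) = y.k21 * d₁)
    (r₂₂ : a₃ * (N * Q.k12) + a₄ * Q.k22 + (b₃ * (N * Q.k32) + b₄ * (N * Q.k42)) = y.k22 * d₂)
    (r₁₃ : a₁ * Q.k13 + a₂ * Q.k23 + (b₁ * Q.k33 + b₂ * (N * Q.k43)) = y.k13 * d₃)
    (r₁₄ : a₁ * Q.k14 + a₂ * (Q.k24 / N) + (b₁ * Q.k34 + b₂ * Q.k44) = y.k14 * d₄)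
    (r₂₃ : a₃ * Q.k13 + a₄ * Q.k23 + (b₃ * Q.k33 + b₄ * (N * Q.k43)) = y.k23 * d₃)
    (r₂₄ : a₃ * Q.k14 + a₄ * (Q.k24 / N) + (b₃ * Q.k34 + b₄ * Q.k44) = y.k24 / N * d₄)
    (r₃₁ : e₁ * Q.k31 + e₂ * (N * Q.k41) = y.k31 * d₁)
    (r₃₂ : e₁ * (N * Q.k32) + e₂ * (N * Q.k42) = N * y.k32 * d₂)
    (r₄₁ : e₃ * Q.k31 + e₄ * (N * Q.k41) = N * y.k41 * d₁)
    (r₄₂ : e₃ * (N * Q.k32) + e₄ * (N * Q.k42) = N * y.k42 * d₂)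
    (r₃₃ : e₁ * Q.k33 + e₂ * (N * Q.k43) = y.k33 * d₃)
    (r₃₄ : e₁ * Q.k34 + e₂ * Q.k44 = y.k34 * d₄)
    (r₄₃ : e₃ * Q.k33 + e₄ * (N * Q.k43) = N * y.k43 * d₃)
    (r₄₄ : e₃ * Q.k34 + e₄ * Q.k44 = y.k44 * d₄) :
    IsHeckeRep N (diag4 d₁ d₂ d₃ d₄) m A B D Q := by
  subst hA hB hD
  refine ⟨?_, isSimilitude_fromBlocks hm ?_ ?_, hQ, y, ?_⟩
  · intro i j
    fin_cases i <;> fin_cases j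
    exacts [⟨a₁, rfl⟩, ⟨a₂, rfl⟩, ⟨a₃, rfl⟩, ⟨a₄, rfl⟩]
  · rw [transpose_fin_two, mul_fin_two, s₁, s₂, s₃, s₄]
    ext i j; fin_cases i <;> fin_cases j <;> simp
  · simp only [transpose_fin_two, mul_fin_two]
    exact fin_two_congr (by ring) s₅ (by linear_combination -s₅) (by ring)
  · rw [toMat_mul_diag4, Entries.toMat, fromBlocks_multiply, zero_fin_two]
    simp only [mul_fin_two, fin_two_add, zero_mul, zero_add]
    exact fromBlocks_congr (fin_two_congr r₁₁ r₁₂ r₂₁ r₂₂) (fin_two_congr r₁₃ r₁₄ r₂₃ r₂₄)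
      (fin_two_congr r₃₁ r₃₂ r₄₁ r₄₂) (fin_two_congr r₃₃ r₃₄ r₄₃ r₄₄)

lemma isSimilitude_diag4 {a b c d m : ℚ} (hm : 0 < m) (h₁ : a * c = m) (h₂ : b * d = m) :
    IsSimilitude (diag4 a b c d) m := by
  rw [diag4_eq, ← zero_fin_two]
  refine isSimilitude_fromBlocks hm ?_ (by simp)
  rw [transpose_fin_two, mul_fin_two]
  ext i j; fin_cases i <;> fin_cases j <;> simp [h₁, h₂]

/-- A criterion for systems of representatives in integral coordinates. -/
theorem isRepSystem_of_isHeckeRep {N : ℕ} (hN : 0 < N) {a b c d m : ℚ} (hm : 0 < m)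
    (h₁ : a * c = m) (h₂ : b * d = m) {ι : Type*} {A B D : ι → Mat2} {Q : ι → Entries}
    (hrep : ∀ i, IsHeckeRep N (diag4 a b c d) m (A i) (B i) (D i) (Q i))
    (hex : ∀ x : Entries, x.IsSymplectic N →
      ∃! i, IsAdmissible N (diag4 a b c d) (x.mul N (Q i))) :
    IsRepSystem N (diag4 a b c d) fun i => fromBlocks (A i) (B i) 0 (D i) := by
  have key : ∀ X : Mat4, (∃ y : Entries, X = y.toMat N * diag4 a b c d) ↔
      ∀ i j, ∃ z : ℤ, X i j = entryScale N i j * (Sum.elim ![a, b] ![c, d]) j * z := by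
    intro X
    constructor
    · rintro ⟨y, rfl⟩ i j
      obtain ⟨z, hz⟩ := y.isIntegralAt N i j
      refine ⟨z, ?_⟩
      rw [diag4, mul_diagonal, hz]
      ring
    · intro h
      choose z hz using h
      obtain ⟨y, hy⟩ := IsIntegralAt.exists_entries (N := N)
        (g := Matrix.of fun i j => entryScale N i j * z i j) fun i j => ⟨z i j, rfl⟩
      refine ⟨y, ?_⟩
      rw [← hy]
      ext i j
      rw [diag4, mul_diagonal, hz, of_apply]
      ring
  refine isRepSystem_of_forall_existsUnique hN (Q := fun i => (Q i).toMat N) ?_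
    (isSimilitude_diag4 hm h₁ h₂) (fun i => (hrep i).similitude)
    (fun i => Entries.inK hN (hrep i).symplectic) (fun i => (key _).1 (hrep i).quotient) ?_
  · rintro (i | i) <;> fin_cases i <;> simp <;> rintro rfl <;> simp at h₁ h₂ <;> linarith
  · intro κ hκ
    obtain ⟨x, hx, rfl⟩ := hκ.exists_entries hN
    obtain ⟨i, hi, hu⟩ := hex x hx
    have e : ∀ i, (∀ s t, ∃ z : ℤ, (Sum.elim ![a, b] ![c, d]) s * (x.toMat N * (Q i).toMat N) s t =
        entryScale N s t * (Sum.elim ![a, b] ![c, d]) t * z) ↔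
        IsAdmissible N (diag4 a b c d) (x.mul N (Q i)) := by
      intro i
      rw [IsAdmissible, key, ← Entries.toMat_mul hN]
      simp only [diag4, diagonal_mul]
    exact ⟨i, (e i).2 hi, fun j hj => hu j ((e j).1 hj)⟩

lemma isAdmissible_of_eq {N : ℕ} {d₁ d₂ d₃ d₄ : ℚ} {c y : Entries}
    (r₁₁ : d₁ * c.k11 = y.k11 * d₁) (r₁₂ : d₁ * c.k12 = y.k12 * d₂)
    (r₂₁ : d₂ * c.k21 = y.k21 * d₁) (r₂₂ : d₂ * c.k22 = y.k22 * d₂)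
    (r₁₃ : d₁ * c.k13 = y.k13 * d₃) (r₁₄ : d₁ * c.k14 = y.k14 * d₄)
    (r₂₃ : d₂ * c.k23 = y.k23 * d₃) (r₂₄ : d₂ * c.k24 = y.k24 * d₄)
    (r₃₁ : d₃ * c.k31 = y.k31 * d₁) (r₃₂ : d₃ * c.k32 = y.k32 * d₂)
    (r₄₁ : d₄ * c.k41 = y.k41 * d₁) (r₄₂ : d₄ * c.k42 = y.k42 * d₂)
    (r₃₃ : d₃ * c.k33 = y.k33 * d₃) (r₃₄ : d₃ * c.k34 = y.k34 * d₄)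
    (r₄₃ : d₄ * c.k43 = y.k43 * d₃) (r₄₄ : d₄ * c.k44 = y.k44 * d₄) :
    IsAdmissible N (diag4 d₁ d₂ d₃ d₄) c := by
  refine ⟨y, ?_⟩
  rw [diag4_mul_toMat, toMat_mul_diag4]
  exact fromBlocks_congr
    (fin_two_congr r₁₁ (by linear_combination (N : ℚ) * r₁₂) r₂₁ r₂₂)
    (fin_two_congr r₁₃ r₁₄ r₂₃ (by linear_combination (N : ℚ)⁻¹ * r₂₄))
    (fin_two_congr r₃₁ (by linear_combination (N : ℚ) * r₃₂)
      (by linear_combination (N : ℚ) * r₄₁) (by linear_combination (N : ℚ) * r₄₂))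
    (fin_two_congr r₃₃ r₃₄ (by linear_combination (N : ℚ) * r₄₃) r₄₄)

lemma IsAdmissible.exists_eq {N : ℕ} (hN : 0 < N) {d₁ d₂ d₃ d₄ : ℚ} {c : Entries}
    (h : IsAdmissible N (diag4 d₁ d₂ d₃ d₄) c) : ∃ y : Entries,
    d₁ * c.k12 = y.k12 * d₂ ∧ d₁ * c.k13 = y.k13 * d₃ ∧ d₁ * c.k14 = y.k14 * d₄ ∧
    d₂ * c.k23 = y.k23 * d₃ ∧ d₂ * c.k24 = y.k24 * d₄ ∧ d₄ * c.k41 = y.k41 * d₁ ∧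
    d₄ * c.k42 = y.k42 * d₂ ∧ d₄ * c.k43 = y.k43 * d₃ := by
  have hN' : (N : ℚ) ≠ 0 := by exact_mod_cast hN.ne'
  obtain ⟨y, hy⟩ := h
  rw [diag4_mul_toMat, toMat_mul_diag4] at hy
  have e := fun i j => congrFun (congrFun hy i) j
  have e12 := e (.inl 0) (.inl 1)
  have e13 := e (.inl 0) (.inr 0)
  have e14 := e (.inl 0) (.inr 1)
  have e23 := e (.inl 1) (.inr 0)
  have e24 := e (.inl 1) (.inr 1)
  have e41 := e (.inr 1) (.inl 0)
  have e42 := e (.inr 1) (.inl 1)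
  have e43 := e (.inr 1) (.inr 0)
  simp only [fromBlocks_apply₁₁, fromBlocks_apply₁₂, fromBlocks_apply₂₁, fromBlocks_apply₂₂,
    of_apply, cons_val_zero, cons_val_one, cons_val_fin_one] at e12 e13 e14 e23 e24 e41 e42 e43
  refine ⟨y, mul_left_cancel₀ hN' (by linear_combination e12), e13, e14, e23, ?_,
    mul_left_cancel₀ hN' (by linear_combination e41),
    mul_left_cancel₀ hN' (by linear_combination e42),
    mul_left_cancel₀ hN' (by linear_combination e43)⟩
  refine mul_left_cancel₀ (inv_ne_zero hN') ?_
  linear_combination e24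

section Criteria

variable {N p : ℕ} {x : Entries}

lemma not_dvd_of_mul_eq_one_add {p : ℕ} (hp : p.Prime) {a b w : ℤ} (h : a * b = 1 + p * w) :
    ¬ (p : ℤ) ∣ a := fun h' => (Nat.prime_iff_prime_int.1 hp).not_isUnit
      (isUnit_of_dvd_one ((Int.dvd_add_left (Dvd.intro w rfl)).1 (h ▸ h'.mul_right b)))

/-- Admissibility for `T(p)` is a condition on the upper right block. -/
lemma isAdmissible_deltaT_iff (hN : 0 < N) :
    IsAdmissible N (deltaT p) x ↔
      ((p : ℤ) ∣ x.k13 ∧ (p : ℤ) ∣ x.k14) ∧ (p : ℤ) ∣ x.k23 ∧ (p : ℤ) ∣ x.k24 := by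
  constructor
  · intro h
    obtain ⟨y, h12, h13, h14, h23, h24, -⟩ := h.exists_eq hN
    refine ⟨⟨⟨y.k13, ?_⟩, ⟨y.k14, ?_⟩⟩, ⟨y.k23, ?_⟩, ⟨y.k24, ?_⟩⟩ <;> qify <;> linarith
  · rintro ⟨⟨⟨z13, h13⟩, ⟨z14, h14⟩⟩, ⟨z23, h23⟩, ⟨z24, h24⟩⟩
    refine isAdmissible_of_eq (y := ⟨x.k11, x.k12, z13, z14, x.k21, x.k22, z23, z24,
      p * x.k31, p * x.k32, x.k33, x.k34, p * x.k41, p * x.k42, x.k43, x.k44⟩)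
      ?_ ?_ ?_ ?_ ?_ ?_ ?_ ?_ ?_ ?_ ?_ ?_ ?_ ?_ ?_ ?_ <;>
    simp only [h13, h14, h23, h24] <;> push_cast <;> ring

lemma isAdmissible_deltaT_iff_of_dvd (hN : 0 < N) (hp : p.Prime) (hpN : p ∣ N)
    (hx : x.IsSymplectic N) : IsAdmissible N (deltaT p) x ↔
      (p : ℤ) ∣ x.k13 ∧ (p : ℤ) ∣ x.k14 ∧ (p : ℤ) ∣ x.k24 := by
  rw [isAdmissible_deltaT_iff hN]
  refine ⟨fun h => ⟨h.1.1, h.1.2, h.2.2⟩, fun ⟨h13, h14, h24⟩ => ⟨⟨h13, h14⟩, ?_, h24⟩⟩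
  obtain ⟨q, hq⟩ := hpN
  have hqz : (N : ℤ) = p * q := by exact_mod_cast hq
  obtain ⟨z13, h13⟩ := h13
  obtain ⟨z14, h14⟩ := h14
  obtain ⟨z24, h24⟩ := h24
  have h11 : ¬ (p : ℤ) ∣ x.k11 := not_dvd_of_mul_eq_one_add hp (b := x.k33)
    (w := - q * x.k12 * x.k34 + z13 * x.k31 + q * x.k14 * x.k32) (by
      have := hx.r13
      rw [h13, hqz] at this
      linear_combination this)
  refine ((Nat.prime_iff_prime_int.1 hp).dvd_mul.1 (Dvd.intro
    (-x.k12 * z24 + z13 * x.k21 + z14 * x.k22) ?_ : (p : ℤ) ∣ x.k11 * x.k23)).resolve_left h11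
  have := hx.r12
  rw [h13, h14, h24] at this
  linear_combination -this

lemma isAdmissible_deltaT0_iff (hN : 0 < N) (hp : p.Prime) (hpN : p ∣ N)
    (hx : x.IsSymplectic N) : IsAdmissible N (deltaT0 p) x ↔
      (p : ℤ) ∣ x.k41 ∧ (p : ℤ) ∣ x.k43 ∧ (p : ℤ) ^ 2 ∣ x.k42 := by
  have hp0 : (p : ℚ) ≠ 0 := by exact_mod_cast hp.ne_zero
  constructor
  · intro h
    obtain ⟨y, -, -, -, -, -, h41, h42, h43⟩ := h.exists_eq hN
    refine ⟨⟨y.k41, ?_⟩, ⟨y.k43, ?_⟩, ⟨y.k42, ?_⟩⟩ <;> qify <;> linarith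
  · rintro ⟨⟨z41, h41⟩, ⟨z43, h43⟩, ⟨z42, h42⟩⟩
    obtain ⟨q, hq⟩ := hpN
    have hqz : (N : ℤ) = p * q := by exact_mod_cast hq
    have h44 : ¬ (p : ℤ) ∣ x.k44 := not_dvd_of_mul_eq_one_add hp (b := x.k22)
      (w := - q * x.k21 * x.k43 + q * x.k23 * x.k41 + x.k24 * p * z42) (by
        have := hx.r24
        rw [h42, hqz] at this
        linear_combination this)
    obtain ⟨z12, h12⟩ := ((Nat.prime_iff_prime_int.1 hp).dvd_mul.1 (Dvd.intro
      (-x.k11 * z43 + x.k13 * z41 + x.k14 * p * z42) (by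
        have := hx.r14
        rw [h41, h42, h43] at this
        linear_combination -this) : (p : ℤ) ∣ x.k12 * x.k44)).resolve_right h44
    obtain ⟨z32, h32⟩ := ((Nat.prime_iff_prime_int.1 hp).dvd_mul.1 (Dvd.intro
      (-x.k31 * z43 + x.k33 * z41 + x.k34 * p * z42) (by
        have := hx.r34
        rw [h41, h42, h43] at this
        linear_combination -this) : (p : ℤ) ∣ x.k32 * x.k44)).resolve_right h44
    refine isAdmissible_of_eq (y := ⟨x.k11, z12, x.k13, p * x.k14, p * x.k21, x.k22, p * x.k23,
      p ^ 2 * x.k24, x.k31, z32, x.k33, p * x.k34, z41, z42, z43, x.k44⟩)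
      ?_ ?_ ?_ ?_ ?_ ?_ ?_ ?_ ?_ ?_ ?_ ?_ ?_ ?_ ?_ ?_ <;>
    simp only [h12, h32, h41, h42, h43] <;> push_cast <;> ring

lemma isAdmissible_deltaT1_iff (hN : 0 < N) (hp : p.Prime) (hx : x.IsSymplectic N) :
    IsAdmissible N (deltaT1 p) x ↔
      (p : ℤ) ∣ x.k12 ∧ (p : ℤ) ∣ x.k14 ∧ (p : ℤ) ^ 2 ∣ x.k13 := by
  have hp0 : (p : ℚ) ≠ 0 := by exact_mod_cast hp.ne_zero
  constructor
  · intro h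
    obtain ⟨y, h12, h13, h14, -⟩ := h.exists_eq hN
    refine ⟨⟨y.k12, ?_⟩, ⟨y.k14, ?_⟩, ⟨y.k13, ?_⟩⟩ <;> qify <;> linarith
  · rintro ⟨⟨z12, h12⟩, ⟨z14, h14⟩, ⟨z13, h13⟩⟩
    have h11 : ¬ (p : ℤ) ∣ x.k11 := not_dvd_of_mul_eq_one_add hp (b := x.k33)
      (w := - N * z12 * x.k34 + p * z13 * x.k31 + N * z14 * x.k32) (by
        have := hx.r13
        rw [h12, h13, h14] at this
        linear_combination this)
    obtain ⟨z23, h23⟩ := ((Nat.prime_iff_prime_int.1 hp).dvd_mul.1 (Dvd.intro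
      (-z12 * x.k24 + p * z13 * x.k21 + z14 * x.k22) (by
        have := hx.r12
        rw [h12, h13, h14] at this
        linear_combination -this) : (p : ℤ) ∣ x.k11 * x.k23)).resolve_left h11
    obtain ⟨z43, h43⟩ := ((Nat.prime_iff_prime_int.1 hp).dvd_mul.1 (Dvd.intro
      (-z12 * x.k44 + p * z13 * x.k41 + z14 * x.k42) (by
        have := hx.r14
        rw [h12, h13, h14] at this
        linear_combination -this) : (p : ℤ) ∣ x.k11 * x.k43)).resolve_left h11
    refine isAdmissible_of_eq (y := ⟨x.k11, z12, z13, z14, p * x.k21, x.k22, z23, x.k24,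
      p ^ 2 * x.k31, p * x.k32, x.k33, p * x.k34, p * x.k41, x.k42, z43, x.k44⟩)
      ?_ ?_ ?_ ?_ ?_ ?_ ?_ ?_ ?_ ?_ ?_ ?_ ?_ ?_ ?_ ?_ <;>
    simp only [h12, h13, h14, h23, h43] <;> push_cast <;> ring

end Criteria

section RepT

lemma dvd_iff_of_sub_eq {n a b : ℤ} (z : ℤ) (h : a - b = n * z) : n ∣ a ↔ n ∣ b := by
  rw [show a = b + n * z by linarith]
  exact Int.dvd_add_left (Dvd.intro z rfl)

/-! ### Representatives for `T(p)` at a prime dividing the level exactly once -/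

/-- The index set of the representatives for `T(p)` with `p ∥ N`. -/
abbrev IndexT (p : ℕ) : Type :=
  (Fin p × Fin p × Fin p) ⊕ (Fin p × Fin p) ⊕ (Fin p × Fin p) ⊕ Unit ⊕ Fin (p - 1)

/-- The blocks `A`, `B`, `D` of the representatives for `T(p)` with `p ∥ N`. Here `a p - c N / p = 1`,
and `l : Fin (p - 1)` stands for the nonzero residue class of `l + 1`. -/
def repT (N p : ℕ) (M a c : ℤ) : IndexT p → Mat2 × Mat2 × Mat2
  | .inl (b₁, b₃, b₂) => (!![1, 0; 0, 1], !![(b₁ : ℕ), (b₂ : ℕ); (b₂ : ℕ), (b₃ : ℕ) / (N : ℚ)],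
      !![(p : ℚ), 0; 0, p])
  | .inr (.inl (b₃, x)) => (!![(p : ℚ), 0; (x : ℕ), 1], !![0, 0; 0, (b₃ : ℕ) / (N : ℚ)],
      !![1, -((x : ℕ) : ℚ); 0, p])
  | .inr (.inr (.inl (b₁, y))) => (!![1, -(N * M * (y : ℕ) : ℚ); 0, p], !![((b₁ : ℕ) : ℚ), 0; 0, 0],
      !![(p : ℚ), 0; N * M * (y : ℕ), 1])
  | .inr (.inr (.inr (.inl _))) => (!![(p : ℚ), 0; 0, p], !![0, 0; 0, 0], !![1, 0; 0, 1])
  | .inr (.inr (.inr (.inr l))) => (!![(p : ℚ), -N; -c, a * p],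
      !![-(((l : ℕ) + 1) * (N / p) : ℚ), (l : ℕ) + 1; ((l : ℕ) + 1) * a, -(((l : ℕ) + 1) * c / p)],
      !![(a * p : ℚ), c; N, p])

/-- The elements `Q ∈ K(N)` for which the coset of the representative is `K(N) δ Q⁻¹`; here `μ l` is
an inverse of `(l + 1) N / p` modulo `p`. -/
def quotT (M : ℤ) (p : ℕ) (μ : Fin (p - 1) → ℤ) : IndexT p → Entries
  | .inl (b₁, b₃, b₂) => ⟨1, 0, -(b₁ : ℕ), -(b₂ : ℕ), 0, 1, -(b₂ : ℕ), -(b₃ : ℕ),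
      0, 0, 1, 0, 0, 0, 0, 1⟩
  | .inr (.inl (b₃, x)) => ⟨0, 0, 1, 0, 0, 1, -(x : ℕ), -(b₃ : ℕ), -1, 0, 0, (x : ℕ), 0, 0, 0, 1⟩
  | .inr (.inr (.inl (b₁, y))) => ⟨1, 0, -(b₁ : ℕ), M * (y : ℕ), 0, 0, 0, 1,
      0, 0, 1, 0, 0, -1, -(M * (y : ℕ)), 0⟩
  | .inr (.inr (.inr (.inl _))) => ⟨0, 0, 1, 0, 0, 0, 0, 1, -1, 0, 0, 0, 0, -1, 0, 0⟩
  | .inr (.inr (.inr (.inr l))) => ⟨0, 0, 1, 0, 0, 0, 0, 1, -1, 0, 0, -μ l, 0, -1, -μ l, 0⟩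

variable {N p : ℕ} {M a c : ℤ}

lemma isHeckeRep_repT (hN : 0 < N) (hp : p.Prime) {q : ℕ} (hq : N = p * q)
    (hac : a * p - c * q = 1) {μ w : Fin (p - 1) → ℤ}
    (hμ : ∀ l : Fin (p - 1), ((((l : ℕ) : ℤ) + 1) * q) * μ l = 1 + p * w l) (i : IndexT p) :
    IsHeckeRep N (deltaT p) p (repT N p M a c i).1 (repT N p M a c i).2.1 (repT N p M a c i).2.2
      (quotT M p μ i) := by
  have hN0 : (N : ℚ) ≠ 0 := by exact_mod_cast hN.ne'
  have hp0 : (p : ℚ) ≠ 0 := by exact_mod_cast hp.ne_zero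
  have hp1 : (0 : ℚ) < p := by exact_mod_cast hp.pos
  rcases i with ⟨b₁, b₃, b₂⟩ | ⟨b₃, x⟩ | ⟨b₁, y⟩ | i | l
  · refine IsHeckeRep.mk' (a₁ := 1) (a₂ := 0) (a₃ := 0) (a₄ := 1) ?_
      ⟨1, 0, 0, 0, 0, 1, 0, 0, 0, 0, 1, 0, 0, 0, 0, 1⟩ hp1 (by simp [repT]) rfl rfl
      ?_ ?_ ?_ ?_ ?_ ?_ ?_ ?_ ?_ ?_ ?_ ?_ ?_ ?_ ?_ ?_ ?_ ?_ ?_ ?_ ?_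
    · constructor <;> simp only [quotT] <;> ring
    all_goals (try simp only [quotT]); (try push_cast); (try field_simp); try ring
  · refine IsHeckeRep.mk' (a₁ := p) (a₂ := 0) (a₃ := (x : ℕ)) (a₄ := 1) ?_
      ⟨0, 0, 1, 0, 0, 1, 0, 0, -1, 0, 0, 0, 0, 0, 0, 1⟩ hp1 (by simp [repT]) rfl rfl
      ?_ ?_ ?_ ?_ ?_ ?_ ?_ ?_ ?_ ?_ ?_ ?_ ?_ ?_ ?_ ?_ ?_ ?_ ?_ ?_ ?_
    · constructor <;> simp only [quotT] <;> ring
    all_goals (try simp only [quotT]); (try push_cast); (try field_simp); try ring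
  · refine IsHeckeRep.mk' (a₁ := 1) (a₂ := -(N * M * (y : ℕ))) (a₃ := 0) (a₄ := p) ?_
      ⟨1, 0, 0, 0, 0, 0, 0, 1, 0, 0, 1, 0, 0, -1, 0, 0⟩ hp1 (by simp [repT]) rfl rfl
      ?_ ?_ ?_ ?_ ?_ ?_ ?_ ?_ ?_ ?_ ?_ ?_ ?_ ?_ ?_ ?_ ?_ ?_ ?_ ?_ ?_
    · constructor <;> simp only [quotT] <;> ring
    all_goals (try simp only [quotT]); (try push_cast); (try field_simp); try ring
  · refine IsHeckeRep.mk' (a₁ := p) (a₂ := 0) (a₃ := 0) (a₄ := p) ?_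
      ⟨0, 0, 1, 0, 0, 0, 0, 1, -1, 0, 0, 0, 0, -1, 0, 0⟩ hp1 (by simp [repT]) rfl rfl
      ?_ ?_ ?_ ?_ ?_ ?_ ?_ ?_ ?_ ?_ ?_ ?_ ?_ ?_ ?_ ?_ ?_ ?_ ?_ ?_ ?_
    · constructor <;> simp only [quotT] <;> ring
    all_goals (try simp only [quotT]); (try push_cast); (try field_simp); try ring
  · have h1 : (((l : ℕ) + 1) * q * μ l : ℚ) = 1 + p * w l := by exact_mod_cast hμ l
    have h2 : (a * p - c * q : ℚ) = 1 := by exact_mod_cast hac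
    have h3 : (N : ℚ) = p * q := by exact_mod_cast hq
    have hq0 : (q : ℚ) ≠ 0 := by rintro h; rw [h, mul_zero] at h3; exact hN0 h3
    refine IsHeckeRep.mk' (a₁ := p) (a₂ := -N) (a₃ := -c) (a₄ := a * p) ?_
      ⟨((l : ℕ) + 1) * q, -((l : ℕ) + 1), -(p * w l), w l,
        -(((l : ℕ) + 1) * a), ((l : ℕ) + 1) * c * q, c * w l, -(a * p * w l),
        -(a * p), -c, -(q * μ l * c), -(μ l * a), -1, -p, -μ l, -(μ l * q)⟩ hp1
        (by simp [repT]) rfl rfl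
      ?_ ?_ ?_ ?_ ?_ ?_ ?_ ?_ ?_ ?_ ?_ ?_ ?_ ?_ ?_ ?_ ?_ ?_ ?_ ?_ ?_
    · constructor <;> simp only [quotT] <;> ring
    all_goals (try simp only [quotT]); (try push_cast); (try simp only [h3]); (try field_simp); try ring1
    · linear_combination h2
    · linear_combination h2
    · linear_combination -(p : ℚ) * h1
    · linear_combination h1
    · linear_combination (c : ℚ) * h1
    · linear_combination -(a * p : ℚ) * h1

/-- The five families cover disjoint cases: which one contains the solution is decided by whether
`p` divides the entries `k11` and `k22`, and, if it divides both, the entry `k12`. In each case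
the congruences determine the parameters one after the other. -/
lemma existsUnique_isAdmissible_quotT (hN : 0 < N) (hp : p.Prime) {q : ℕ} (hq : N = p * q)
    (hq₁ : ¬ (p : ℤ) ∣ q) (hM : ¬ (p : ℤ) ∣ M) {μ w : Fin (p - 1) → ℤ}
    (hμ : ∀ l : Fin (p - 1), ((((l : ℕ) : ℤ) + 1) * q) * μ l = 1 + p * w l)
    (hQ : ∀ i, (quotT M p μ i).IsSymplectic N)
    {x : Entries} (hx : x.IsSymplectic N) :
    ∃! i, IsAdmissible N (deltaT p) (x.mul N (quotT M p μ i)) := by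
  have hpp := Nat.prime_iff_prime_int.1 hp
  have hqz : (N : ℤ) = p * q := by exact_mod_cast hq
  have crit : ∀ i, IsAdmissible N (deltaT p) (x.mul N (quotT M p μ i)) ↔ _ := fun i =>
    isAdmissible_deltaT_iff_of_dvd hN hp ⟨q, hq⟩ (hx.mul hN (hQ i))
  -- the conditions for the five families
  have c₁ : ∀ b₁ b₃ b₂ : Fin p, IsAdmissible N (deltaT p) (x.mul N (quotT M p μ
      (.inl (b₁, b₃, b₂)))) ↔ (p : ℤ) ∣ x.k13 - x.k11 * (b₁ : ℕ) ∧
        (p : ℤ) ∣ x.k14 - x.k12 * (b₃ : ℕ) - x.k11 * (b₂ : ℕ) ∧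
          (p : ℤ) ∣ x.k24 - x.k22 * (b₃ : ℕ) := by
    intro b₁ b₃ b₂
    rw [crit]
    simp only [Entries.mul, quotT, hqz]
    exact and_congr (dvd_iff_of_sub_eq (-q * x.k12 * (b₂ : ℕ)) (by ring))
      (and_congr (dvd_iff_of_sub_eq 0 (by ring))
        (dvd_iff_of_sub_eq (-q * x.k21 * (b₂ : ℕ)) (by ring)))
  have c₂ : ∀ b₃ y : Fin p, IsAdmissible N (deltaT p) (x.mul N (quotT M p μ
      (.inr (.inl (b₃, y))))) ↔ (p : ℤ) ∣ x.k11 ∧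
        (p : ℤ) ∣ x.k14 - x.k12 * (b₃ : ℕ) - (-x.k13) * (y : ℕ) ∧
          (p : ℤ) ∣ x.k24 - x.k22 * (b₃ : ℕ) := by
    intro b₃ y
    rw [crit]
    simp only [Entries.mul, quotT, hqz]
    exact and_congr (dvd_iff_of_sub_eq (-q * x.k12 * (y : ℕ)) (by ring))
      (and_congr (dvd_iff_of_sub_eq 0 (by ring))
        (dvd_iff_of_sub_eq (q * x.k23 * (y : ℕ)) (by ring)))
  have c₃ : ∀ b₁ y : Fin p, IsAdmissible N (deltaT p) (x.mul N (quotT M p μ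
      (.inr (.inr (.inl (b₁, y)))))) ↔ (p : ℤ) ∣ x.k13 - x.k11 * (b₁ : ℕ) ∧
        (p : ℤ) ∣ x.k12 - (-(x.k11 * M)) * (y : ℕ) ∧ (p : ℤ) ∣ x.k22 := by
    intro b₁ y
    rw [crit]
    simp only [Entries.mul, quotT, hqz]
    exact and_congr (dvd_iff_of_sub_eq (-q * x.k14 * (M * (y : ℕ))) (by ring))
      (and_congr (dvd_iff_of_sub_eq 0 (by ring))
        (dvd_iff_of_sub_eq (q * x.k21 * (M * (y : ℕ))) (by ring)))
  have c₄ : ∀ u : Unit, IsAdmissible N (deltaT p) (x.mul N (quotT M p μ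
      (.inr (.inr (.inr (.inl u)))))) ↔ (p : ℤ) ∣ x.k11 ∧ (p : ℤ) ∣ x.k12 ∧ (p : ℤ) ∣ x.k22 := by
    intro u
    rw [crit]
    simp only [Entries.mul, quotT, hqz]
    exact and_congr (dvd_iff_of_sub_eq 0 (by ring))
      (and_congr (dvd_iff_of_sub_eq 0 (by ring)) (dvd_iff_of_sub_eq 0 (by ring)))
  have c₅ : ∀ l : Fin (p - 1), IsAdmissible N (deltaT p) (x.mul N (quotT M p μ
      (.inr (.inr (.inr (.inr l)))))) ↔ (p : ℤ) ∣ x.k11 ∧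
        (p : ℤ) ∣ x.k13 - q * x.k12 * ((l : ℕ) + 1) ∧ (p : ℤ) ∣ x.k22 := by
    intro l
    rw [crit]
    simp only [Entries.mul, quotT, hqz]
    have hl : ¬ (p : ℤ) ∣ (((l : ℕ) : ℤ) + 1) * q := not_dvd_of_mul_eq_one_add hp (hμ l)
    refine and_congr (dvd_iff_of_sub_eq (-q * x.k14 * μ l) (by ring)) (and_congr ?_
      (dvd_iff_of_sub_eq (-q * x.k23 * μ l) (by ring)))
    rw [← (or_iff_right hl : _ ↔ (p : ℤ) ∣ x.k11 * 0 + x.k12 * 1 + x.k13 * -μ l + x.k14 * 0),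
      ← hpp.dvd_mul, ← dvd_neg]
    exact dvd_iff_of_sub_eq (x.k13 * w l) (by linear_combination x.k13 * hμ l)
  have hq' : (p : ℤ) ∣ N := ⟨q, hqz⟩
  -- modulo `p` the relation `r13` only involves the columns 1 and 3, and `r24` the columns 2 and 4
  have u₁ : (p : ℤ) ∣ x.k11 → ¬ (p : ℤ) ∣ x.k13 := by
    rintro ⟨s, hs⟩ ⟨t, ht⟩
    refine hpp.not_isUnit (isUnit_of_dvd_one ⟨s * x.k33 + q * x.k12 * x.k34 - t * x.k31
      - q * x.k14 * x.k32, ?_⟩)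
    rw [← hx.r13, hs, ht, hqz]; ring
  have u₂ : (p : ℤ) ∣ x.k22 → ¬ (p : ℤ) ∣ x.k24 := by
    rintro ⟨s, hs⟩ ⟨t, ht⟩
    refine hpp.not_isUnit (isUnit_of_dvd_one ⟨q * x.k21 * x.k43 + s * x.k44 - q * x.k23 * x.k41
      - t * x.k42, ?_⟩)
    rw [← hx.r24, hs, ht, hqz]; ring
  have v₁ : ∀ b : ℤ, (p : ℤ) ∣ x.k11 → ¬ (p : ℤ) ∣ x.k13 - x.k11 * b := fun b h h' =>
    u₁ h ((dvd_sub_left (h.mul_right b)).1 h')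
  have v₂ : ∀ b : ℤ, (p : ℤ) ∣ x.k22 → ¬ (p : ℤ) ∣ x.k24 - x.k22 * b := fun b h h' =>
    u₂ h ((dvd_sub_left (h.mul_right b)).1 h')
  by_cases h11 : (p : ℤ) ∣ x.k11 <;> by_cases h22 : (p : ℤ) ∣ x.k22
  · refine existsUnique_inr ?_ (existsUnique_inr ?_ (existsUnique_inr ?_ ?_))
    · rintro ⟨b₁, b₃, b₂⟩ h
      exact v₁ _ h11 ((c₁ _ _ _).1 h).1
    · rintro ⟨b₃, y⟩ h
      exact v₂ _ h22 ((c₂ _ _).1 h).2.2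
    · rintro ⟨b₁, y⟩ h
      exact v₁ _ h11 ((c₃ _ _).1 h).1
    -- the remaining representatives are the one with `B = 0` and the family of the `λ ≠ 0`
    by_cases h12 : (p : ℤ) ∣ x.k12
    · refine existsUnique_inl ⟨(), (c₄ _).2 ⟨h11, h12, h22⟩, fun _ _ => rfl⟩ ?_
      intro l h
      exact u₁ h11 ((dvd_sub_left ((h12.mul_left _).mul_right _)).1 ((c₅ _).1 h).2.1)
    · refine existsUnique_inr (fun u h => h12 ((c₄ _).1 h).2.1) ?_
      simp only [c₅, h11, h22, true_and, and_true]
      exact existsUnique_unit_dvd hp (fun h => (hpp.dvd_mul.1 h).elim hq₁ h12) (u₁ h11)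
  · refine existsUnique_inr ?_ (existsUnique_inl ?_ ?_)
    · rintro ⟨b₁, b₃, b₂⟩ h
      exact v₁ _ h11 ((c₁ _ _ _).1 h).1
    · refine existsUnique_prod (fun b₃ y => (c₂ b₃ y).trans
        ⟨fun h => ⟨h.2.2, h.2.1⟩, fun h => ⟨h11, h.2, h.1⟩⟩)
        (existsUnique_fin_dvd hp.pos (isCoprime_of_not_dvd hp h22) _) fun b₃ _ => ?_
      exact existsUnique_fin_dvd hp.pos
        (isCoprime_of_not_dvd hp (by rw [dvd_neg]; exact u₁ h11)) _
    · rintro (⟨b₁, y⟩ | u | l) h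
      · exact h22 ((c₃ _ _).1 h).2.2
      · exact h22 ((c₄ _).1 h).2.2
      · exact h22 ((c₅ _).1 h).2.2
  · refine existsUnique_inr ?_ (existsUnique_inr ?_ (existsUnique_inl ?_ ?_))
    · rintro ⟨b₁, b₃, b₂⟩ h
      exact v₂ _ h22 ((c₁ _ _ _).1 h).2.2
    · rintro ⟨b₃, y⟩ h
      exact h11 ((c₂ _ _).1 h).1
    · refine existsUnique_prod (fun b₁ y => (c₃ b₁ y).trans
        ⟨fun h => ⟨h.1, h.2.1⟩, fun h => ⟨h.1, h.2, h22⟩⟩)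
        (existsUnique_fin_dvd hp.pos (isCoprime_of_not_dvd hp h11) _) fun b₁ _ => ?_
      exact existsUnique_fin_dvd hp.pos (isCoprime_of_not_dvd hp
        (by rw [dvd_neg]; exact fun h => (hpp.dvd_mul.1 h).elim h11 hM)) _
    · rintro (u | l) h
      · exact h11 ((c₄ _).1 h).1
      · exact h11 ((c₅ _).1 h).1
  · refine existsUnique_inl ?_ ?_
    · refine existsUnique_prod (R := fun _ i => (p : ℤ) ∣ x.k24 - x.k22 * (i.1 : ℕ) ∧
        (p : ℤ) ∣ x.k14 - x.k12 * (i.1 : ℕ) - x.k11 * (i.2 : ℕ)) (fun b₁ i => ?_)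
        (existsUnique_fin_dvd hp.pos (isCoprime_of_not_dvd hp h11) x.k13) fun b₁ _ =>
        existsUnique_prod (fun b₃ b₂ => Iff.rfl)
        (existsUnique_fin_dvd hp.pos (isCoprime_of_not_dvd hp h22) x.k24) fun b₃ _ =>
        existsUnique_fin_dvd hp.pos (isCoprime_of_not_dvd hp h11) (x.k14 - x.k12 * (b₃ : ℕ))
      rw [c₁]
      exact ⟨fun h => ⟨h.1, h.2.2, h.2.1⟩, fun h => ⟨h.1, h.2.2, h.2.1⟩⟩
    · rintro (⟨b₃, y⟩ | ⟨b₁, y⟩ | u | l) h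
      · exact h11 ((c₂ _ _).1 h).1
      · exact h22 ((c₃ _ _).1 h).2.2
      · exact h11 ((c₄ _).1 h).1
      · exact h11 ((c₅ _).1 h).1

end RepT

section RepT0

/-! ### Representatives for `T₀(p²)` at a prime dividing the level exactly once -/

/-- The index set of the representatives for `T₀(p²)` with `p ∥ N`. -/
abbrev IndexT0 (p : ℕ) : Type :=
  (Fin p × Fin p × Fin (p ^ 2)) ⊕ Fin p ⊕ (Fin p × Fin (p - 1)) ⊕ (Fin p × Fin (p - 1) × Fin p)

/-- The blocks `A`, `B`, `D` of the representatives for `T₀(p²)` with `p ∥ N`; `l : Fin (p - 1)` stands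
for the nonzero residue class of `l + 1`. -/
def repT0 (N p : ℕ) (M c : ℤ) : IndexT0 p → Mat2 × Mat2 × Mat2
  | .inl (x, b₂, b₃) => (!![(p : ℚ), 0; (x : ℕ), 1],
      !![0, p * (b₂ : ℕ); (b₂ : ℕ), (b₃ : ℕ) / (N : ℚ) - (x : ℕ) * (b₂ : ℕ)],
      !![(p : ℚ), -(p * (x : ℕ)); 0, p ^ 2])
  | .inr (.inl y) => (!![(p : ℚ), -(p * (N * M * (y : ℕ))); 0, p ^ 2], !![0, 0; 0, 0],
      !![(p : ℚ), 0; N * M * (y : ℕ), 1])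
  | .inr (.inr (.inl (y, l))) => (!![(p : ℚ), -(p * (N + N * M * (y : ℕ)));
        -c, c * (N + N * M * (y : ℕ)) + p],
      !![((l : ℕ) + 1) * (N + N * M * (y : ℕ) : ℚ), (l : ℕ) + 1;
        ((l : ℕ) + 1) * (1 + c * (N + N * M * (y : ℕ)) / p), ((l : ℕ) + 1) * (c / p)],
      !![p + c * (N + N * M * (y : ℕ) : ℚ), c; p * (N + N * M * (y : ℕ)), p])
  | .inr (.inr (.inr (y, l, x))) => (!![(p : ℚ), -(p * (N * M * (y : ℕ)));
        -((x : ℕ) : ℚ), (x : ℕ) * (N * M * (y : ℕ)) + p],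
      !![0, 0; ((l : ℕ) + 1) * (M * (y : ℕ) : ℚ), ((l : ℕ) + 1) / N],
      !![p + (x : ℕ) * (N * M * (y : ℕ) : ℚ), (x : ℕ); p * (N * M * (y : ℕ)), p])

/-- The elements `Q ∈ K(N)` for which the coset of the representative is `K(N) δ Q⁻¹`; here
`q = N / p`, and `μ l` is an inverse of `(l + 1) q` modulo `p`. -/
def quotT0 (N : ℕ) (M : ℤ) (p q : ℕ) (μ : Fin (p - 1) → ℤ) : IndexT0 p → Entries
  | .inl (x, b₂, b₃) => ⟨1, (b₂ : ℕ), 0, 0,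
      -(x : ℕ), (b₃ : ℕ) - N * (b₂ : ℕ) * (x : ℕ), -(b₂ : ℕ), 1,
      0, -(x : ℕ), 1, 0, 0, -1, 0, 0⟩
  | .inr (.inl y) => ⟨1, M * (y : ℕ), 0, 0, 0, 1, 0, 0, 0, 0, 1, 0, 0, 0, -(M * (y : ℕ)), 1⟩
  | .inr (.inr (.inl (y, l))) => ⟨1, M * (y : ℕ), 0, 0, 0, 1, 0, 0,
      0, μ l, 1, 0, μ l, -(N * μ l * (M * (y : ℕ))), -(M * (y : ℕ)), 1⟩
  | .inr (.inr (.inr (y, l, x))) => ⟨1, M * (y : ℕ), 0, 0, 0, 1, 0, 0,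
      0, (x : ℕ) * (q * μ l), 1, 0, (x : ℕ) * (q * μ l),
      -(N * ((x : ℕ) * (q * μ l)) * (M * (y : ℕ))) - p * (q * μ l), -(M * (y : ℕ)), 1⟩

variable {N p : ℕ} {M a c : ℤ}

lemma isHeckeRep_repT0 (hN : 0 < N) (hp : p.Prime) {q : ℕ} (hq : N = p * q)
    (hac : a * p - c * q = 1) {μ w : Fin (p - 1) → ℤ}
    (hμ : ∀ l : Fin (p - 1), ((((l : ℕ) : ℤ) + 1) * q) * μ l = 1 + p * w l) (i : IndexT0 p) :
    IsHeckeRep N (deltaT0 p) (p ^ 2) (repT0 N p M c i).1 (repT0 N p M c i).2.1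
      (repT0 N p M c i).2.2 (quotT0 N M p q μ i) := by
  have hN0 : (N : ℚ) ≠ 0 := by exact_mod_cast hN.ne'
  have hp0 : (p : ℚ) ≠ 0 := by exact_mod_cast hp.ne_zero
  have hp1 : (0 : ℚ) < p ^ 2 := by
    have : (0 : ℚ) < p := by exact_mod_cast hp.pos
    positivity
  rcases i with ⟨x, b₂, b₃⟩ | y | ⟨y, l⟩ | ⟨y, l, x⟩
  · refine IsHeckeRep.mk' (a₁ := p) (a₂ := 0) (a₃ := (x : ℕ)) (a₄ := 1) ?_
      ⟨1, 0, 0, 0, 0, 0, 0, 1, 0, 0, 1, 0, 0, -1, 0, 0⟩ hp1 (by simp [repT0]) rfl rfl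
      ?_ ?_ ?_ ?_ ?_ ?_ ?_ ?_ ?_ ?_ ?_ ?_ ?_ ?_ ?_ ?_ ?_ ?_ ?_ ?_ ?_
    · constructor <;> simp only [quotT0] <;> ring
    all_goals (try simp only [quotT0]); (try push_cast); (try field_simp); try ring
  · refine IsHeckeRep.mk' (a₁ := p) (a₂ := -(p * (N * M * (y : ℕ)))) (a₃ := 0) (a₄ := p ^ 2) ?_
      ⟨1, 0, 0, 0, 0, 1, 0, 0, 0, 0, 1, 0, 0, 0, 0, 1⟩ hp1 (by simp [repT0]) rfl rfl
      ?_ ?_ ?_ ?_ ?_ ?_ ?_ ?_ ?_ ?_ ?_ ?_ ?_ ?_ ?_ ?_ ?_ ?_ ?_ ?_ ?_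
    · constructor <;> simp only [quotT0] <;> ring
    all_goals (try simp only [quotT0]); (try push_cast); (try field_simp); try ring
  · have h1 : (((l : ℕ) + 1) * q * μ l : ℚ) = 1 + p * w l := by exact_mod_cast hμ l
    have h2 : (a * p - c * q : ℚ) = 1 := by exact_mod_cast hac
    have h3 : (N : ℚ) = p * q := by exact_mod_cast hq
    have hq0 : (q : ℚ) ≠ 0 := by rintro h; rw [h, mul_zero] at h3; exact hN0 h3
    refine IsHeckeRep.mk' (a₁ := p) (a₂ := -(p * (N + N * M * (y : ℕ)))) (a₃ := -c)
      (a₄ := c * (N + N * M * (y : ℕ)) + p) ?_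
      ⟨2 + p * w l, w l, ((l : ℕ) + 1) * q, (l : ℕ) + 1,
        c * w l, a * (2 + p * w l), ((l : ℕ) + 1) * a, ((l : ℕ) + 1) * c * q,
        q * μ l * c, μ l * a, a * p, c, μ l, μ l * q, 1, p⟩ hp1
        (by simp [repT0]) rfl rfl
      ?_ ?_ ?_ ?_ ?_ ?_ ?_ ?_ ?_ ?_ ?_ ?_ ?_ ?_ ?_ ?_ ?_ ?_ ?_ ?_ ?_
    · constructor <;> simp only [quotT0] <;> ring
    all_goals (try simp only [quotT0]); (try push_cast); (try simp only [h3])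
    all_goals (try field_simp); try ring1
    · linear_combination h1
    · linear_combination h1
    · linear_combination (c : ℚ) * h1
    · linear_combination (1 + c * q : ℚ) * h1 - (2 + p * w l : ℚ) * h2
    · linear_combination (-(((l : ℕ) : ℚ) + 1)) * h2
    · linear_combination (-(μ l : ℚ)) * h2
    · linear_combination -h2
  · have h1 : (((l : ℕ) + 1) * q * μ l : ℚ) = 1 + p * w l := by exact_mod_cast hμ l
    have h3 : (N : ℚ) = p * q := by exact_mod_cast hq
    have hq0 : (q : ℚ) ≠ 0 := by rintro h; rw [h, mul_zero] at h3; exact hN0 h3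
    refine IsHeckeRep.mk' (a₁ := p) (a₂ := -(p * (N * M * (y : ℕ)))) (a₃ := -(x : ℕ))
      (a₄ := (x : ℕ) * (N * M * (y : ℕ)) + p) ?_
      ⟨1, 0, 0, 0, (x : ℕ) * w l, -w l, 0, (l : ℕ) + 1,
        q * (x : ℕ) ^ 2 * (q * μ l), 0, 1, (x : ℕ), (x : ℕ) * (q * μ l), -(q * μ l), 0, p⟩ hp1
        (by simp [repT0]) rfl rfl
      ?_ ?_ ?_ ?_ ?_ ?_ ?_ ?_ ?_ ?_ ?_ ?_ ?_ ?_ ?_ ?_ ?_ ?_ ?_ ?_ ?_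
    · constructor <;> simp only [quotT0] <;> ring
    all_goals (try simp only [quotT0]); (try push_cast); (try simp only [h3])
    all_goals (try field_simp); try ring1
    · linear_combination ((x : ℕ) : ℚ) * h1
    · linear_combination -h1

/-- Admissibility only involves the last row of `x`. If `p ∤ k42`, then the solution lies in the
first family. Otherwise `p ∤ k44`, so that `y` is determined by `p ∣ k43 - k44 M y`, and the family
is decided by whether `p²` divides `k42 + N M y k41`, and if so, by whether `p` divides `k41`. -/
lemma existsUnique_isAdmissible_quotT0 (hN : 0 < N) (hp : p.Prime) {q : ℕ} (hq : N = p * q)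
    (hq₁ : ¬ (p : ℤ) ∣ q) (hM : ¬ (p : ℤ) ∣ M) {μ w : Fin (p - 1) → ℤ}
    (hμ : ∀ l : Fin (p - 1), ((((l : ℕ) : ℤ) + 1) * q) * μ l = 1 + p * w l)
    (hQ : ∀ i, (quotT0 N M p q μ i).IsSymplectic N)
    {x : Entries} (hx : x.IsSymplectic N) :
    ∃! i, IsAdmissible N (deltaT0 p) (x.mul N (quotT0 N M p q μ i)) := by
  have hpp := Nat.prime_iff_prime_int.1 hp
  have hqz : (N : ℤ) = p * q := by exact_mod_cast hq
  have hp2 : ((p : ℤ) ^ 2) ≠ 0 := pow_ne_zero _ hpp.ne_zero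
  have crit : ∀ i, IsAdmissible N (deltaT0 p) (x.mul N (quotT0 N M p q μ i)) ↔ _ := fun i =>
    isAdmissible_deltaT0_iff hN hp ⟨q, hq⟩ (hx.mul hN (hQ i))
  -- the conditions for the four families
  have c₁ : ∀ (y b₂ : Fin p) (b₃ : Fin (p ^ 2)), IsAdmissible N (deltaT0 p) (x.mul N
      (quotT0 N M p q μ (.inl (y, b₂, b₃)))) ↔ (p : ℤ) ∣ x.k41 - x.k42 * (y : ℕ) ∧
        (p : ℤ) ∣ x.k43 - x.k42 * (b₂ : ℕ) ∧
          (p : ℤ) ^ 2 ∣ (x.k44 + N * (y : ℕ) * x.k43 - N * (b₂ : ℕ) * x.k41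
            + N * (b₂ : ℕ) * (y : ℕ) * x.k42) - x.k42 * (b₃ : ℕ) := by
    intro y b₂ b₃
    rw [crit]
    simp only [Entries.mul, quotT0]
    refine and_congr (dvd_iff_of_sub_eq 0 (by ring))
      (and_congr (dvd_iff_of_sub_eq 0 (by ring)) ?_)
    rw [← dvd_neg]
    exact dvd_iff_of_sub_eq 0 (by ring)
  have c₂ : ∀ y : Fin p, IsAdmissible N (deltaT0 p) (x.mul N (quotT0 N M p q μ
      (.inr (.inl y)))) ↔ (p : ℤ) ∣ x.k41 ∧ (p : ℤ) ∣ x.k43 - x.k44 * M * (y : ℕ) ∧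
          (p : ℤ) ^ 2 ∣ x.k42 + N * M * (y : ℕ) * x.k41 := by
    intro y
    rw [crit]
    simp only [Entries.mul, quotT0]
    exact and_congr (dvd_iff_of_sub_eq 0 (by ring))
      (and_congr (dvd_iff_of_sub_eq 0 (by ring)) (dvd_iff_of_sub_eq 0 (by ring)))
  have c₃ : ∀ (y : Fin p) (l : Fin (p - 1)), IsAdmissible N (deltaT0 p) (x.mul N
      (quotT0 N M p q μ (.inr (.inr (.inl (y, l)))))) ↔
        (p : ℤ) ∣ x.k44 - (-(q * x.k41)) * ((l : ℕ) + 1) ∧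
        (p : ℤ) ∣ x.k43 - x.k44 * M * (y : ℕ) ∧
          (p : ℤ) ^ 2 ∣ x.k42 + N * M * (y : ℕ) * x.k41 := by
    intro y l
    have hl : ¬ (p : ℤ) ∣ (((l : ℕ) : ℤ) + 1) * q := not_dvd_of_mul_eq_one_add hp (hμ l)
    rw [crit]
    simp only [Entries.mul, quotT0]
    refine and_congr ?_ ?_
    · rw [← (or_iff_right hl : _ ↔ (p : ℤ) ∣ x.k41 * 1 + x.k42 * 0 + x.k43 * 0 + x.k44 * μ l),
        ← hpp.dvd_mul]
      exact dvd_iff_of_sub_eq (x.k44 * w l) (by linear_combination x.k44 * hμ l)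
    · rw [show x.k41 * 0 + x.k42 * 0 + x.k43 * 1 + x.k44 * -(M * ((y : ℕ) : ℤ)) =
        x.k43 - x.k44 * M * (y : ℕ) by ring]
      exact and_congr_right fun ⟨e, he⟩ => dvd_iff_of_sub_eq (q * μ l * e) (by
        rw [hqz]; linear_combination (p * q * μ l : ℤ) * he)
  have c₄ : ∀ (y : Fin p) (l : Fin (p - 1)) (s : Fin p), IsAdmissible N (deltaT0 p) (x.mul N
      (quotT0 N M p q μ (.inr (.inr (.inr (y, l, s)))))) ↔
        (p : ℤ) ∣ x.k41 * ((l : ℕ) + 1) - (-x.k44) * (s : ℕ) ∧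
        (p : ℤ) ∣ x.k43 - x.k44 * M * (y : ℕ) ∧
          (p : ℤ) ^ 2 ∣ (x.k42 + N * M * (y : ℕ) * x.k41) * ((l : ℕ) + 1) - p * x.k44 := by
    intro y l s
    have hl : ¬ (p : ℤ) ∣ (l : ℕ) + 1 := not_dvd_succ l
    have hl2 : IsCoprime ((p : ℤ) ^ 2) ((l : ℕ) + 1) :=
      (isCoprime_of_not_dvd hp hl).symm.pow_left
    rw [crit]
    simp only [Entries.mul, quotT0]
    refine and_congr ?_ ?_
    · rw [← (or_iff_right hl : _ ↔ (p : ℤ) ∣ x.k41 * 1 + x.k42 * 0 + x.k43 * 0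
        + x.k44 * ((s : ℕ) * (q * μ l))), ← hpp.dvd_mul]
      exact dvd_iff_of_sub_eq (x.k44 * (s : ℕ) * w l) (by
        linear_combination x.k44 * (s : ℕ) * hμ l)
    · rw [show x.k41 * 0 + x.k42 * 0 + x.k43 * 1 + x.k44 * -(M * ((y : ℕ) : ℤ)) =
        x.k43 - x.k44 * M * (y : ℕ) by ring]
      refine and_congr_right fun ⟨e, he⟩ => ?_
      refine Iff.trans ⟨fun h => h.mul_left (((l : ℕ) : ℤ) + 1), hl2.dvd_of_dvd_mul_left⟩
        (dvd_iff_of_sub_eq ((((l : ℕ) : ℤ) + 1) * q * (s : ℕ) * (q * μ l) * e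
          - w l * x.k44) ?_)
      rw [hqz]
      linear_combination (((l : ℕ) + 1) * p * q * (s : ℕ) * (q * μ l) : ℤ) * he
        - p * x.k44 * hμ l
  have hq' : (p : ℤ) ∣ N := ⟨q, hqz⟩
  have hpp2 : (p : ℤ) ∣ (p : ℤ) ^ 2 := dvd_pow_self _ two_ne_zero
  have u₄ : (p : ℤ) ∣ x.k42 → ¬ (p : ℤ) ∣ x.k44 := by
    rintro ⟨s, hs⟩ ⟨t, ht⟩
    refine hpp.not_isUnit (isUnit_of_dvd_one ⟨q * x.k21 * x.k43 + x.k22 * t - q * x.k23 * x.k41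
      - x.k24 * s, ?_⟩)
    rw [← hx.r24, hs, ht, hqz]; ring
  -- the level is divisible by `p`, so the shear by `N M y` does not change `k42` modulo `p`
  have hV : ∀ y : Fin p, (p : ℤ) ∣ x.k42 + N * M * (y : ℕ) * x.k41 → (p : ℤ) ∣ x.k42 :=
    fun y h => (dvd_add_left (((hq'.mul_right _).mul_right _).mul_right _)).1 h
  by_cases h42 : (p : ℤ) ∣ x.k42
  swap
  · refine existsUnique_inl ?_ ?_
    · refine existsUnique_prod (R := fun y i => (p : ℤ) ∣ x.k43 - x.k42 * (i.1 : ℕ) ∧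
        (p : ℤ) ^ 2 ∣ (x.k44 + N * (y : ℕ) * x.k43 - N * (i.1 : ℕ) * x.k41
            + N * (i.1 : ℕ) * (y : ℕ) * x.k42) - x.k42 * (i.2 : ℕ)) (fun y i => c₁ y i.1 i.2)
        (existsUnique_fin_dvd hp.pos (isCoprime_of_not_dvd hp h42) x.k41) fun y _ =>
        existsUnique_prod (fun _ _ => Iff.rfl)
        (existsUnique_fin_dvd hp.pos (isCoprime_of_not_dvd hp h42) x.k43) fun b₂ _ => ?_
      have := existsUnique_fin_dvd (n := p ^ 2) (pow_pos hp.pos 2) (a := x.k42)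
        (by push_cast; exact (isCoprime_of_not_dvd hp h42).pow_right)
        (x.k44 + N * (y : ℕ) * x.k43 - N * (b₂ : ℕ) * x.k41 + N * (b₂ : ℕ) * (y : ℕ) * x.k42)
      exact_mod_cast this
    · rintro (y | ⟨y, l⟩ | ⟨y, l, s⟩) h
      · exact h42 (hV y (hpp2.trans ((c₂ _).1 h).2.2))
      · exact h42 (hV y (hpp2.trans ((c₃ _ _).1 h).2.2))
      · have h1 := (dvd_sub_left (dvd_mul_right _ _)).1 (hpp2.trans ((c₄ _ _ _).1 h).2.2)
        exact h42 (hV y ((hpp.dvd_mul.1 h1).resolve_right (not_dvd_succ l)))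
  · have h44 := u₄ h42
    obtain ⟨s, hs⟩ := h42
    refine existsUnique_inr ?_ ?_
    · rintro ⟨y, b₂, b₃⟩ h
      obtain ⟨t, ht⟩ := ((c₁ _ _ _).1 h).2.2
      refine h44 ⟨p * t + s * (b₃ : ℕ) - q * (y : ℕ) * x.k43 + q * (b₂ : ℕ) * x.k41
        - q * (b₂ : ℕ) * (y : ℕ) * x.k42, ?_⟩
      rw [hqz] at ht
      linear_combination ht + (b₃ : ℕ) * hs
    obtain ⟨y, hy, huy⟩ := existsUnique_fin_dvd hp.pos (isCoprime_of_not_dvd hp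
      (fun h => (hpp.dvd_mul.1 h).elim h44 hM : ¬ (p : ℤ) ∣ x.k44 * M)) x.k43
    -- `hW`, `hW2` and `hW3` divide the congruences modulo `p²` by `p`
    have hW : ∀ y : Fin p, x.k42 + N * M * (y : ℕ) * x.k41 = p * (s + q * M * (y : ℕ) * x.k41) := by
      intro y; rw [hqz, hs]; ring
    have hW2 : ∀ y : Fin p, (p : ℤ) ^ 2 ∣ x.k42 + N * M * (y : ℕ) * x.k41 ↔
        (p : ℤ) ∣ s + q * M * (y : ℕ) * x.k41 := by
      intro y
      rw [hW, sq]
      exact mul_dvd_mul_iff_left hpp.ne_zero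
    have hW3 : ∀ (y : Fin p) (l : Fin (p - 1)),
        (p : ℤ) ^ 2 ∣ (x.k42 + N * M * (y : ℕ) * x.k41) * ((l : ℕ) + 1) - p * x.k44 ↔
        (p : ℤ) ∣ x.k44 - (s + q * M * (y : ℕ) * x.k41) * ((l : ℕ) + 1) := by
      intro y l
      rw [hW, sq, mul_assoc, ← mul_sub, mul_dvd_mul_iff_left hpp.ne_zero, ← dvd_neg, neg_sub]
    simp only [hW2] at c₂ c₃
    simp only [hW3] at c₄
    by_cases hWy : (p : ℤ) ∣ s + q * M * (y : ℕ) * x.k41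
    · have h₄ : ∀ i, ¬ IsAdmissible N (deltaT0 p) (x.mul N (quotT0 N M p q μ
          (.inr (.inr (.inr i))))) := by
        rintro ⟨y', l, t⟩ h
        obtain ⟨-, h2, h3⟩ := (c₄ _ _ _).1 h
        obtain rfl := huy y' h2
        exact h44 ((dvd_sub_left (hWy.mul_right _)).1 h3)
      by_cases h41 : (p : ℤ) ∣ x.k41
      · refine existsUnique_inl ⟨y, (c₂ y).2 ⟨h41, hy, hWy⟩, fun y' h => huy y' ((c₂ y').1 h).2.1⟩ ?_
        rintro (⟨y', l⟩ | i) h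
        · exact h44 ((dvd_sub_left ((dvd_neg.2 (h41.mul_left _)).mul_right _)).1 ((c₃ _ _).1 h).1)
        · exact h₄ i h
      · refine existsUnique_inr (fun y' h => h41 ((c₂ _).1 h).1) (existsUnique_inl ?_ h₄)
        refine existsUnique_prod (Q := fun y' => y' = y) (R := fun _ l => (p : ℤ) ∣ x.k44 -
          (-(q * x.k41)) * ((l : ℕ) + 1)) (fun y' l => ?_) ⟨y, rfl, fun _ h => h⟩ fun _ _ =>
          existsUnique_unit_dvd hp (by
            rw [dvd_neg]; exact fun h => (hpp.dvd_mul.1 h).elim hq₁ h41) h44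
        rw [c₃]
        exact ⟨fun h => ⟨huy _ h.2.1, h.1⟩, by rintro ⟨rfl, h⟩; exact ⟨h, hy, hWy⟩⟩
    · refine existsUnique_inr ?_ (existsUnique_inr ?_ ?_)
      · intro y' h
        obtain ⟨-, h2, h3⟩ := (c₂ _).1 h
        obtain rfl := huy y' h2
        exact hWy h3
      · rintro ⟨y', l⟩ h
        obtain ⟨-, h2, h3⟩ := (c₃ _ _).1 h
        obtain rfl := huy y' h2
        exact hWy h3
      refine existsUnique_prod (Q := fun y' => y' = y) (R := fun y' i =>
        (p : ℤ) ∣ x.k44 - (s + q * M * (y : ℕ) * x.k41) * ((i.1 : ℕ) + 1) ∧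
        (p : ℤ) ∣ x.k41 * ((i.1 : ℕ) + 1) - (-x.k44) * (i.2 : ℕ)) (fun y' i => ?_)
        ⟨y, rfl, fun _ h => h⟩ fun _ _ => existsUnique_prod (fun _ _ => Iff.rfl)
        (existsUnique_unit_dvd hp hWy h44) fun l _ =>
          existsUnique_fin_dvd hp.pos (a := -x.k44) (isCoprime_of_not_dvd hp (by rwa [dvd_neg]))
            (x.k41 * ((l : ℕ) + 1))
      rw [c₄]
      constructor
      · rintro ⟨h1, h2, h3⟩
        obtain rfl := huy _ h2
        exact ⟨rfl, h3, h1⟩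
      · rintro ⟨rfl, h3, h1⟩
        exact ⟨h1, hy, h3⟩

end RepT0

section RepGoodT

/-! ### Representatives for `T(p)` at a prime not dividing the level -/

/-- The index set of the representatives for `T(p)` with `p ∤ N`. -/
abbrev IndexGoodT (p : ℕ) : Type :=
  (Fin p × Fin p × Fin p) ⊕ (Fin p × Fin p) ⊕ Fin p ⊕ Unit

/-- The blocks `A`, `B`, `D` of the representatives for `T(p)` with `p ∤ N`. -/
def repGoodT (N p : ℕ) : IndexGoodT p → Mat2 × Mat2 × Mat2
  | .inl (b₁, b₂, b₃) => (!![1, 0; 0, 1], !![(b₁ : ℕ), (b₂ : ℕ); (b₂ : ℕ), (b₃ : ℕ) / (N : ℚ)],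
      !![(p : ℚ), 0; 0, p])
  | .inr (.inl (x, b₃)) => (!![(p : ℚ), 0; (x : ℕ), 1], !![0, 0; 0, (b₃ : ℕ) / (N : ℚ)],
      !![1, -((x : ℕ) : ℚ); 0, p])
  | .inr (.inr (.inl b₁)) => (!![1, 0; 0, p], !![((b₁ : ℕ) : ℚ), 0; 0, 0], !![(p : ℚ), 0; 0, 1])
  | .inr (.inr (.inr _)) => (!![(p : ℚ), 0; 0, p], !![0, 0; 0, 0], !![1, 0; 0, 1])

/-- The elements `Q ∈ K(N)` for which the coset of the representative is `K(N) δ Q⁻¹`. -/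
def quotGoodT (p : ℕ) : IndexGoodT p → Entries
  | .inl (b₁, b₂, b₃) => ⟨1, 0, -(b₁ : ℕ), -(b₂ : ℕ), 0, 1, -(b₂ : ℕ), -(b₃ : ℕ),
      0, 0, 1, 0, 0, 0, 0, 1⟩
  | .inr (.inl (x, b₃)) => ⟨0, 0, 1, 0, 0, 1, -(x : ℕ), -(b₃ : ℕ), -1, 0, 0, (x : ℕ), 0, 0, 0, 1⟩
  | .inr (.inr (.inl b₁)) => ⟨1, 0, -(b₁ : ℕ), 0, 0, 0, 0, 1, 0, 0, 1, 0, 0, -1, 0, 0⟩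
  | .inr (.inr (.inr _)) => ⟨0, 0, 1, 0, 0, 0, 0, 1, -1, 0, 0, 0, 0, -1, 0, 0⟩

variable {N p : ℕ}

lemma isHeckeRep_repGoodT (hN : 0 < N) (hp : p.Prime) (i : IndexGoodT p) :
    IsHeckeRep N (deltaT p) p (repGoodT N p i).1 (repGoodT N p i).2.1 (repGoodT N p i).2.2
      (quotGoodT p i) := by
  have hN0 : (N : ℚ) ≠ 0 := by exact_mod_cast hN.ne'
  have hp0 : (p : ℚ) ≠ 0 := by exact_mod_cast hp.ne_zero
  have hp1 : (0 : ℚ) < p := by exact_mod_cast hp.pos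
  rcases i with ⟨b₁, b₂, b₃⟩ | ⟨x, b₃⟩ | b₁ | i
  · refine IsHeckeRep.mk' (a₁ := 1) (a₂ := 0) (a₃ := 0) (a₄ := 1) ?_
      ⟨1, 0, 0, 0, 0, 1, 0, 0, 0, 0, 1, 0, 0, 0, 0, 1⟩ hp1 (by simp [repGoodT]) rfl rfl
      ?_ ?_ ?_ ?_ ?_ ?_ ?_ ?_ ?_ ?_ ?_ ?_ ?_ ?_ ?_ ?_ ?_ ?_ ?_ ?_ ?_
    · constructor <;> simp only [quotGoodT] <;> ring
    all_goals (try simp only [quotGoodT]); (try push_cast); (try field_simp); try ring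
  · refine IsHeckeRep.mk' (a₁ := p) (a₂ := 0) (a₃ := (x : ℕ)) (a₄ := 1) ?_
      ⟨0, 0, 1, 0, 0, 1, 0, 0, -1, 0, 0, 0, 0, 0, 0, 1⟩ hp1 (by simp [repGoodT]) rfl rfl
      ?_ ?_ ?_ ?_ ?_ ?_ ?_ ?_ ?_ ?_ ?_ ?_ ?_ ?_ ?_ ?_ ?_ ?_ ?_ ?_ ?_
    · constructor <;> simp only [quotGoodT] <;> ring
    all_goals (try simp only [quotGoodT]); (try push_cast); (try field_simp); try ring
  · refine IsHeckeRep.mk' (a₁ := 1) (a₂ := 0) (a₃ := 0) (a₄ := p) ?_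
      ⟨1, 0, 0, 0, 0, 0, 0, 1, 0, 0, 1, 0, 0, -1, 0, 0⟩ hp1 (by simp [repGoodT]) rfl rfl
      ?_ ?_ ?_ ?_ ?_ ?_ ?_ ?_ ?_ ?_ ?_ ?_ ?_ ?_ ?_ ?_ ?_ ?_ ?_ ?_ ?_
    · constructor <;> simp only [quotGoodT] <;> ring
    all_goals (try simp only [quotGoodT]); (try push_cast); (try field_simp); try ring
  · refine IsHeckeRep.mk' (a₁ := p) (a₂ := 0) (a₃ := 0) (a₄ := p) ?_
      ⟨0, 0, 1, 0, 0, 0, 0, 1, -1, 0, 0, 0, 0, -1, 0, 0⟩ hp1 (by simp [repGoodT]) rfl rfl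
      ?_ ?_ ?_ ?_ ?_ ?_ ?_ ?_ ?_ ?_ ?_ ?_ ?_ ?_ ?_ ?_ ?_ ?_ ?_ ?_ ?_
    · constructor <;> simp only [quotGoodT] <;> ring
    all_goals (try simp only [quotGoodT]); (try push_cast); (try field_simp); try ring

/-- If the upper right block is divisible by `p`, then the upper left block is invertible modulo
`p`. -/
lemma IsAdmissible.not_dvd_det (hN : 0 < N) (hp : p.Prime) {x : Entries} (hx : x.IsSymplectic N)
    (h : IsAdmissible N (deltaT p) x) : ¬ (p : ℤ) ∣ x.k11 * x.k22 - N * x.k12 * x.k21 := by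
  obtain ⟨⟨⟨z13, h13⟩, ⟨z14, h14⟩⟩, ⟨z23, h23⟩, ⟨z24, h24⟩⟩ := (isAdmissible_deltaT_iff hN).1 h
  obtain ⟨r13, r24, -, r14, r23, -⟩ := hx
  rw [h13, h14] at r13 r14
  rw [h23, h24] at r24 r23
  rintro ⟨u, hu⟩
  refine (Nat.prime_iff_prime_int.1 hp).not_isUnit (isUnit_of_dvd_one
    ⟨u * (x.k33 * x.k44 - N * x.k34 * x.k43) - (z13 * x.k31 + N * z14 * x.k32)
      - (N * z23 * x.k41 + z24 * x.k42) * (1 + p * (z13 * x.k31 + N * z14 * x.k32))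
      + N * (z13 * x.k41 + z14 * x.k42) * (x.k21 * x.k33 + x.k22 * x.k34), ?_⟩)
  linear_combination (-(x.k22 * x.k44 + N * x.k21 * x.k43)) * r13
    - (1 + p * (z13 * x.k31 + N * z14 * x.k32)) * r24
    + N * (x.k21 * x.k33 + x.k22 * x.k34) * r14 + (x.k33 * x.k44 - N * x.k34 * x.k43) * hu

/-- The family containing the solution is decided by the upper left block of `x` modulo `p`: it is
the first one if the block is invertible, the second one if the block is singular with nonzero
second column, the third one if only the second column is zero, and the last one if the block is
zero. -/
lemma existsUnique_isAdmissible_quotGoodT (hN : 0 < N) (hp : p.Prime) (hpN : ¬ p ∣ N)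
    {x : Entries} (hx : x.IsSymplectic N) :
    ∃! i, IsAdmissible N (deltaT p) (x.mul N (quotGoodT p i)) := by
  have hpp := Nat.prime_iff_prime_int.1 hp
  have hpN' : ¬ (p : ℤ) ∣ N := by exact_mod_cast hpN
  have hQ : ∀ i, (quotGoodT p i).IsSymplectic N := fun i => (isHeckeRep_repGoodT hN hp i).symplectic
  have crit : ∀ i, IsAdmissible N (deltaT p) (x.mul N (quotGoodT p i)) ↔ _ := fun i =>
    isAdmissible_deltaT_iff hN
  have dets : ∀ i, IsAdmissible N (deltaT p) (x.mul N (quotGoodT p i)) → _ := fun i h =>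
    h.not_dvd_det hN hp (hx.mul hN (hQ i))
  -- the conditions for the four families
  have c₁ : ∀ b₁ b₂ b₃ : Fin p, IsAdmissible N (deltaT p) (x.mul N (quotGoodT p
      (.inl (b₁, b₂, b₃)))) ↔ ((p : ℤ) ∣ x.k13 - x.k11 * (b₁ : ℕ) - N * x.k12 * (b₂ : ℕ) ∧
        (p : ℤ) ∣ x.k14 - x.k11 * (b₂ : ℕ) - x.k12 * (b₃ : ℕ)) ∧
        (p : ℤ) ∣ x.k23 - x.k21 * (b₁ : ℕ) - x.k22 * (b₂ : ℕ) ∧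
          (p : ℤ) ∣ x.k24 - N * x.k21 * (b₂ : ℕ) - x.k22 * (b₃ : ℕ) := by
    intro b₁ b₂ b₃
    rw [crit]
    simp only [Entries.mul, quotGoodT]
    exact and_congr (and_congr (dvd_iff_of_sub_eq 0 (by ring)) (dvd_iff_of_sub_eq 0 (by ring)))
      (and_congr (dvd_iff_of_sub_eq 0 (by ring)) (dvd_iff_of_sub_eq 0 (by ring)))
  have c₂ : ∀ y b₃ : Fin p, IsAdmissible N (deltaT p) (x.mul N (quotGoodT p
      (.inr (.inl (y, b₃))))) ↔ ((p : ℤ) ∣ x.k11 - N * x.k12 * (y : ℕ) ∧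
        (p : ℤ) ∣ (x.k14 + x.k13 * (y : ℕ)) - x.k12 * (b₃ : ℕ)) ∧
        (p : ℤ) ∣ x.k21 - x.k22 * (y : ℕ) ∧
          (p : ℤ) ∣ (x.k24 + N * x.k23 * (y : ℕ)) - x.k22 * (b₃ : ℕ) := by
    intro y b₃
    rw [crit]
    simp only [Entries.mul, quotGoodT]
    exact and_congr (and_congr (dvd_iff_of_sub_eq 0 (by ring)) (dvd_iff_of_sub_eq 0 (by ring)))
      (and_congr (dvd_iff_of_sub_eq 0 (by ring)) (dvd_iff_of_sub_eq 0 (by ring)))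
  have c₃ : ∀ b₁ : Fin p, IsAdmissible N (deltaT p) (x.mul N (quotGoodT p
      (.inr (.inr (.inl b₁))))) ↔ ((p : ℤ) ∣ x.k13 - x.k11 * (b₁ : ℕ) ∧ (p : ℤ) ∣ x.k12) ∧
        (p : ℤ) ∣ x.k23 - x.k21 * (b₁ : ℕ) ∧ (p : ℤ) ∣ x.k22 := by
    intro b₁
    rw [crit]
    simp only [Entries.mul, quotGoodT]
    exact and_congr (and_congr (dvd_iff_of_sub_eq 0 (by ring)) (dvd_iff_of_sub_eq 0 (by ring)))
      (and_congr (dvd_iff_of_sub_eq 0 (by ring)) (dvd_iff_of_sub_eq 0 (by ring)))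
  have c₄ : ∀ u : Unit, IsAdmissible N (deltaT p) (x.mul N (quotGoodT p
      (.inr (.inr (.inr u))))) ↔ ((p : ℤ) ∣ x.k11 ∧ (p : ℤ) ∣ x.k12) ∧
        (p : ℤ) ∣ x.k21 ∧ (p : ℤ) ∣ x.k22 := by
    intro u
    rw [crit]
    simp only [Entries.mul, quotGoodT]
    exact and_congr (and_congr (dvd_iff_of_sub_eq 0 (by ring)) (dvd_iff_of_sub_eq 0 (by ring)))
      (and_congr (dvd_iff_of_sub_eq 0 (by ring)) (dvd_iff_of_sub_eq 0 (by ring)))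
  -- the consequences of the invertibility of the upper left block
  have d₁ : ∀ i, IsAdmissible N (deltaT p) (x.mul N (quotGoodT p (.inl i))) →
      ¬ (p : ℤ) ∣ x.k11 * x.k22 - N * x.k12 * x.k21 := by
    rintro ⟨b₁, b₂, b₃⟩ h h'
    refine dets _ h ?_
    simp only [Entries.mul, quotGoodT]
    exact (dvd_iff_of_sub_eq 0 (by ring)).2 h'
  have d₂ : ∀ i, IsAdmissible N (deltaT p) (x.mul N (quotGoodT p (.inr (.inl i)))) →
      ¬ ((p : ℤ) ∣ x.k12 ∧ (p : ℤ) ∣ x.k22) := by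
    rintro ⟨y, b₃⟩ h ⟨h12, h22⟩
    refine dets _ h ?_
    simp only [Entries.mul, quotGoodT]
    exact (dvd_iff_of_sub_eq 0 (by ring)).2
      (dvd_sub ((h12.mul_right _).mul_left N) (h22.mul_left x.k13) : (p : ℤ) ∣
        N * (x.k12 * x.k23) - x.k13 * x.k22)
  have d₃ : ∀ i, IsAdmissible N (deltaT p) (x.mul N (quotGoodT p (.inr (.inr (.inl i))))) →
      ¬ ((p : ℤ) ∣ x.k11 ∧ (p : ℤ) ∣ x.k21) := by
    rintro b₁ h ⟨h11, h21⟩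
    refine dets _ h ?_
    simp only [Entries.mul, quotGoodT]
    exact (dvd_iff_of_sub_eq 0 (by ring)).2
      (dvd_sub ((h21.mul_right _).mul_left N) (h11.mul_right x.k24) : (p : ℤ) ∣
        N * (x.k21 * x.k14) - x.k11 * x.k24)
  by_cases hd : (p : ℤ) ∣ x.k11 * x.k22 - N * x.k12 * x.k21
  · refine existsUnique_inr (fun i h => d₁ i h hd) ?_
    by_cases h2 : (p : ℤ) ∣ x.k12 ∧ (p : ℤ) ∣ x.k22
    · refine existsUnique_inr (fun i h => d₂ i h h2) ?_
      by_cases h1 : (p : ℤ) ∣ x.k11 ∧ (p : ℤ) ∣ x.k21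
      · exact existsUnique_inr (fun i h => d₃ i h h1)
          ⟨(), (c₄ _).2 ⟨⟨h1.1, h2.1⟩, h1.2, h2.2⟩, fun _ _ => rfl⟩
      · refine existsUnique_inl ?_ fun u h => h1 ⟨((c₄ u).1 h).1.1, ((c₄ u).1 h).2.1⟩
        simp only [c₃, h2.1, h2.2, and_true]
        refine existsUnique_fin_dvd_pair hp h1 ?_
        obtain ⟨⟨s, hs⟩, ⟨t, ht⟩⟩ := h2
        have := hx.r12
        rw [hs, ht] at this
        exact ⟨x.k14 * t - s * x.k24, by linear_combination this⟩
    · refine existsUnique_inl ?_ ?_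
      · refine existsUnique_prod (Q := fun y => (p : ℤ) ∣ x.k11 - N * x.k12 * (y : ℕ) ∧
          (p : ℤ) ∣ x.k21 - x.k22 * (y : ℕ)) (R := fun y b₃ =>
          (p : ℤ) ∣ (x.k14 + x.k13 * (y : ℕ)) - x.k12 * (b₃ : ℕ) ∧
          (p : ℤ) ∣ (x.k24 + N * x.k23 * (y : ℕ)) - x.k22 * (b₃ : ℕ))
          (fun y b₃ => (c₂ y b₃).trans and_and_and_comm)
          (existsUnique_fin_dvd_pair hp (fun h => h2
            ⟨(hpp.dvd_mul.1 h.1).resolve_left hpN', h.2⟩) ?_) ?_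
        · rw [← dvd_neg]
          exact (dvd_iff_of_sub_eq 0 (by ring)).2 hd
        · rintro y ⟨⟨s, hs⟩, ⟨t, ht⟩⟩
          refine existsUnique_fin_dvd_pair hp h2 ⟨-(s * x.k23) + x.k13 * t, ?_⟩
          linear_combination hx.r12 - x.k23 * hs + x.k13 * ht
      · rintro (b₁ | u) h
        · exact h2 ⟨((c₃ _).1 h).1.2, ((c₃ _).1 h).2.2⟩
        · exact h2 ⟨((c₄ _).1 h).1.2, ((c₄ _).1 h).2.2⟩
  · refine existsUnique_inl ?_ ?_
    · have hcop := isCoprime_of_not_dvd hp hd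
      refine existsUnique_prod (R := fun b₁ i =>
        (p : ℤ) ∣ (x.k11 * x.k23 - x.k21 * x.k13) -
          (x.k11 * x.k22 - N * x.k12 * x.k21) * (i.1 : ℕ) ∧
        (p : ℤ) ∣ (x.k11 * x.k24 - N * x.k21 * x.k14) -
          (x.k11 * x.k22 - N * x.k12 * x.k21) * (i.2 : ℕ)) ?_
        (existsUnique_fin_dvd hp.pos hcop (x.k22 * x.k13 - N * x.k12 * x.k23)) fun _ _ =>
        existsUnique_prod (fun _ _ => Iff.rfl)
          (existsUnique_fin_dvd hp.pos hcop (x.k11 * x.k23 - x.k21 * x.k13)) fun _ _ =>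
          existsUnique_fin_dvd hp.pos hcop (x.k11 * x.k24 - N * x.k21 * x.k14)
      rintro b₁ ⟨b₂, b₃⟩
      rw [c₁]
      -- the four congruences are equivalent to three by Cramer's rule; the fourth one follows from
      -- the symplectic relation between the first two rows
      constructor
      · rintro ⟨⟨⟨s, hs⟩, ⟨r, hr⟩⟩, ⟨t, ht⟩, ⟨u, hu⟩⟩
        exact ⟨⟨x.k22 * s - N * x.k12 * t, by
            linear_combination x.k22 * hs - N * x.k12 * ht⟩,
          ⟨x.k11 * t - x.k21 * s, by linear_combination x.k11 * ht - x.k21 * hs⟩,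
          ⟨x.k11 * u - N * x.k21 * r, by linear_combination x.k11 * hu - N * x.k21 * hr⟩⟩
      · rintro ⟨⟨s, hs⟩, ⟨t, ht⟩, ⟨u, hu⟩⟩
        have hr := hx.r12
        refine ⟨⟨(hpp.dvd_mul.1 ⟨x.k11 * s + N * x.k12 * t, ?_⟩).resolve_left hd,
          (hpp.dvd_mul.1 ⟨x.k11 * t + x.k12 * u, ?_⟩).resolve_left hd⟩,
          (hpp.dvd_mul.1 ⟨x.k21 * s + x.k22 * t, ?_⟩).resolve_left hd,
          (hpp.dvd_mul.1 ⟨N * x.k21 * t + x.k22 * u, ?_⟩).resolve_left hd⟩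
        · linear_combination x.k11 * hs + N * x.k12 * ht
        · linear_combination x.k11 * ht + x.k12 * hu - x.k11 * hr
        · linear_combination x.k21 * hs + x.k22 * ht
        · linear_combination N * x.k21 * ht + x.k22 * hu - N * x.k21 * hr
    · rintro (⟨y, b₃⟩ | b₁ | u) h
      · obtain ⟨⟨⟨s, hs⟩, -⟩, ⟨t, ht⟩, -⟩ := (c₂ _ _).1 h
        exact hd ⟨s * x.k22 - N * x.k12 * t, by linear_combination x.k22 * hs - N * x.k12 * ht⟩
      · obtain ⟨⟨-, h1⟩, -, h2⟩ := (c₃ _).1 h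
        exact hd (dvd_sub (h2.mul_left _) ((h1.mul_left _).mul_right _))
      · obtain ⟨⟨-, h1⟩, -, h2⟩ := (c₄ _).1 h
        exact hd (dvd_sub (h2.mul_left _) ((h1.mul_left _).mul_right _))

end RepGoodT

section RepT1

/-! ### Representatives for `T₁(p²)` at a prime not dividing the level -/

/-- The index set of the representatives for `T₁(p²)` with `p ∤ N`. -/
abbrev IndexT1 (p : ℕ) : Type :=
  (Fin p × Fin p × Fin (p ^ 2)) ⊕ (Fin p × Fin (p ^ 2)) ⊕ Fin p ⊕ (Fin p × Fin (p - 1)) ⊕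
    Unit ⊕ Fin (p - 1)

/-- The blocks `A`, `B`, `D` of the representatives for `T₁(p²)` with `p ∤ N`. Here
`p² ε - N β = 1`, and `l : Fin (p - 1)` stands for the nonzero residue class of `l + 1`. -/
def repT1 (N p : ℕ) (ε β : ℤ) : IndexT1 p → Mat2 × Mat2 × Mat2
  | .inl (y, b₂, b₁) => (!![1, N * (y : ℕ); 0, (p : ℚ)],
      !![(b₁ : ℕ) - N * (y : ℕ) * (b₂ : ℕ), (b₂ : ℕ); p * (b₂ : ℕ), 0],
      !![(p : ℚ) ^ 2, 0; -(p * (N * (y : ℕ))), p])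
  | .inr (.inl (b₂, b₃)) => (!![(p : ℚ), 0; 0, 1],
      !![0, p * (b₂ : ℕ); (b₂ : ℕ), (b₃ : ℕ) / (N : ℚ)], !![(p : ℚ), 0; 0, p ^ 2])
  | .inr (.inr (.inl x)) => (!![(p : ℚ) ^ 2, 0; p * (x : ℕ), p], !![0, 0; 0, 0],
      !![1, -((x : ℕ) : ℚ); 0, p])
  | .inr (.inr (.inr (.inl (x, l)))) => (!![(p : ℚ), 0; p * (x : ℕ), p],
      !![(l : ℕ) + 1, -(((l : ℕ) + 1) * ((x : ℕ) : ℚ)); 0, 0], !![(p : ℚ), -(p * (x : ℕ)); 0, p])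
  | .inr (.inr (.inr (.inr (.inl _)))) => (!![p ^ 2 * (p * ε : ℚ), p ^ 2 * (N * β); p, p ^ 2],
      !![0, 0; 0, 0], !![(p : ℚ), -1; -(p * (N * β)), p * (p * ε)])
  | .inr (.inr (.inr (.inr (.inr l)))) => (!![p * (p * ε : ℚ), p * (N * β); p, p ^ 2],
      !![((l : ℕ) + 1) * (p : ℚ), -((l : ℕ) + 1); 0, 0],
      !![(p : ℚ) ^ 2, -p; -(p * (N * β)), p * (p * ε)])

/-- The elements `Q ∈ K(N)` for which the coset of the representative is `K(N) δ Q⁻¹`; here `z l` is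
an inverse of `l + 1` modulo `p`. -/
def quotT1 (N p : ℕ) (ε β : ℤ) (z : Fin (p - 1) → ℤ) : IndexT1 p → Entries
  | .inl (y, b₂, b₁) => ⟨1, -(y : ℕ), -(b₁ : ℕ) + N * (b₂ : ℕ) * (y : ℕ), -(b₂ : ℕ),
      0, 1, -(b₂ : ℕ), 0, 0, 0, 1, 0, 0, 0, (y : ℕ), 1⟩
  | .inr (.inl (b₂, b₃)) => ⟨ε, -β, -(N * β * (b₂ : ℕ)), -(ε * (b₂ : ℕ)),
      -1, p ^ 2, -(p ^ 2 * (b₂ : ℕ)) - β * (b₃ : ℕ), -(N * (b₂ : ℕ)) - ε * (b₃ : ℕ),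
      0, 0, p ^ 2, 1, 0, 0, β, ε⟩
  | .inr (.inr (.inl x)) => ⟨0, 0, -1, 0, 0, 1, (x : ℕ), 0, 1, 0, 0, (x : ℕ), 0, 0, 0, 1⟩
  | .inr (.inr (.inr (.inl (x, l)))) => ⟨0, 0, -1, 0, 0, 1, (x : ℕ), 0, 1, 0, p * z l, (x : ℕ),
      0, 0, 0, 1⟩
  | .inr (.inr (.inr (.inr (.inl _)))) => ⟨0, -β, -p, 0, 0, p * ε, 1, 0, p * ε, 0, 0, 1, β, 0, 0, p⟩
  | .inr (.inr (.inr (.inr (.inr l)))) => ⟨0, -β, -p, 0, 0, p * ε, 1, 0,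
      p * ε, 0, p * z l * (p * ε), 1, β, 0, p * z l * β, p⟩

variable {N p : ℕ} {ε β : ℤ}

lemma isHeckeRep_repT1 (hN : 0 < N) (hp : p.Prime) (hε : p ^ 2 * ε - N * β = 1)
    {z w : Fin (p - 1) → ℤ}
    (hz : ∀ l : Fin (p - 1), (((l : ℕ) : ℤ) + 1) * z l = 1 + p * w l) (i : IndexT1 p) :
    IsHeckeRep N (deltaT1 p) (p ^ 2) (repT1 N p ε β i).1 (repT1 N p ε β i).2.1
      (repT1 N p ε β i).2.2 (quotT1 N p ε β z i) := by
  have hN0 : (N : ℚ) ≠ 0 := by exact_mod_cast hN.ne'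
  have hp0 : (p : ℚ) ≠ 0 := by exact_mod_cast hp.ne_zero
  have hp1 : (0 : ℚ) < p ^ 2 := by
    have : (0 : ℚ) < p := by exact_mod_cast hp.pos
    positivity
  have h2 : (p ^ 2 * ε - N * β : ℚ) = 1 := by exact_mod_cast hε
  rcases i with ⟨y, b₂, b₁⟩ | ⟨b₂, b₃⟩ | x | ⟨x, l⟩ | i | l
  · refine IsHeckeRep.mk' (a₁ := 1) (a₂ := N * (y : ℕ)) (a₃ := 0) (a₄ := p) ?_
      ⟨1, 0, 0, 0, 0, 1, 0, 0, 0, 0, 1, 0, 0, 0, 0, 1⟩ hp1 (by simp [repT1]) rfl rfl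
      ?_ ?_ ?_ ?_ ?_ ?_ ?_ ?_ ?_ ?_ ?_ ?_ ?_ ?_ ?_ ?_ ?_ ?_ ?_ ?_ ?_
    · constructor <;> simp only [quotT1] <;> ring
    all_goals (try simp only [quotT1]); (try push_cast); (try field_simp); try ring
  · refine IsHeckeRep.mk' (a₁ := p) (a₂ := 0) (a₃ := 0) (a₄ := 1) ?_
      ⟨p * ε, -β, 0, 0, -1, p, 0, 0, 0, 0, p, 1, 0, 0, β, p * ε⟩ hp1 (by simp [repT1]) rfl rfl
      ?_ ?_ ?_ ?_ ?_ ?_ ?_ ?_ ?_ ?_ ?_ ?_ ?_ ?_ ?_ ?_ ?_ ?_ ?_ ?_ ?_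
    · constructor <;> simp only [quotT1]
      · linear_combination hε
      · linear_combination hε
      · ring
      · ring
      · ring
      · ring
    all_goals (try simp only [quotT1]); (try push_cast); (try field_simp); try ring
  · refine IsHeckeRep.mk' (a₁ := p ^ 2) (a₂ := 0) (a₃ := p * (x : ℕ)) (a₄ := p) ?_
      ⟨0, 0, -1, 0, 0, 1, 0, 0, 1, 0, 0, 0, 0, 0, 0, 1⟩ hp1 (by simp [repT1]) rfl rfl
      ?_ ?_ ?_ ?_ ?_ ?_ ?_ ?_ ?_ ?_ ?_ ?_ ?_ ?_ ?_ ?_ ?_ ?_ ?_ ?_ ?_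
    · constructor <;> simp only [quotT1] <;> ring
    all_goals (try simp only [quotT1]); (try push_cast); (try field_simp); try ring
  · have h1 : (((l : ℕ) + 1) * z l : ℚ) = 1 + p * w l := by exact_mod_cast hz l
    refine IsHeckeRep.mk' (a₁ := p) (a₂ := 0) (a₃ := p * (x : ℕ)) (a₄ := p) ?_
      ⟨(l : ℕ) + 1, 0, w l, 0, 0, 1, 0, 0, p, 0, z l, 0, 0, 0, 0, 1⟩ hp1 (by simp [repT1]) rfl rfl
      ?_ ?_ ?_ ?_ ?_ ?_ ?_ ?_ ?_ ?_ ?_ ?_ ?_ ?_ ?_ ?_ ?_ ?_ ?_ ?_ ?_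
    · constructor <;> simp only [quotT1] <;> ring
    all_goals (try simp only [quotT1]); (try push_cast); (try field_simp); try ring1
    linear_combination (p : ℚ) * h1
  · refine IsHeckeRep.mk' (a₁ := p ^ 2 * (p * ε)) (a₂ := p ^ 2 * (N * β)) (a₃ := p) (a₄ := p ^ 2) ?_
      ⟨0, 0, -1, 0, 0, 1, 0, 0, 1, 0, 0, 0, 0, 0, 0, 1⟩ hp1 (by simp [repT1]) rfl rfl
      ?_ ?_ ?_ ?_ ?_ ?_ ?_ ?_ ?_ ?_ ?_ ?_ ?_ ?_ ?_ ?_ ?_ ?_ ?_ ?_ ?_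
    · constructor <;> simp only [quotT1] <;> first | ring1 | linear_combination hε
    all_goals (try simp only [quotT1]); (try push_cast); (try field_simp); try ring1
    · linear_combination h2
    · linear_combination h2
    · linear_combination (p : ℚ) * h2
    · linear_combination -(p : ℚ) ^ 2 * h2
    · linear_combination h2
    · linear_combination h2
  · have h1 : (((l : ℕ) + 1) * z l : ℚ) = 1 + p * w l := by exact_mod_cast hz l
    refine IsHeckeRep.mk' (a₁ := p * (p * ε)) (a₂ := p * (N * β)) (a₃ := p) (a₄ := p ^ 2) ?_
      ⟨(l : ℕ) + 1, 0, w l, 0, 0, 1, 0, 0, p, 0, z l, 0, 0, 0, 0, 1⟩ hp1 (by simp [repT1]) rfl rfl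
      ?_ ?_ ?_ ?_ ?_ ?_ ?_ ?_ ?_ ?_ ?_ ?_ ?_ ?_ ?_ ?_ ?_ ?_ ?_ ?_ ?_
    · constructor <;> simp only [quotT1] <;> first | ring1 | linear_combination hε
    all_goals (try simp only [quotT1]); (try push_cast); (try field_simp); try ring1
    · linear_combination h2
    · linear_combination h2
    · linear_combination (((l : ℕ) : ℚ) + 1) * h2
    · linear_combination (p : ℚ) * h2
    · linear_combination h1 + ((((l : ℕ) : ℚ) + 1) * z l - 1) * h2
    · linear_combination h2
    · linear_combination (z l : ℚ) * h2
    · linear_combination h2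

/-- Admissibility only involves the first row of `x`. The first family contains the solution if
`p ∤ k11`, and the second one if `p ∣ k11` and `p ∤ k12`. If `p` divides both, then `(k13, k14)` is
a nonzero vector modulo `p`, and the other families are indexed by its class in the projective
line over `ℤ/p`: the third and fourth belong to the classes with `p ∤ k13`, the fifth and sixth to
the class with `p ∣ k13`. -/
lemma existsUnique_isAdmissible_quotT1 (hN : 0 < N) (hp : p.Prime) (hε : p ^ 2 * ε - N * β = 1)
    {z w : Fin (p - 1) → ℤ}
    (hz : ∀ l : Fin (p - 1), (((l : ℕ) : ℤ) + 1) * z l = 1 + p * w l)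
    {x : Entries} (hx : x.IsSymplectic N) :
    ∃! i, IsAdmissible N (deltaT1 p) (x.mul N (quotT1 N p ε β z i)) := by
  have hpp := Nat.prime_iff_prime_int.1 hp
  have hNβ : ¬ (p : ℤ) ∣ N * β := not_dvd_of_mul_eq_one_add hp (b := -1) (w := -p * ε)
    (by linear_combination hε)
  have hpN : ¬ (p : ℤ) ∣ N := fun h => hNβ (h.mul_right _)
  have hβ : ¬ (p : ℤ) ∣ β := fun h => hNβ (h.mul_left _)
  have hcop2 : IsCoprime ((p : ℤ) ^ 2) (N * β) := ⟨ε, -1, by linear_combination hε⟩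
  have hQ : ∀ i, (quotT1 N p ε β z i).IsSymplectic N := fun i =>
    (isHeckeRep_repT1 hN hp hε hz i).symplectic
  have hpp2 : (p : ℤ) ∣ (p : ℤ) ^ 2 := dvd_pow_self _ two_ne_zero
  have crit : ∀ i, IsAdmissible N (deltaT1 p) (x.mul N (quotT1 N p ε β z i)) ↔ _ := fun i =>
    isAdmissible_deltaT1_iff hN hp (hx.mul hN (hQ i))
  -- the conditions for the six families
  have c₁ : ∀ (y b₂ : Fin p) (b₁ : Fin (p ^ 2)), IsAdmissible N (deltaT1 p) (x.mul N
      (quotT1 N p ε β z (.inl (y, b₂, b₁)))) ↔ (p : ℤ) ∣ x.k12 - x.k11 * (y : ℕ) ∧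
        (p : ℤ) ∣ x.k14 - x.k11 * (b₂ : ℕ) ∧
          (p : ℤ) ^ 2 ∣ (x.k13 + N * (y : ℕ) * x.k14 - (b₂ : ℕ) * N * (x.k12 - (y : ℕ) * x.k11))
            - x.k11 * (b₁ : ℕ) := by
    intro y b₂ b₁
    rw [crit]
    simp only [Entries.mul, quotT1]
    exact and_congr (dvd_iff_of_sub_eq 0 (by ring))
      (and_congr (dvd_iff_of_sub_eq 0 (by ring)) (dvd_iff_of_sub_eq 0 (by ring)))
  have c₂ : ∀ (b₂ : Fin p) (b₃ : Fin (p ^ 2)), IsAdmissible N (deltaT1 p) (x.mul N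
      (quotT1 N p ε β z (.inr (.inl (b₂, b₃))))) ↔ (p : ℤ) ∣ x.k11 ∧
        (p : ℤ) ∣ x.k13 - N * x.k12 * (b₂ : ℕ) ∧
          (p : ℤ) ^ 2 ∣ (x.k14 - x.k11 * (b₂ : ℕ)) - x.k12 * (b₃ : ℕ) := by
    intro b₂ b₃
    rw [crit]
    simp only [Entries.mul, quotT1]
    refine and_congr ?_ ?_
    · rw [← (or_iff_right hβ : _ ↔ (p : ℤ) ∣ x.k11), ← hpp.dvd_mul, ← dvd_neg]
      exact dvd_iff_of_sub_eq (-(p * x.k12)) (by ring)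
    · have e3 : (p : ℤ) ^ 2 ∣ x.k11 * -(N * β * ((b₂ : ℕ) : ℤ)) + N * x.k12 *
          (-(p ^ 2 * ((b₂ : ℕ) : ℤ)) - β * ((b₃ : ℕ) : ℤ)) + x.k13 * p ^ 2 + N * x.k14 * β ↔
          (p : ℤ) ^ 2 ∣ (x.k14 - x.k11 * (b₂ : ℕ)) - x.k12 * (b₃ : ℕ) := by
        refine Iff.trans (dvd_iff_of_sub_eq (x.k13 - N * x.k12 * (b₂ : ℕ)) ?_)
          (⟨hcop2.dvd_of_dvd_mul_left, fun h => h.mul_left _⟩ : (p : ℤ) ^ 2 ∣ (N * β) *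
            ((x.k14 - x.k11 * (b₂ : ℕ)) - x.k12 * (b₃ : ℕ)) ↔ _)
        ring
      rw [e3]
      refine and_congr_left fun ⟨e, he⟩ => dvd_iff_of_sub_eq (ε * p * e) ?_
      linear_combination ε * he
  have c₃ : ∀ y : Fin p, IsAdmissible N (deltaT1 p) (x.mul N
      (quotT1 N p ε β z (.inr (.inr (.inl y))))) ↔ (p : ℤ) ∣ x.k12 ∧
        (p : ℤ) ∣ x.k14 - (-x.k13) * (y : ℕ) ∧ (p : ℤ) ^ 2 ∣ x.k11 - N * x.k12 * (y : ℕ) := by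
    intro y
    rw [crit]
    simp only [Entries.mul, quotT1]
    refine and_congr (dvd_iff_of_sub_eq 0 (by ring))
      (and_congr (dvd_iff_of_sub_eq 0 (by ring)) ?_)
    rw [← dvd_neg]
    exact dvd_iff_of_sub_eq 0 (by ring)
  have c₄ : ∀ (y : Fin p) (l : Fin (p - 1)), IsAdmissible N (deltaT1 p) (x.mul N
      (quotT1 N p ε β z (.inr (.inr (.inr (.inl (y, l))))))) ↔ (p : ℤ) ∣ x.k12 ∧
        (p : ℤ) ∣ x.k14 - (-x.k13) * (y : ℕ) ∧
          (p : ℤ) ^ 2 ∣ p * x.k13 - (x.k11 - N * x.k12 * (y : ℕ)) * ((l : ℕ) + 1) := by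
    intro y l
    have hl2 : IsCoprime ((p : ℤ) ^ 2) ((l : ℕ) + 1) :=
      (isCoprime_of_not_dvd hp (not_dvd_succ l)).symm.pow_left
    rw [crit]
    simp only [Entries.mul, quotT1]
    refine and_congr (dvd_iff_of_sub_eq 0 (by ring))
      (and_congr (dvd_iff_of_sub_eq 0 (by ring)) ?_)
    refine Iff.trans ⟨fun h => h.mul_left (((l : ℕ) : ℤ) + 1), hl2.dvd_of_dvd_mul_left⟩
      (dvd_iff_of_sub_eq (w l * x.k13) ?_)
    linear_combination p * x.k13 * hz l
  have c₅ : ∀ u : Unit, IsAdmissible N (deltaT1 p) (x.mul N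
      (quotT1 N p ε β z (.inr (.inr (.inr (.inr (.inl u))))))) ↔ (p : ℤ) ∣ x.k11 ∧
        (p : ℤ) ∣ x.k13 ∧ (p : ℤ) ^ 2 ∣ p * x.k11 - N * x.k12 := by
    intro u
    rw [crit]
    simp only [Entries.mul, quotT1]
    refine and_congr ?_ (and_congr (dvd_iff_of_sub_eq x.k14 (by ring)) ?_)
    · rw [← (or_iff_right hβ : _ ↔ (p : ℤ) ∣ x.k11), ← hpp.dvd_mul, ← dvd_neg]
      exact dvd_iff_of_sub_eq (-(ε * x.k12)) (by ring)
    · rw [← dvd_neg]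
      exact dvd_iff_of_sub_eq 0 (by ring)
  have c₆ : ∀ l : Fin (p - 1), IsAdmissible N (deltaT1 p) (x.mul N
      (quotT1 N p ε β z (.inr (.inr (.inr (.inr (.inr l))))))) ↔ (p : ℤ) ∣ x.k11 ∧
        (p : ℤ) ∣ x.k13 ∧
          (p : ℤ) ^ 2 ∣ p * x.k14 - (-(p * x.k11 - N * x.k12)) * ((l : ℕ) + 1) := by
    intro l
    have hl2 : IsCoprime ((p : ℤ) ^ 2) ((l : ℕ) + 1) :=
      (isCoprime_of_not_dvd hp (not_dvd_succ l)).symm.pow_left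
    rw [crit]
    simp only [Entries.mul, quotT1]
    refine and_congr ?_ ?_
    · rw [← (or_iff_right hβ : _ ↔ (p : ℤ) ∣ x.k11), ← hpp.dvd_mul, ← dvd_neg]
      exact dvd_iff_of_sub_eq (-(ε * x.k12)) (by ring)
    rw [show (p : ℤ) ∣ x.k11 * 0 + x.k12 * 0 + x.k13 * 1 + x.k14 * p ↔ (p : ℤ) ∣ x.k13 from
      dvd_iff_of_sub_eq x.k14 (by ring)]
    refine and_congr_right fun ⟨e, he⟩ => ?_
    rw [← dvd_neg (b := (p : ℤ) * x.k14 - _)]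
    refine Iff.trans ⟨fun h => h.mul_left (((l : ℕ) : ℤ) + 1), hl2.dvd_of_dvd_mul_left⟩
      (dvd_iff_of_sub_eq (((l : ℕ) + 1) * z l * (p * ε) * e
        + p * x.k14 * ε * (((l : ℕ) + 1) * z l) - x.k14 * w l) ?_)
    linear_combination (((l : ℕ) + 1) * z l * p * p * ε : ℤ) * he
      - (((l : ℕ) + 1) * z l * p * x.k14 : ℤ) * hε - (p * x.k14 : ℤ) * hz l
  -- the first row of a symplectic matrix is nonzero modulo `p`
  have prim : ¬ (((p : ℤ) ∣ x.k11 ∧ (p : ℤ) ∣ x.k12) ∧ (p : ℤ) ∣ x.k13 ∧ (p : ℤ) ∣ x.k14) := by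
    rintro ⟨⟨⟨a, ha⟩, ⟨b, hb⟩⟩, ⟨c, hc⟩, ⟨d, hd⟩⟩
    refine hpp.not_isUnit (isUnit_of_dvd_one ⟨a * x.k33 + N * b * x.k34 - c * x.k31
      - N * d * x.k32, ?_⟩)
    rw [← hx.r13, ha, hb, hc, hd]; ring
  have hp2 : IsCoprime x.k11 p → IsCoprime x.k11 ((p ^ 2 : ℕ) : ℤ) := fun h => by
    push_cast; exact h.pow_right
  by_cases h11 : (p : ℤ) ∣ x.k11
  swap
  · refine existsUnique_inl ?_ ?_
    · have hcop := isCoprime_of_not_dvd hp h11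
      refine existsUnique_prod (R := fun y i => (p : ℤ) ∣ x.k14 - x.k11 * (i.1 : ℕ) ∧
        (p : ℤ) ^ 2 ∣ (x.k13 + N * (y : ℕ) * x.k14 - (i.1 : ℕ) * N * (x.k12 - (y : ℕ) * x.k11))
            - x.k11 * (i.2 : ℕ)) (fun y i => c₁ y i.1 i.2)
        (existsUnique_fin_dvd hp.pos hcop x.k12) fun y _ =>
        existsUnique_prod (fun _ _ => Iff.rfl)
        (existsUnique_fin_dvd hp.pos hcop x.k14) fun b₂ _ => ?_
      have := existsUnique_fin_dvd (n := p ^ 2) (pow_pos hp.pos 2) (hp2 hcop)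
        (x.k13 + N * (y : ℕ) * x.k14 - (b₂ : ℕ) * N * (x.k12 - (y : ℕ) * x.k11))
      exact_mod_cast this
    · rintro (⟨b₂, b₃⟩ | y | ⟨y, l⟩ | u | l) h
      · exact h11 ((c₂ _ _).1 h).1
      · obtain ⟨h1, -, h3⟩ := (c₃ _).1 h
        exact h11 ((dvd_sub_left ((h1.mul_left _).mul_right _)).1 (hpp2.trans h3))
      · obtain ⟨h1, -, h3⟩ := (c₄ _ _).1 h
        have h4 := (dvd_sub_right (dvd_mul_right _ _)).1 (hpp2.trans h3)
        exact h11 ((dvd_sub_left ((h1.mul_left _).mul_right _)).1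
          ((hpp.dvd_mul.1 h4).resolve_right (not_dvd_succ l)))
      · exact h11 ((c₅ _).1 h).1
      · exact h11 ((c₆ _).1 h).1
  refine existsUnique_inr ?_ ?_
  · rintro ⟨y, b₂, b₁⟩ h
    obtain ⟨h1, h2, h3⟩ := (c₁ _ _ _).1 h
    have h12 := (dvd_sub_left (h11.mul_right _)).1 h1
    have h14 := (dvd_sub_left (h11.mul_right _)).1 h2
    have h13 := (dvd_sub_left (h11.mul_right _)).1 (hpp2.trans h3)
    have h13' := (dvd_sub_left ((dvd_sub h12 (h11.mul_left _)).mul_left _)).1 h13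
    exact prim ⟨⟨h11, h12⟩, (dvd_add_left (h14.mul_left _)).1 h13', h14⟩
  by_cases h12 : (p : ℤ) ∣ x.k12
  swap
  · have hN12 : ¬ (p : ℤ) ∣ N * x.k12 := fun h => (hpp.dvd_mul.1 h).elim hpN h12
    refine existsUnique_inl ?_ ?_
    · refine existsUnique_prod (fun b₂ b₃ => (c₂ b₂ b₃).trans (and_iff_right h11))
        (existsUnique_fin_dvd hp.pos (isCoprime_of_not_dvd hp hN12) x.k13) fun b₂ _ => ?_
      have := existsUnique_fin_dvd (n := p ^ 2) (pow_pos hp.pos 2) (a := x.k12)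
        (by push_cast; exact (isCoprime_of_not_dvd hp h12).pow_right)
        (x.k14 - x.k11 * (b₂ : ℕ))
      exact_mod_cast this
    · rintro (y | ⟨y, l⟩ | u | l) h
      · exact h12 ((c₃ _).1 h).1
      · exact h12 ((c₄ _ _).1 h).1
      · exact hN12 ((dvd_sub_right (dvd_mul_right _ _)).1 (hpp2.trans ((c₅ _).1 h).2.2))
      · have h4 := (dvd_sub_right (dvd_mul_right _ _)).1 (hpp2.trans ((c₆ _).1 h).2.2)
        have h5 := dvd_neg.1 ((hpp.dvd_mul.1 h4).resolve_right (not_dvd_succ l))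
        exact hN12 ((dvd_sub_right (dvd_mul_right _ _)).1 h5)
  refine existsUnique_inr ?_ ?_
  · rintro ⟨b₂, b₃⟩ h
    obtain ⟨-, h2, h3⟩ := (c₂ _ _).1 h
    have h14 := (dvd_sub_left (h12.mul_right _)).1 (hpp2.trans h3)
    exact prim ⟨⟨h11, h12⟩, (dvd_sub_left ((h12.mul_left _).mul_right _)).1 h2,
      (dvd_sub_left (h11.mul_right _)).1 h14⟩
  obtain ⟨s, hs⟩ := id h11
  obtain ⟨t, ht⟩ := id h12
  -- as `p` divides `k11` and `k12`, the congruences modulo `p²` can be divided by `p`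
  have hW₃ : ∀ y : Fin p, (p : ℤ) ^ 2 ∣ x.k11 - N * x.k12 * (y : ℕ) ↔
      (p : ℤ) ∣ s - N * t * (y : ℕ) := by
    intro y
    rw [hs, ht, sq, show (p : ℤ) * s - N * (p * t) * (y : ℕ) = p * (s - N * t * (y : ℕ)) by ring]
    exact mul_dvd_mul_iff_left hpp.ne_zero
  have hW₄ : ∀ (y : Fin p) (l : Fin (p - 1)), (p : ℤ) ^ 2 ∣ p * x.k13 -
      (x.k11 - N * x.k12 * (y : ℕ)) * ((l : ℕ) + 1) ↔
      (p : ℤ) ∣ x.k13 - (s - N * t * (y : ℕ)) * ((l : ℕ) + 1) := by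
    intro y l
    rw [hs, ht, sq, show (p : ℤ) * x.k13 - (p * s - N * (p * t) * (y : ℕ)) * ((l : ℕ) + 1) =
      p * (x.k13 - (s - N * t * (y : ℕ)) * ((l : ℕ) + 1)) by ring]
    exact mul_dvd_mul_iff_left hpp.ne_zero
  have hW₅ : (p : ℤ) ^ 2 ∣ p * x.k11 - N * x.k12 ↔ (p : ℤ) ∣ x.k11 - N * t := by
    rw [ht, sq, show (p : ℤ) * x.k11 - N * (p * t) = p * (x.k11 - N * t) by ring]
    exact mul_dvd_mul_iff_left hpp.ne_zero
  have hW₆ : ∀ l : Fin (p - 1), (p : ℤ) ^ 2 ∣ p * x.k14 -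
      (-(p * x.k11 - N * x.k12)) * ((l : ℕ) + 1) ↔
      (p : ℤ) ∣ x.k14 - (-(x.k11 - N * t)) * ((l : ℕ) + 1) := by
    intro l
    rw [ht, sq, show (p : ℤ) * x.k14 - (-(p * x.k11 - N * (p * t))) * ((l : ℕ) + 1) =
      p * (x.k14 - (-(x.k11 - N * t)) * ((l : ℕ) + 1)) by ring]
    exact mul_dvd_mul_iff_left hpp.ne_zero
  simp only [hW₃] at c₃
  simp only [hW₄] at c₄
  simp only [hW₅] at c₅
  simp only [hW₆] at c₆
  by_cases h13 : (p : ℤ) ∣ x.k13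
  · have h14 : ¬ (p : ℤ) ∣ x.k14 := fun h14 => prim ⟨⟨h11, h12⟩, h13, h14⟩
    have h14' : ∀ y : ℤ, ¬ (p : ℤ) ∣ x.k14 - (-x.k13) * y := fun y h =>
      h14 ((dvd_sub_left ((dvd_neg.2 h13).mul_right _)).1 h)
    refine existsUnique_inr (fun y h => h14' _ ((c₃ _).1 h).2.1)
      (existsUnique_inr (fun i h => h14' _ ((c₄ i.1 i.2).1 h).2.1) ?_)
    by_cases hW : (p : ℤ) ∣ x.k11 - N * t
    · refine existsUnique_inl ⟨(), (c₅ _).2 ⟨h11, h13, hW⟩, fun _ _ => rfl⟩ fun l h => ?_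
      exact h14 ((dvd_sub_left ((dvd_neg.2 hW).mul_right _)).1 ((c₆ _).1 h).2.2)
    · refine existsUnique_inr (fun u h => hW ((c₅ _).1 h).2.2) ?_
      simp only [c₆, h11, h13, true_and]
      exact existsUnique_unit_dvd hp (by rwa [dvd_neg]) h14
  · obtain ⟨y, hy, huy⟩ := existsUnique_fin_dvd hp.pos (a := -x.k13)
      (isCoprime_of_not_dvd hp (by rwa [dvd_neg])) x.k14
    have h₅ : ∀ i, ¬ IsAdmissible N (deltaT1 p) (x.mul N
        (quotT1 N p ε β z (.inr (.inr (.inr (.inr i)))))) := by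
      rintro (u | l) h
      · exact h13 ((c₅ _).1 h).2.1
      · exact h13 ((c₆ _).1 h).2.1
    by_cases hW : (p : ℤ) ∣ s - N * t * (y : ℕ)
    · refine existsUnique_inl ⟨y, (c₃ y).2 ⟨h12, hy, hW⟩, fun y' h => huy y' ((c₃ _).1 h).2.1⟩ ?_
      rintro (⟨y', l⟩ | i) h
      · obtain ⟨-, h2, h3⟩ := (c₄ _ _).1 h
        obtain rfl := huy y' h2
        exact h13 ((dvd_sub_left (hW.mul_right _)).1 h3)
      · exact h₅ i h
    · refine existsUnique_inr ?_ (existsUnique_inl ?_ h₅)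
      · intro y' h
        obtain ⟨-, h2, h3⟩ := (c₃ _).1 h
        obtain rfl := huy y' h2
        exact hW h3
      · refine existsUnique_prod (Q := fun y' => y' = y) (R := fun _ l => (p : ℤ) ∣
          x.k13 - (s - N * t * (y : ℕ)) * ((l : ℕ) + 1)) (fun y' l => ?_) ⟨y, rfl, fun _ h => h⟩
          fun _ _ => existsUnique_unit_dvd hp hW h13
        rw [c₄]
        constructor
        · rintro ⟨-, h2, h3⟩
          obtain rfl := huy y' h2
          exact ⟨rfl, h3⟩
        · rintro ⟨rfl, h⟩
          exact ⟨h12, hy, h⟩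

end RepT1

/-! ### The Fourier coefficients of `f | T` at a prime dividing the level exactly once -/

section Formulas

variable {k : ℤ} {N p : ℕ} {f : Siegel → ℂ}

lemma exists_inverses (hp : p.Prime) {q : ℤ} (hq : ¬ (p : ℤ) ∣ q) : ∃ μ w : Fin (p - 1) → ℤ,
    ∀ l : Fin (p - 1), ((((l : ℕ) : ℤ) + 1) * q) * μ l = 1 + p * w l := by
  have : ∀ l : Fin (p - 1), ∃ b w : ℤ, ((((l : ℕ) : ℤ) + 1) * q) * b = 1 + p * w := fun l =>
    exists_mul_eq_one_add hp fun h =>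
      ((Nat.prime_iff_prime_int.1 hp).dvd_mul.1 h).elim (not_dvd_succ l) hq
  choose μ w h using this
  exact ⟨μ, w, h⟩

lemma isSimilitude_deltaT (hp : p.Prime) : IsSimilitude (deltaT p) (p : ℕ) :=
  isSimilitude_diag4 (by exact_mod_cast hp.pos) (by simp) (by simp)

lemma isSimilitude_deltaT0 (hp : p.Prime) : IsSimilitude (deltaT0 p) (p ^ 2 : ℕ) :=
  isSimilitude_diag4 (by exact_mod_cast pow_pos hp.pos 2) (by push_cast; ring) (by push_cast; ring)

lemma isSimilitude_deltaT1 (hp : p.Prime) : IsSimilitude (deltaT1 p) (p ^ 2 : ℕ) :=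
  isSimilitude_diag4 (by exact_mod_cast pow_pos hp.pos 2) (by push_cast; ring) (by push_cast; ring)

lemma trace_indexMatrix_mul (N : ℕ) (n r m : ℤ) (e₁ e₂ e₃ e₄ b₁ b₂ b₃ b₄ : ℚ) :
    (indexMatrix N n r m * (!![e₁, e₂; e₃, e₄] * !![b₁, b₂; b₃, b₄])).trace =
      n * (e₁ * b₁ + e₂ * b₃) + r / 2 * (e₁ * b₂ + e₂ * b₄ + (e₃ * b₁ + e₄ * b₃))
        + m * N * (e₃ * b₂ + e₄ * b₄) := by
  rw [indexMatrix, mul_fin_two, mul_fin_two, trace_fin_two_of]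
  ring

lemma zpow_mul_det_zpow (hp : p.Prime) {D : Mat2} {j : ℤ} (s : ℤ) (hD : D.det = (p : ℚ) ^ j) :
    (p : ℂ) ^ s * (D.det : ℂ) ^ (-k) = (p : ℂ) ^ (s - j * k) := by
  have hpC : (p : ℂ) ≠ 0 := by exact_mod_cast hp.ne_zero
  rw [hD, Rat.cast_zpow, Rat.cast_natCast, ← _root_.zpow_mul, ← zpow_add₀ hpC]
  congr 1; ring

lemma expRat_eq_one {x : ℚ} (z : ℤ) (h : x = z) : expRat x = 1 := h ▸ expRat_intCast z

lemma smul_act_smul (c d : ℚ) (t u : Mat2) : c • act t (d • u) = (c * d ^ 2) • act t u := by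
  simp only [act, transpose_smul, Matrix.smul_mul, Matrix.mul_smul, smul_smul]
  congr 1; ring

lemma act_one (t : Mat2) : act t !![1, 0; 0, 1] = t := by
  rw [← one_fin_two]; simp [act]

lemma smul_act_scalar (hp : p.Prime) (t : Mat2) :
    (1 / (p : ℕ) : ℚ) • act t !![(p : ℚ), 0; 0, p] = (p : ℚ) • t := by
  have hp0 : (p : ℚ) ≠ 0 := by exact_mod_cast hp.ne_zero
  rw [show !![(p : ℚ), 0; 0, p] = (p : ℚ) • !![1, 0; 0, 1] by
    ext i j; fin_cases i <;> fin_cases j <;> simp, smul_act_smul, act_one]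
  congr 1; field_simp

lemma isRepSystem_repT (hN : 0 < N) (hp : p.Prime) {q : ℕ} (hq : N = p * q)
    (hq₁ : ¬ (p : ℤ) ∣ q) {M a c : ℤ} (hM : ¬ (p : ℤ) ∣ M) (hac : a * p - c * q = 1) :
    IsRepSystem N (deltaT p) (fun i => fromBlocks (repT N p M a c i).1 (repT N p M a c i).2.1 0
      (repT N p M a c i).2.2) ∧ ∀ i s t, ∃ z : ℤ, (repT N p M a c i).1 s t = z := by
  obtain ⟨μ, w, hμ⟩ := exists_inverses hp hq₁
  have h := isHeckeRep_repT (M := M) hN hp hq hac hμ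
  exact ⟨isRepSystem_of_isHeckeRep hN (by exact_mod_cast hp.pos) (by simp) (by simp) h fun x hx =>
    existsUnique_isAdmissible_quotT hN hp hq hq₁ hM hμ (fun i => (h i).symplectic) hx,
    fun i => (h i).integral⟩

lemma isRepSystem_repT0 (hN : 0 < N) (hp : p.Prime) {q : ℕ} (hq : N = p * q)
    (hq₁ : ¬ (p : ℤ) ∣ q) {M a c : ℤ} (hM : ¬ (p : ℤ) ∣ M) (hac : a * p - c * q = 1) :
    IsRepSystem N (deltaT0 p) (fun i => fromBlocks (repT0 N p M c i).1 (repT0 N p M c i).2.1 0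
      (repT0 N p M c i).2.2) ∧ ∀ i s t, ∃ z : ℤ, (repT0 N p M c i).1 s t = z := by
  obtain ⟨μ, w, hμ⟩ := exists_inverses hp hq₁
  have h := isHeckeRep_repT0 (M := M) hN hp hq hac hμ
  exact ⟨isRepSystem_of_isHeckeRep hN (by exact_mod_cast pow_pos hp.pos 2) (by ring) (by ring) h
    fun x hx => existsUnique_isAdmissible_quotT0 hN hp hq hq₁ hM hμ (fun i => (h i).symplectic) hx,
    fun i => (h i).integral⟩

lemma isRepSystem_repGoodT (hN : 0 < N) (hp : p.Prime) (hpN : ¬ p ∣ N) :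
    IsRepSystem N (deltaT p) (fun i => fromBlocks (repGoodT N p i).1 (repGoodT N p i).2.1 0
      (repGoodT N p i).2.2) ∧ ∀ i s t, ∃ z : ℤ, (repGoodT N p i).1 s t = z := by
  have h := isHeckeRep_repGoodT (N := N) hN hp
  exact ⟨isRepSystem_of_isHeckeRep hN (by exact_mod_cast hp.pos) (by simp) (by simp) h fun x hx =>
    existsUnique_isAdmissible_quotGoodT hN hp hpN hx, fun i => (h i).integral⟩

lemma isRepSystem_repT1 (hN : 0 < N) (hp : p.Prime) {ε β : ℤ} (hε : p ^ 2 * ε - N * β = 1) :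
    IsRepSystem N (deltaT1 p) (fun i => fromBlocks (repT1 N p ε β i).1 (repT1 N p ε β i).2.1 0
      (repT1 N p ε β i).2.2) ∧ ∀ i s t, ∃ z : ℤ, (repT1 N p ε β i).1 s t = z := by
  obtain ⟨z, w, hz⟩ := exists_inverses hp (q := 1)
    fun h => (Nat.prime_iff_prime_int.1 hp).not_isUnit (isUnit_of_dvd_one h)
  simp only [mul_one] at hz
  have h := isHeckeRep_repT1 hN hp hε hz
  exact ⟨isRepSystem_of_isHeckeRep hN (by exact_mod_cast pow_pos hp.pos 2) (by ring) (by ring) h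
    fun x hx => existsUnique_isAdmissible_quotT1 hN hp hε hz hx, fun i => (h i).integral⟩

/-- The Fourier coefficients of `f | T(p)` for `p ∥ N`. -/
theorem fourierCoeff_deltaT (hN : 0 < N) (hp : p.Prime) {q : ℕ} (hq : N = p * q)
    (hq₁ : ¬ (p : ℤ) ∣ q) {M a c : ℤ} (hM : ¬ (p : ℤ) ∣ M) (hac : a * p - c * q = 1)
    (hf : IsCuspForm k N f) {n r m : ℤ} {t : Mat2} (ht : t = indexMatrix N n r m) :
    fourierCoeff N (heckeOp k N (deltaT p) f) t =
      fourierCoeff N f ((p : ℚ) • t)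
      + (p : ℂ) ^ (k - 2) * ∑ x ∈ Finset.range p,
          fourierCoeff N f ((1 / p : ℚ) • act t !![1, 0; -(x : ℚ), p])
      + (p : ℂ) ^ (k - 2) * ∑ y ∈ Finset.range p,
          fourierCoeff N f ((1 / p : ℚ) • act t !![(p : ℚ), N * M * y; 0, 1])
      + (p : ℂ) ^ (2 * k - 3) * fourierCoeff N f ((1 / p : ℚ) • t)
      + (p : ℂ) ^ (k - 3) * charSum p (2 * t 0 1) *
          fourierCoeff N f ((1 / p : ℚ) • act t !![(a * p : ℚ), N; c, p]) := by
  have hN0 : (N : ℚ) ≠ 0 := by exact_mod_cast hN.ne'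
  have hp0 : (p : ℚ) ≠ 0 := by exact_mod_cast hp.ne_zero
  have hpC : (p : ℂ) ≠ 0 := by exact_mod_cast hp.ne_zero
  have h2 : (a * p - c * q : ℚ) = 1 := by exact_mod_cast hac
  have h3 : (N : ℚ) = p * q := by exact_mod_cast hq
  obtain ⟨hrep, hint⟩ := isRepSystem_repT hN hp hq hq₁ hM hac
  rw [fourierCoeff_heckeOp hN (isSimilitude_deltaT hp) hrep hint hf t]
  simp only [Fintype.sum_sum_type, Fintype.sum_prod_type, repT, transpose_fin_two]
  -- the exponential is `1`, except for the families with a parameter `l`, where it gives `charSum`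
  have e₁ : ∀ b₁ b₃ b₂ : Fin p, (p : ℂ) ^ (2 * k - 3) *
      ((!![(p : ℚ), 0; 0, p].det : ℚ) : ℂ) ^ (-k) *
      expRat ((t * (!![(p : ℚ), 0; 0, p] *
        !![((b₁ : ℕ) : ℚ), (b₂ : ℕ); (b₂ : ℕ), (b₃ : ℕ) / (N : ℚ)])).trace / (p : ℕ)) *
      fourierCoeff N f ((1 / (p : ℕ) : ℚ) • act t !![(p : ℚ), 0; 0, p]) =
      (p : ℂ) ^ (-3 : ℤ) * fourierCoeff N f ((p : ℚ) • t) := by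
    intro b₁ b₃ b₂
    rw [zpow_mul_det_zpow hp (j := 2) _ (by rw [det_fin_two_of, zpow_two]; ring), smul_act_scalar hp, ht,
      trace_indexMatrix_mul, expRat_eq_one (n * (b₁ : ℕ) + r * (b₂ : ℕ) + m * (b₃ : ℕ))
      (by push_cast; field_simp; ring), mul_one, show 2 * k - 3 - 2 * k = -3 by ring]
  have e₂ : ∀ b₃ x : Fin p, (p : ℂ) ^ (2 * k - 3) *
      ((!![1, -((x : ℕ) : ℚ); 0, p].det : ℚ) : ℂ) ^ (-k) *
      expRat ((t * (!![1, 0; -((x : ℕ) : ℚ), p] *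
        !![0, 0; 0, (b₃ : ℕ) / (N : ℚ)])).trace / (p : ℕ)) *
      fourierCoeff N f ((1 / (p : ℕ) : ℚ) • act t !![1, 0; -((x : ℕ) : ℚ), p]) =
      (p : ℂ) ^ (k - 3) * fourierCoeff N f ((1 / p : ℚ) • act t !![1, 0; -((x : ℕ) : ℚ), p]) := by
    intro b₃ x
    rw [zpow_mul_det_zpow hp (j := 1) _ (by rw [det_fin_two_of, zpow_one]; ring), ht,
      trace_indexMatrix_mul, expRat_eq_one (m * (b₃ : ℕ))
      (by push_cast; field_simp; ring), mul_one, show 2 * k - 3 - 1 * k = k - 3 by ring]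
  have e₃ : ∀ b₁ y : Fin p, (p : ℂ) ^ (2 * k - 3) *
      ((!![(p : ℚ), 0; N * M * (y : ℕ), 1].det : ℚ) : ℂ) ^ (-k) *
      expRat ((t * (!![(p : ℚ), N * M * (y : ℕ); 0, 1] *
        !![((b₁ : ℕ) : ℚ), 0; 0, 0])).trace / (p : ℕ)) *
      fourierCoeff N f ((1 / (p : ℕ) : ℚ) • act t !![(p : ℚ), N * M * (y : ℕ); 0, 1]) =
      (p : ℂ) ^ (k - 3) *
        fourierCoeff N f ((1 / p : ℚ) • act t !![(p : ℚ), N * M * (y : ℕ); 0, 1]) := by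
    intro b₁ y
    rw [zpow_mul_det_zpow hp (j := 1) _ (by rw [det_fin_two_of, zpow_one]; ring), ht,
      trace_indexMatrix_mul, expRat_eq_one (n * (b₁ : ℕ))
      (by push_cast; field_simp; ring), mul_one, show 2 * k - 3 - 1 * k = k - 3 by ring]
  have e₄ : (p : ℂ) ^ (2 * k - 3) * ((!![(1 : ℚ), 0; 0, 1].det : ℚ) : ℂ) ^ (-k) *
      expRat ((t * (!![(1 : ℚ), 0; 0, 1] * !![0, 0; 0, 0])).trace / (p : ℕ)) *
      fourierCoeff N f ((1 / (p : ℕ) : ℚ) • act t !![1, 0; 0, 1]) =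
      (p : ℂ) ^ (2 * k - 3) * fourierCoeff N f ((1 / p : ℚ) • t) := by
    rw [zpow_mul_det_zpow hp (j := 0) _ (by rw [det_fin_two_of, zpow_zero]; ring), act_one, ht,
      trace_indexMatrix_mul, expRat_eq_one 0 (by simp), mul_one,
      show 2 * k - 3 - 0 * k = 2 * k - 3 by ring]
  have e₅ : ∀ l : Fin (p - 1), (p : ℂ) ^ (2 * k - 3) *
      ((!![(a * p : ℚ), c; N, p].det : ℚ) : ℂ) ^ (-k) *
      expRat ((t * (!![(a * p : ℚ), N; c, p] *
        !![-(((l : ℕ) + 1) * (N / p) : ℚ), (l : ℕ) + 1; ((l : ℕ) + 1) * a,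
          -(((l : ℕ) + 1) * c / p)])).trace / (p : ℕ)) *
      fourierCoeff N f ((1 / (p : ℕ) : ℚ) • act t !![(a * p : ℚ), N; c, p]) =
      expRat ((((l : ℕ) : ℚ) + 1) * r / p) * ((p : ℂ) ^ (k - 3) *
        fourierCoeff N f ((1 / p : ℚ) • act t !![(a * p : ℚ), N; c, p])) := by
    intro l
    rw [zpow_mul_det_zpow hp (j := 1) _ (by
        rw [det_fin_two_of, zpow_one, h3]; linear_combination (p : ℚ) * h2),
      show 2 * k - 3 - 1 * k = k - 3 by ring]
    have : (t * (!![(a * p : ℚ), N; c, p] * !![-(((l : ℕ) + 1) * (N / p) : ℚ), (l : ℕ) + 1;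
        ((l : ℕ) + 1) * a, -(((l : ℕ) + 1) * c / p)])).trace / (p : ℕ) =
        (((l : ℕ) : ℚ) + 1) * r / p := by
      rw [ht, trace_indexMatrix_mul, h3]
      field_simp
      linear_combination 2 * (r : ℚ) * h2
    rw [this]
    ring
  simp only [e₁, e₂, e₃, e₄, e₅, ← Finset.sum_mul, sum_expRat_eq_charSum hp, Finset.sum_const,
    Finset.card_univ, Fintype.card_fin, nsmul_eq_mul, Fintype.univ_unit, Finset.card_singleton,
    ← Finset.mul_sum]
  rw [Fin.sum_univ_eq_sum_range (fun x => fourierCoeff N f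
      ((1 / p : ℚ) • act t !![1, 0; -(x : ℚ), p])) p,
    Fin.sum_univ_eq_sum_range (fun y => fourierCoeff N f
      ((1 / p : ℚ) • act t !![(p : ℚ), N * M * y; 0, 1])) p]
  have hr : 2 * t 0 1 = (r : ℚ) := by rw [ht]; simp [indexMatrix]; ring
  have z1 : (p : ℂ) ^ (k - 2) = p * (p : ℂ) ^ (k - 3) := by
    rw [← zpow_one_add₀ hpC]; congr 1; ring
  have z2 : (p : ℂ) * (p * (p * (p : ℂ) ^ (-3 : ℤ))) = 1 := by
    rw [← zpow_one_add₀ hpC, ← zpow_one_add₀ hpC, ← zpow_one_add₀ hpC]; norm_num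
  rw [hr, z1]
  linear_combination fourierCoeff N f ((p : ℚ) • t) * z2

end Formulas

section Formulas

variable {k : ℤ} {N p : ℕ} {f : Siegel → ℂ}

lemma smul_fin_two (c e₁ e₂ e₃ e₄ : ℚ) :
    c • !![e₁, e₂; e₃, e₄] = !![c * e₁, c * e₂; c * e₃, c * e₄] := by
  ext i j; fin_cases i <;> fin_cases j <;> rfl

lemma smul_act_eq (hp : p.Prime) {t u v : Mat2} (h : u = (p : ℚ) • v) :
    (1 / (p ^ 2 : ℕ) : ℚ) • act t u = act t v := by
  have hp0 : (p : ℚ) ≠ 0 := by exact_mod_cast hp.ne_zero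
  rw [h, smul_act_smul, Nat.cast_pow, one_div_mul_cancel (pow_ne_zero 2 hp0), one_smul]

lemma sq_zpow_mul_det_zpow (hp : p.Prime) {D : Mat2} {j : ℤ} (hD : D.det = (p : ℚ) ^ j) :
    ((p ^ 2 : ℕ) : ℂ) ^ (2 * k - 3) * (D.det : ℂ) ^ (-k) = (p : ℂ) ^ (4 * k - 6 - j * k) := by
  rw [Nat.cast_pow, ← zpow_natCast (p : ℂ) 2, ← _root_.zpow_mul, zpow_mul_det_zpow hp _ hD]
  congr 1; push_cast; ring

/-- The Fourier coefficients of `f | T₀(p²)` for `p ∥ N`. -/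
theorem fourierCoeff_deltaT0 (hN : 0 < N) (hp : p.Prime) {q : ℕ} (hq : N = p * q)
    (hq₁ : ¬ (p : ℤ) ∣ q) {M a c : ℤ} (hM : M * q ≡ 1 [ZMOD p]) (hac : a * p - c * q = 1)
    (hf : IsCuspForm k N f) {n r m : ℤ} {t : Mat2} (ht : t = indexMatrix N n r m) :
    fourierCoeff N (heckeOp k N (deltaT0 p) f) t =
      (p : ℂ) ^ (k - 3) * ∑ x ∈ Finset.range p,
          fourierCoeff N f (act t !![1, 0; -(x : ℚ), p])
      + (p : ℂ) ^ (3 * k - 6) * ∑ y ∈ Finset.range p,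
          fourierCoeff N f (act t !![1, (N * M * y / p : ℚ); 0, 1 / p])
      + (p : ℂ) ^ (2 * k - 6) * ∑ y ∈ Finset.range p,
          charSum p (2 * t 0 1 * (1 + 2 * c * N / p + 2 * c * y) + 2 * t 1 1 * c / p) *
          fourierCoeff N f
            (act t !![((c * N + p + c * N * M * y) / p : ℚ), N + N * M * y; c / p, 1])
      + (p : ℂ) ^ (2 * k - 6) * ∑ x ∈ Finset.range p, ∑ y ∈ Finset.range p,
          charSum p (2 * t 0 1 * M * y + t 1 1 / N) *
          fourierCoeff N f
            (act t !![(1 + N * M * x * y / p : ℚ), N * M * y; x / p, 1]) := by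
  have hN0 : (N : ℚ) ≠ 0 := by exact_mod_cast hN.ne'
  have hp0 : (p : ℚ) ≠ 0 := by exact_mod_cast hp.ne_zero
  have hpC : (p : ℂ) ≠ 0 := by exact_mod_cast hp.ne_zero
  have h3 : (N : ℚ) = p * q := by exact_mod_cast hq
  have hq0 : (q : ℚ) ≠ 0 := fun h => hN0 (by rw [h3, h, mul_zero])
  obtain ⟨w, hw⟩ := hM.symm.dvd
  have h4 : (M * q - 1 : ℚ) = p * w := by exact_mod_cast hw
  have hM' : ¬ (p : ℤ) ∣ M := fun h => (Nat.prime_iff_prime_int.1 hp).not_isUnit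
    (isUnit_of_dvd_one ((dvd_sub_right (h.mul_right (q : ℤ))).1 ⟨w, hw⟩))
  have hr : 2 * t 0 1 = (r : ℚ) := by rw [ht]; simp [indexMatrix]; ring
  have hm : t 1 1 = (m : ℚ) * N := by rw [ht]; simp [indexMatrix]
  obtain ⟨hrep, hint⟩ := isRepSystem_repT0 hN hp hq hq₁ hM' hac
  rw [fourierCoeff_heckeOp hN (isSimilitude_deltaT0 hp) hrep hint hf t]
  simp only [Fintype.sum_sum_type, Fintype.sum_prod_type, repT0, transpose_fin_two]
  -- the exponential is `1`, except for the families with a parameter `l`, where it gives `charSum`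
  have e₁ : ∀ (x b₂ : Fin p) (b₃ : Fin (p ^ 2)), ((p ^ 2 : ℕ) : ℂ) ^ (2 * k - 3) *
      ((!![(p : ℚ), -(p * (x : ℕ)); 0, p ^ 2].det : ℚ) : ℂ) ^ (-k) *
      expRat ((t * (!![(p : ℚ), 0; -(p * (x : ℕ)), p ^ 2] *
        !![0, p * ((b₂ : ℕ) : ℚ); (b₂ : ℕ), (b₃ : ℕ) / (N : ℚ) - (x : ℕ) * (b₂ : ℕ)])).trace /
          (p ^ 2 : ℕ)) *
      fourierCoeff N f ((1 / (p ^ 2 : ℕ) : ℚ) • act t !![(p : ℚ), 0; -(p * (x : ℕ)), p ^ 2]) =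
      (p : ℂ) ^ (k - 6) * fourierCoeff N f (act t !![1, 0; -((x : ℕ) : ℚ), p]) := by
    intro x b₂ b₃
    rw [sq_zpow_mul_det_zpow hp (j := 3) (by
        rw [det_fin_two_of, show (3 : ℤ) = (3 : ℕ) from rfl, zpow_natCast]; ring),
      smul_act_eq (v := !![1, 0; -((x : ℕ) : ℚ), p]) hp (by
        rw [smul_fin_two]
        exact fin_two_congr (by ring) (by ring) (by ring) (by ring)), ht,
      trace_indexMatrix_mul,
      expRat_eq_one (r * (b₂ : ℕ) + m * ((b₃ : ℕ) - 2 * N * (x : ℕ) * (b₂ : ℕ)))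
      (by push_cast; field_simp; ring), mul_one, show 4 * k - 6 - 3 * k = k - 6 by ring]
  have e₂ : ∀ y : Fin p, ((p ^ 2 : ℕ) : ℂ) ^ (2 * k - 3) *
      ((!![(p : ℚ), 0; N * M * (y : ℕ), 1].det : ℚ) : ℂ) ^ (-k) *
      expRat ((t * (!![(p : ℚ), N * M * (y : ℕ); 0, 1] * !![0, 0; 0, 0])).trace / (p ^ 2 : ℕ)) *
      fourierCoeff N f ((1 / (p ^ 2 : ℕ) : ℚ) • act t !![(p : ℚ), N * M * (y : ℕ); 0, 1]) =
      (p : ℂ) ^ (3 * k - 6) *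
        fourierCoeff N f (act t !![1, (N * M * (y : ℕ) / p : ℚ); 0, 1 / p]) := by
    intro y
    rw [sq_zpow_mul_det_zpow hp (j := 1) (by rw [det_fin_two_of, zpow_one]; ring),
      smul_act_eq (v := !![1, (N * M * (y : ℕ) / p : ℚ); 0, 1 / p]) hp (by
        rw [smul_fin_two]
        exact fin_two_congr (by ring) (by field_simp) (by ring) (by field_simp)), ht,
      trace_indexMatrix_mul, expRat_eq_one 0 (by simp), mul_one,
      show 4 * k - 6 - 1 * k = 3 * k - 6 by ring]
  have e₃ : ∀ (y : Fin p) (l : Fin (p - 1)), ((p ^ 2 : ℕ) : ℂ) ^ (2 * k - 3) *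
      ((!![p + c * (N + N * M * (y : ℕ) : ℚ), c; p * (N + N * M * (y : ℕ)), p].det : ℚ) : ℂ) ^ (-k) *
      expRat ((t * (!![p + c * (N + N * M * (y : ℕ) : ℚ), p * (N + N * M * (y : ℕ)); c, p] *
        !![((l : ℕ) + 1) * (N + N * M * (y : ℕ) : ℚ), (l : ℕ) + 1;
          ((l : ℕ) + 1) * (1 + c * (N + N * M * (y : ℕ)) / p), ((l : ℕ) + 1) * (c / p)])).trace /
            (p ^ 2 : ℕ)) *
      fourierCoeff N f ((1 / (p ^ 2 : ℕ) : ℚ) •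
        act t !![p + c * (N + N * M * (y : ℕ) : ℚ), p * (N + N * M * (y : ℕ)); c, p]) =
      (p : ℂ) ^ (2 * k - 6) * (expRat ((((l : ℕ) : ℚ) + 1) *
        (r * (1 + 2 * c * q + 2 * c * (y : ℕ)) + 2 * m * q * c : ℤ) / p) * fourierCoeff N f
          (act t !![((c * N + p + c * N * M * (y : ℕ)) / p : ℚ), N + N * M * (y : ℕ); c / p, 1])) := by
    intro y l
    rw [sq_zpow_mul_det_zpow hp (j := 2) (by rw [det_fin_two_of, zpow_two]; ring),
      smul_act_eq (v := !![((c * N + p + c * N * M * (y : ℕ)) / p : ℚ), N + N * M * (y : ℕ);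
          c / p, 1]) hp (by
        rw [smul_fin_two]
        exact fin_two_congr (by field_simp; ring) (by ring) (by field_simp) (by ring)),
      show 4 * k - 6 - 2 * k = 2 * k - 6 by ring, mul_assoc]
    congr 2
    refine expRat_eq_of_sub_eq (((l : ℕ) + 1) * (2 * n * q * (1 + M * (y : ℕ)) *
      (1 + c * q * (1 + M * (y : ℕ))) + 2 * r * c * (y : ℕ) * w)) ?_
    rw [ht, trace_indexMatrix_mul]
    push_cast
    rw [h3]
    field_simp
    linear_combination 4 * ((y : ℕ) : ℚ) * c * r * h4
  have e₄ : ∀ (y : Fin p) (l : Fin (p - 1)) (x : Fin p), ((p ^ 2 : ℕ) : ℂ) ^ (2 * k - 3) *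
      ((!![p + (x : ℕ) * (N * M * (y : ℕ) : ℚ), (x : ℕ); p * (N * M * (y : ℕ)), p].det : ℚ) : ℂ)
        ^ (-k) *
      expRat ((t * (!![p + (x : ℕ) * (N * M * (y : ℕ) : ℚ), p * (N * M * (y : ℕ)); (x : ℕ), p] *
        !![0, 0; ((l : ℕ) + 1) * (M * (y : ℕ) : ℚ), ((l : ℕ) + 1) / N])).trace / (p ^ 2 : ℕ)) *
      fourierCoeff N f ((1 / (p ^ 2 : ℕ) : ℚ) •
        act t !![p + (x : ℕ) * (N * M * (y : ℕ) : ℚ), p * (N * M * (y : ℕ)); (x : ℕ), p]) =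
      (p : ℂ) ^ (2 * k - 6) * (expRat ((((l : ℕ) : ℚ) + 1) * (r * M * (y : ℕ) + m : ℤ) / p) *
        fourierCoeff N f (act t !![(1 + N * M * (x : ℕ) * (y : ℕ) / p : ℚ), N * M * (y : ℕ);
          (x : ℕ) / p, 1])) := by
    intro y l x
    rw [sq_zpow_mul_det_zpow hp (j := 2) (by rw [det_fin_two_of, zpow_two]; ring),
      smul_act_eq (v := !![(1 + N * M * (x : ℕ) * (y : ℕ) / p : ℚ), N * M * (y : ℕ);
          (x : ℕ) / p, 1]) hp (by
        rw [smul_fin_two]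
        exact fin_two_congr (by field_simp) (by ring) (by field_simp) (by ring)),
      show 4 * k - 6 - 2 * k = 2 * k - 6 by ring, mul_assoc]
    congr 2
    refine expRat_eq_of_sub_eq (((l : ℕ) + 1) * (n * q * M ^ 2 * (y : ℕ) ^ 2)) ?_
    rw [ht, trace_indexMatrix_mul]
    push_cast
    rw [h3]
    field_simp
    ring
  simp only [e₁, e₂, e₃, e₄]
  have s₄ : ∀ y : Fin p, ∑ l : Fin (p - 1), ∑ x : Fin p, (p : ℂ) ^ (2 * k - 6) *
      (expRat ((((l : ℕ) : ℚ) + 1) * (r * M * (y : ℕ) + m : ℤ) / p) *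
        fourierCoeff N f (act t !![(1 + N * M * (x : ℕ) * (y : ℕ) / p : ℚ), N * M * (y : ℕ);
          (x : ℕ) / p, 1])) = ∑ x : Fin p, (p : ℂ) ^ (2 * k - 6) *
      (charSum p (r * M * (y : ℕ) + m : ℤ) *
        fourierCoeff N f (act t !![(1 + N * M * (x : ℕ) * (y : ℕ) / p : ℚ), N * M * (y : ℕ);
          (x : ℕ) / p, 1])) := by
    intro y
    rw [Finset.sum_comm]
    simp only [← Finset.mul_sum, ← Finset.sum_mul, sum_expRat_eq_charSum hp]
  simp only [s₄]
  rw [Finset.sum_comm (s := (Finset.univ : Finset (Fin p))) (t := (Finset.univ : Finset (Fin p)))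
    (f := fun y x => (p : ℂ) ^ (2 * k - 6) * (charSum p (r * M * (y : ℕ) + m : ℤ) *
        fourierCoeff N f (act t !![(1 + N * M * (x : ℕ) * (y : ℕ) / p : ℚ), N * M * (y : ℕ);
          (x : ℕ) / p, 1])))]
  simp only [← Finset.mul_sum, ← Finset.sum_mul, sum_expRat_eq_charSum hp, Finset.sum_const,
    Finset.card_univ, Fintype.card_fin, nsmul_eq_mul]
  have a₃ : ∀ y : ℕ, (2 * t 0 1 * (1 + 2 * c * N / p + 2 * c * y) + 2 * t 1 1 * c / p : ℚ) =
      (r * (1 + 2 * c * q + 2 * c * y) + 2 * m * q * c : ℤ) := by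
    intro y
    rw [hr, hm, h3]; push_cast; field_simp
  have a₄ : ∀ y : ℕ, (2 * t 0 1 * M * y + t 1 1 / N : ℚ) = (r * M * y + m : ℤ) := by
    intro y
    rw [hr, hm]; push_cast; field_simp
  simp only [a₃, a₄, Finset.sum_range]
  have z1 : (p : ℂ) ^ (k - 3) = p * ((p ^ 2 : ℕ) * (p : ℂ) ^ (k - 6)) := by
    rw [Nat.cast_pow, pow_two, mul_assoc, ← zpow_one_add₀ hpC, ← zpow_one_add₀ hpC,
      ← zpow_one_add₀ hpC]; congr 1; ring
  rw [z1]
  ring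

end Formulas

/-! ### The Fourier coefficients of `f | T` at a prime not dividing the level -/

section GoodFormulas

variable {k : ℤ} {N p : ℕ} {f : Siegel → ℂ}

/-- The Fourier coefficients of `f | T(p)` for `p ∤ N`. -/
theorem fourierCoeff_deltaT_of_not_dvd (hN : 0 < N) (hp : p.Prime) (hpN : ¬ p ∣ N)
    (hf : IsCuspForm k N f) {n r m : ℤ} {t : Mat2} (ht : t = indexMatrix N n r m) :
    fourierCoeff N (heckeOp k N (deltaT p) f) t =
      fourierCoeff N f ((p : ℚ) • t)
      + (p : ℂ) ^ (k - 2) * ∑ x ∈ Finset.range p,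
          fourierCoeff N f ((1 / p : ℚ) • act t !![1, 0; -(x : ℚ), p])
      + (p : ℂ) ^ (k - 2) * fourierCoeff N f ((1 / p : ℚ) • act t !![(p : ℚ), 0; 0, 1])
      + (p : ℂ) ^ (2 * k - 3) * fourierCoeff N f ((1 / p : ℚ) • t) := by
  have hN0 : (N : ℚ) ≠ 0 := by exact_mod_cast hN.ne'
  have hp0 : (p : ℚ) ≠ 0 := by exact_mod_cast hp.ne_zero
  have hpC : (p : ℂ) ≠ 0 := by exact_mod_cast hp.ne_zero
  obtain ⟨hrep, hint⟩ := isRepSystem_repGoodT hN hp hpN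
  rw [fourierCoeff_heckeOp hN (isSimilitude_deltaT hp) hrep hint hf t]
  simp only [Fintype.sum_sum_type, Fintype.sum_prod_type, repGoodT, transpose_fin_two]
  -- all exponentials are `1`
  have e₁ : ∀ b₁ b₂ b₃ : Fin p, (p : ℂ) ^ (2 * k - 3) *
      ((!![(p : ℚ), 0; 0, p].det : ℚ) : ℂ) ^ (-k) *
      expRat ((t * (!![(p : ℚ), 0; 0, p] *
        !![((b₁ : ℕ) : ℚ), (b₂ : ℕ); (b₂ : ℕ), (b₃ : ℕ) / (N : ℚ)])).trace / (p : ℕ)) *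
      fourierCoeff N f ((1 / (p : ℕ) : ℚ) • act t !![(p : ℚ), 0; 0, p]) =
      (p : ℂ) ^ (-3 : ℤ) * fourierCoeff N f ((p : ℚ) • t) := by
    intro b₁ b₂ b₃
    rw [zpow_mul_det_zpow hp (j := 2) _ (by rw [det_fin_two_of, zpow_two]; ring),
      smul_act_scalar hp, ht, trace_indexMatrix_mul,
      expRat_eq_one (n * (b₁ : ℕ) + r * (b₂ : ℕ) + m * (b₃ : ℕ))
      (by push_cast; field_simp; ring), mul_one, show 2 * k - 3 - 2 * k = -3 by ring]
  have e₂ : ∀ x b₃ : Fin p, (p : ℂ) ^ (2 * k - 3) *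
      ((!![1, -((x : ℕ) : ℚ); 0, p].det : ℚ) : ℂ) ^ (-k) *
      expRat ((t * (!![1, 0; -((x : ℕ) : ℚ), p] *
        !![0, 0; 0, (b₃ : ℕ) / (N : ℚ)])).trace / (p : ℕ)) *
      fourierCoeff N f ((1 / (p : ℕ) : ℚ) • act t !![1, 0; -((x : ℕ) : ℚ), p]) =
      (p : ℂ) ^ (k - 3) * fourierCoeff N f ((1 / p : ℚ) • act t !![1, 0; -((x : ℕ) : ℚ), p]) := by
    intro x b₃
    rw [zpow_mul_det_zpow hp (j := 1) _ (by rw [det_fin_two_of, zpow_one]; ring), ht,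
      trace_indexMatrix_mul, expRat_eq_one (m * (b₃ : ℕ))
      (by push_cast; field_simp; ring), mul_one, show 2 * k - 3 - 1 * k = k - 3 by ring]
  have e₃ : ∀ b₁ : Fin p, (p : ℂ) ^ (2 * k - 3) *
      ((!![(p : ℚ), 0; 0, 1].det : ℚ) : ℂ) ^ (-k) *
      expRat ((t * (!![(p : ℚ), 0; 0, 1] * !![((b₁ : ℕ) : ℚ), 0; 0, 0])).trace / (p : ℕ)) *
      fourierCoeff N f ((1 / (p : ℕ) : ℚ) • act t !![(p : ℚ), 0; 0, 1]) =
      (p : ℂ) ^ (k - 3) * fourierCoeff N f ((1 / p : ℚ) • act t !![(p : ℚ), 0; 0, 1]) := by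
    intro b₁
    rw [zpow_mul_det_zpow hp (j := 1) _ (by rw [det_fin_two_of, zpow_one]; ring), ht,
      trace_indexMatrix_mul, expRat_eq_one (n * (b₁ : ℕ))
      (by push_cast; field_simp; ring), mul_one, show 2 * k - 3 - 1 * k = k - 3 by ring]
  have e₄ : (p : ℂ) ^ (2 * k - 3) * ((!![(1 : ℚ), 0; 0, 1].det : ℚ) : ℂ) ^ (-k) *
      expRat ((t * (!![(1 : ℚ), 0; 0, 1] * !![0, 0; 0, 0])).trace / (p : ℕ)) *
      fourierCoeff N f ((1 / (p : ℕ) : ℚ) • act t !![1, 0; 0, 1]) =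
      (p : ℂ) ^ (2 * k - 3) * fourierCoeff N f ((1 / p : ℚ) • t) := by
    rw [zpow_mul_det_zpow hp (j := 0) _ (by rw [det_fin_two_of, zpow_zero]; ring), act_one, ht,
      trace_indexMatrix_mul, expRat_eq_one 0 (by simp), mul_one,
      show 2 * k - 3 - 0 * k = 2 * k - 3 by ring]
  simp only [e₁, e₂, e₃, e₄, Finset.sum_const,
    Finset.card_univ, Fintype.card_fin, nsmul_eq_mul, Fintype.univ_unit, Finset.card_singleton,
    ← Finset.mul_sum, Finset.sum_range]
  have z1 : (p : ℂ) ^ (k - 2) = p * (p : ℂ) ^ (k - 3) := by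
    rw [← zpow_one_add₀ hpC]; congr 1; ring
  have z2 : (p : ℂ) * (p * (p * (p : ℂ) ^ (-3 : ℤ))) = 1 := by
    rw [← zpow_one_add₀ hpC, ← zpow_one_add₀ hpC, ← zpow_one_add₀ hpC]; norm_num
  rw [z1]
  linear_combination fourierCoeff N f ((p : ℚ) • t) * z2

/-- The Fourier coefficients of `f | T₁(p²)` for `p ∤ N`. -/
theorem fourierCoeff_deltaT1 (hN : 0 < N) (hp : p.Prime) {ε β : ℤ} (hε : p ^ 2 * ε - N * β = 1)
    (hf : IsCuspForm k N f) {n r m : ℤ} {t : Mat2} (ht : t = indexMatrix N n r m) :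
    fourierCoeff N (heckeOp k N (deltaT1 p) f) t =
      (p : ℂ) ^ (k - 3) * ∑ y ∈ Finset.range p,
          fourierCoeff N f (act t !![(p : ℚ), -(N * y); 0, 1])
      + (p : ℂ) ^ (k - 3) * fourierCoeff N f (act t !![1, 0; 0, (p : ℚ)])
      + (p : ℂ) ^ (3 * k - 6) * ∑ x ∈ Finset.range p,
          fourierCoeff N f (act t !![(1 / p : ℚ), 0; -(x / p), 1])
      + (p : ℂ) ^ (2 * k - 6) * ∑ x ∈ Finset.range p,
          charSum p (n - r * x + m * N * x ^ 2 : ℤ) *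
          fourierCoeff N f (act t !![1, 0; -(x : ℚ), 1])
      + (p : ℂ) ^ (3 * k - 6) *
          fourierCoeff N f (act t !![1, -(N * β : ℚ); -(1 / p), p * ε])
      + (p : ℂ) ^ (2 * k - 6) * (charSum p (p ^ 2 * n - p * r + m * N : ℤ) *
          fourierCoeff N f (act t !![(p : ℚ), -(N * β); -1, p * ε])) := by
  have hN0 : (N : ℚ) ≠ 0 := by exact_mod_cast hN.ne'
  have hp0 : (p : ℚ) ≠ 0 := by exact_mod_cast hp.ne_zero
  have hpC : (p : ℂ) ≠ 0 := by exact_mod_cast hp.ne_zero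
  have h1 : (p ^ 2 * ε - N * β : ℚ) = 1 := by exact_mod_cast hε
  obtain ⟨hrep, hint⟩ := isRepSystem_repT1 hN hp hε
  rw [fourierCoeff_heckeOp hN (isSimilitude_deltaT1 hp) hrep hint hf t]
  simp only [Fintype.sum_sum_type, Fintype.sum_prod_type, repT1, transpose_fin_two]
  -- the exponential is `1`, except for the families with a parameter `l`, where it gives `charSum`
  have e₁ : ∀ (y b₂ : Fin p) (b₁ : Fin (p ^ 2)), ((p ^ 2 : ℕ) : ℂ) ^ (2 * k - 3) *
      ((!![(p : ℚ) ^ 2, 0; -(p * (N * (y : ℕ))), p].det : ℚ) : ℂ) ^ (-k) *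
      expRat ((t * (!![(p : ℚ) ^ 2, -(p * (N * (y : ℕ))); 0, p] *
        !![((b₁ : ℕ) - N * (y : ℕ) * (b₂ : ℕ) : ℚ), (b₂ : ℕ); p * (b₂ : ℕ), 0])).trace /
          (p ^ 2 : ℕ)) *
      fourierCoeff N f ((1 / (p ^ 2 : ℕ) : ℚ) • act t !![(p : ℚ) ^ 2, -(p * (N * (y : ℕ))); 0, p]) =
      (p : ℂ) ^ (k - 6) * fourierCoeff N f (act t !![(p : ℚ), -(N * (y : ℕ)); 0, 1]) := by
    intro y b₂ b₁
    rw [sq_zpow_mul_det_zpow hp (j := 3) (by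
        rw [det_fin_two_of, show (3 : ℤ) = (3 : ℕ) from rfl, zpow_natCast]; ring),
      smul_act_eq (v := !![(p : ℚ), -(N * (y : ℕ)); 0, 1]) hp (by
        rw [smul_fin_two]
        exact fin_two_congr (by ring) (by ring) (by ring) (by ring)), ht,
      trace_indexMatrix_mul,
      expRat_eq_one (n * ((b₁ : ℕ) - 2 * N * (y : ℕ) * (b₂ : ℕ)) + r * (b₂ : ℕ))
      (by push_cast; field_simp; ring), mul_one, show 4 * k - 6 - 3 * k = k - 6 by ring]
  have e₂ : ∀ (b₂ : Fin p) (b₃ : Fin (p ^ 2)), ((p ^ 2 : ℕ) : ℂ) ^ (2 * k - 3) *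
      ((!![(p : ℚ), 0; 0, p ^ 2].det : ℚ) : ℂ) ^ (-k) *
      expRat ((t * (!![(p : ℚ), 0; 0, p ^ 2] *
        !![0, p * ((b₂ : ℕ) : ℚ); (b₂ : ℕ), (b₃ : ℕ) / (N : ℚ)])).trace / (p ^ 2 : ℕ)) *
      fourierCoeff N f ((1 / (p ^ 2 : ℕ) : ℚ) • act t !![(p : ℚ), 0; 0, p ^ 2]) =
      (p : ℂ) ^ (k - 6) * fourierCoeff N f (act t !![1, 0; 0, (p : ℚ)]) := by
    intro b₂ b₃
    rw [sq_zpow_mul_det_zpow hp (j := 3) (by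
        rw [det_fin_two_of, show (3 : ℤ) = (3 : ℕ) from rfl, zpow_natCast]; ring),
      smul_act_eq (v := !![1, 0; 0, (p : ℚ)]) hp (by
        rw [smul_fin_two]
        exact fin_two_congr (by ring) (by ring) (by ring) (by ring)), ht,
      trace_indexMatrix_mul, expRat_eq_one (r * (b₂ : ℕ) + m * (b₃ : ℕ))
      (by push_cast; field_simp; ring), mul_one, show 4 * k - 6 - 3 * k = k - 6 by ring]
  have e₃ : ∀ x : Fin p, ((p ^ 2 : ℕ) : ℂ) ^ (2 * k - 3) *
      ((!![1, -((x : ℕ) : ℚ); 0, p].det : ℚ) : ℂ) ^ (-k) *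
      expRat ((t * (!![1, 0; -((x : ℕ) : ℚ), p] * !![0, 0; 0, 0])).trace / (p ^ 2 : ℕ)) *
      fourierCoeff N f ((1 / (p ^ 2 : ℕ) : ℚ) • act t !![1, 0; -((x : ℕ) : ℚ), p]) =
      (p : ℂ) ^ (3 * k - 6) *
        fourierCoeff N f (act t !![(1 / p : ℚ), 0; -(((x : ℕ) : ℚ) / p), 1]) := by
    intro x
    rw [sq_zpow_mul_det_zpow hp (j := 1) (by rw [det_fin_two_of, zpow_one]; ring),
      smul_act_eq (v := !![(1 / p : ℚ), 0; -(((x : ℕ) : ℚ) / p), 1]) hp (by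
        rw [smul_fin_two]
        exact fin_two_congr (by field_simp) (by ring) (by field_simp) (by ring)), ht,
      trace_indexMatrix_mul, expRat_eq_one 0 (by simp), mul_one,
      show 4 * k - 6 - 1 * k = 3 * k - 6 by ring]
  have e₄ : ∀ (x : Fin p) (l : Fin (p - 1)), ((p ^ 2 : ℕ) : ℂ) ^ (2 * k - 3) *
      ((!![(p : ℚ), -(p * (x : ℕ)); 0, p].det : ℚ) : ℂ) ^ (-k) *
      expRat ((t * (!![(p : ℚ), 0; -(p * (x : ℕ)), p] *
        !![((l : ℕ) : ℚ) + 1, -(((l : ℕ) + 1) * ((x : ℕ) : ℚ)); 0, 0])).trace / (p ^ 2 : ℕ)) *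
      fourierCoeff N f ((1 / (p ^ 2 : ℕ) : ℚ) • act t !![(p : ℚ), 0; -(p * (x : ℕ)), p]) =
      (p : ℂ) ^ (2 * k - 6) * (expRat ((((l : ℕ) : ℚ) + 1) *
        (n - r * (x : ℕ) + m * N * (x : ℕ) ^ 2 : ℤ) / p) *
          fourierCoeff N f (act t !![1, 0; -((x : ℕ) : ℚ), 1])) := by
    intro x l
    rw [sq_zpow_mul_det_zpow hp (j := 2) (by rw [det_fin_two_of, zpow_two]; ring),
      smul_act_eq (v := !![1, 0; -((x : ℕ) : ℚ), 1]) hp (by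
        rw [smul_fin_two]
        exact fin_two_congr (by ring) (by ring) (by ring) (by ring)),
      show 4 * k - 6 - 2 * k = 2 * k - 6 by ring, mul_assoc]
    congr 2
    refine expRat_eq_of_sub_eq 0 ?_
    rw [ht, trace_indexMatrix_mul]
    push_cast
    field_simp
    ring
  have e₅ : ((p ^ 2 : ℕ) : ℂ) ^ (2 * k - 3) *
      ((!![(p : ℚ), -1; -(p * (N * β)), p * (p * ε)].det : ℚ) : ℂ) ^ (-k) *
      expRat ((t * (!![(p : ℚ), -(p * (N * β)); -1, p * (p * ε)] * !![0, 0; 0, 0])).trace /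
        (p ^ 2 : ℕ)) *
      fourierCoeff N f ((1 / (p ^ 2 : ℕ) : ℚ) •
        act t !![(p : ℚ), -(p * (N * β)); -1, p * (p * ε)]) =
      (p : ℂ) ^ (3 * k - 6) *
        fourierCoeff N f (act t !![1, -(N * β : ℚ); -(1 / p), p * ε]) := by
    rw [sq_zpow_mul_det_zpow hp (j := 1) (by
        rw [det_fin_two_of, zpow_one]; linear_combination (p : ℚ) * h1),
      smul_act_eq (v := !![1, -(N * β : ℚ); -(1 / p), p * ε]) hp (by
        rw [smul_fin_two]
        exact fin_two_congr (by ring) (by ring) (by field_simp) (by ring)), ht,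
      trace_indexMatrix_mul, expRat_eq_one 0 (by simp), mul_one,
      show 4 * k - 6 - 1 * k = 3 * k - 6 by ring]
  have e₆ : ∀ l : Fin (p - 1), ((p ^ 2 : ℕ) : ℂ) ^ (2 * k - 3) *
      ((!![(p : ℚ) ^ 2, -p; -(p * (N * β)), p * (p * ε)].det : ℚ) : ℂ) ^ (-k) *
      expRat ((t * (!![(p : ℚ) ^ 2, -(p * (N * β)); -p, p * (p * ε)] *
        !![((l : ℕ) + 1) * (p : ℚ), -((l : ℕ) + 1); 0, 0])).trace / (p ^ 2 : ℕ)) *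
      fourierCoeff N f ((1 / (p ^ 2 : ℕ) : ℚ) •
        act t !![(p : ℚ) ^ 2, -(p * (N * β)); -p, p * (p * ε)]) =
      (p : ℂ) ^ (2 * k - 6) * (expRat ((((l : ℕ) : ℚ) + 1) *
        (p ^ 2 * n - p * r + m * N : ℤ) / p) *
          fourierCoeff N f (act t !![(p : ℚ), -(N * β); -1, p * ε])) := by
    intro l
    rw [sq_zpow_mul_det_zpow hp (j := 2) (by
        rw [det_fin_two_of, zpow_two]; linear_combination (p : ℚ) * p * h1),
      smul_act_eq (v := !![(p : ℚ), -(N * β); -1, p * ε]) hp (by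
        rw [smul_fin_two]
        exact fin_two_congr (by ring) (by ring) (by ring) (by ring)),
      show 4 * k - 6 - 2 * k = 2 * k - 6 by ring, mul_assoc]
    congr 2
    refine expRat_eq_of_sub_eq 0 ?_
    rw [ht, trace_indexMatrix_mul]
    push_cast
    field_simp
    ring
  simp only [e₁, e₂, e₃, e₄, e₅, e₆, ← Finset.mul_sum, ← Finset.sum_mul, sum_expRat_eq_charSum hp,
    Finset.sum_const, Finset.card_univ, Fintype.card_fin, nsmul_eq_mul, Fintype.univ_unit,
    Finset.card_singleton, Finset.sum_range]
  have z1 : (p : ℂ) ^ (k - 3) = p * ((p ^ 2 : ℕ) * (p : ℂ) ^ (k - 6)) := by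
    rw [Nat.cast_pow, pow_two, mul_assoc, ← zpow_one_add₀ hpC, ← zpow_one_add₀ hpC,
      ← zpow_one_add₀ hpC]; congr 1; ring
  rw [z1]
  push_cast
  ring

end GoodFormulas

/-! ### Integral linear combinations of Fourier coefficients -/

section IntComb

variable {k : ℤ} {N p : ℕ}

/-- `Φ f` is a finite integral linear combination of the Fourier coefficients of `f`, the same
one for all cusp forms `f`. -/
def IsIntComb (k : ℤ) (N : ℕ) (Φ : (Siegel → ℂ) → ℂ) : Prop :=
  ∃ c : indexSemi N →₀ ℤ, ∀ f, IsCuspForm k N f →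
    Φ f = c.sum fun s n => (n : ℂ) * fourierCoeff N f s

variable {Φ Ψ : (Siegel → ℂ) → ℂ}

lemma IsIntComb.congr (hΨ : IsIntComb k N Ψ) (h : ∀ f, IsCuspForm k N f → Φ f = Ψ f) :
    IsIntComb k N Φ :=
  hΨ.imp fun _ hc f hf => (h f hf).trans (hc f hf)

lemma IsIntComb.zero : IsIntComb k N fun _ => 0 := ⟨0, by simp⟩

/-- The index `t` may be any rational matrix: the coefficient is `0` outside `indexSemi N`. -/
lemma IsIntComb.eval (hN : 0 < N) (t : Mat2) : IsIntComb k N fun f => fourierCoeff N f t := by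
  classical
  by_cases ht : t ∈ indexSemi N
  · exact ⟨Finsupp.single ⟨t, ht⟩ 1, fun f _ => by simp⟩
  · exact ⟨0, fun f hf => by
      simp [(isFourierExpansion_fourierCoeff hN hf.toIsParamodularForm).support t ht]⟩

lemma IsIntComb.add (hΦ : IsIntComb k N Φ) (hΨ : IsIntComb k N Ψ) :
    IsIntComb k N fun f => Φ f + Ψ f := by
  classical
  obtain ⟨c, hc⟩ := hΦ
  obtain ⟨d, hd⟩ := hΨ
  refine ⟨c + d, fun f hf => ?_⟩
  rw [Finsupp.sum_add_index' (by simp) (by intros; push_cast; ring), ← hc f hf, ← hd f hf]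

lemma IsIntComb.mul_left {z : ℂ} (hz : ∃ j : ℤ, z = j) (hΦ : IsIntComb k N Φ) :
    IsIntComb k N fun f => z * Φ f := by
  obtain ⟨c, hc⟩ := hΦ
  obtain ⟨j, rfl⟩ := hz
  refine ⟨j • c, fun f hf => ?_⟩
  rw [Finsupp.sum_smul_index' (by simp)]
  simp only [hc f hf, Finsupp.mul_sum]
  exact Finsupp.sum_congr fun s _ => by rw [smul_eq_mul]; push_cast; ring

lemma IsIntComb.sum {ι : Type*} (s : Finset ι) {Φ : ι → (Siegel → ℂ) → ℂ}
    (h : ∀ i, IsIntComb k N (Φ i)) : IsIntComb k N fun f => ∑ i ∈ s, Φ i f := by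
  classical
  induction s using Finset.induction_on with
  | empty => simpa using IsIntComb.zero
  | insert i s hi ih => simpa only [Finset.sum_insert hi] using (h i).add ih

lemma exists_zpow_eq_intCast (p : ℕ) {j : ℤ} (hj : 0 ≤ j) : ∃ z : ℤ, (p : ℂ) ^ j = z := by
  lift j to ℕ using hj
  exact ⟨p ^ j, by simp⟩

lemma exists_charSum_eq_intCast (p : ℕ) (x : ℚ) : ∃ z : ℤ, charSum p x = z := by
  rw [charSum]
  split_ifs
  · exact ⟨p - 1, by simp⟩
  · exact ⟨-1, by simp⟩

lemma exists_finsupp_of_isIntComb {δ : Mat4}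
    (hδ : ∀ f, IsCuspForm k N f → IsCuspForm k N (heckeOp k N δ f))
    (h : ∀ n r m : ℤ, IsIntComb k N fun f => fourierCoeff N (heckeOp k N δ f) (indexMatrix N n r m)) :
    ∃ c : indexSemi N → (indexSemi N →₀ ℤ), ∀ f, IsCuspForm k N f →
      IsCuspForm k N (heckeOp k N δ f) ∧
      ∀ t : indexSemi N, fourierCoeff N (heckeOp k N δ f) t =
        (c t).sum fun s n => (n : ℂ) * fourierCoeff N f s := by
  have h' : ∀ t : indexSemi N, IsIntComb k N fun f => fourierCoeff N (heckeOp k N δ f) t := by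
    rintro ⟨_, n, r, m, -, -, -, rfl⟩
    exact h n r m
  choose c hc using h'
  exact ⟨c, fun f hf => ⟨hδ f hf, fun t => hc t f hf⟩⟩

end IntComb

end Paramodular

theorem lemma4p4 (k : ℤ) (hk : 0 ≤ k) (N p : ℕ) (hN : 0 < N) (hp : p.Prime) :
    -- cusp forms have a Fourier expansion, and only one
    (∀ f, IsCuspForm k N f → ∃! a, IsFourierExpansion N f a) ∧
    -- the Fourier coefficients of `f | T` are fixed integral combinations of those of `f`
    (3 ≤ k → ∀ δ : Mat4,
      (¬ p ∣ N ∧ (δ = deltaT p ∨ δ = deltaT1 p)) ∨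
        (p ∣ N ∧ ¬ p ^ 2 ∣ N ∧ (δ = deltaT p ∨ δ = deltaT0 p)) →
      ∃ c : indexSemi N → (indexSemi N →₀ ℤ), ∀ f, IsCuspForm k N f →
        IsCuspForm k N (heckeOp k N δ f) ∧
        ∀ t : indexSemi N, fourierCoeff N (heckeOp k N δ f) t =
          (c t).sum fun s n => (n : ℂ) * fourierCoeff N f s) ∧
    -- explicit formulas when `p` divides `N` exactly once
    (p ∣ N → ¬ p ^ 2 ∣ N → ∀ M a c : ℤ,
      M * ((N / p : ℕ) : ℤ) ≡ 1 [ZMOD p] → a * p - c * ((N / p : ℕ) : ℤ) = 1 →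
      ∀ f, IsCuspForm k N f → ∀ t ∈ indexPos N,
        IsCuspForm k N (heckeOp k N (deltaT p) f) ∧
        IsCuspForm k N (heckeOp k N (deltaT0 p) f) ∧
        fourierCoeff N (heckeOp k N (deltaT p) f) t =
          fourierCoeff N f ((p : ℚ) • t)
          + (p : ℂ) ^ (k - 2) * ∑ x ∈ Finset.range p,
              fourierCoeff N f ((1 / p : ℚ) • act t !![1, 0; -(x : ℚ), p])
          + (p : ℂ) ^ (k - 2) * ∑ y ∈ Finset.range p,
              fourierCoeff N f ((1 / p : ℚ) • act t !![(p : ℚ), N * M * y; 0, 1])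
          + (p : ℂ) ^ (2 * k - 3) * fourierCoeff N f ((1 / p : ℚ) • t)
          + (p : ℂ) ^ (k - 3) * charSum p (2 * t 0 1) *
              fourierCoeff N f ((1 / p : ℚ) • act t !![(a * p : ℚ), N; c, p]) ∧
        fourierCoeff N (heckeOp k N (deltaT0 p) f) t =
          (p : ℂ) ^ (k - 3) * ∑ x ∈ Finset.range p,
              fourierCoeff N f (act t !![1, 0; -(x : ℚ), p])
          + (p : ℂ) ^ (3 * k - 6) * ∑ y ∈ Finset.range p,
              fourierCoeff N f (act t !![1, (N * M * y / p : ℚ); 0, 1 / p])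
          + (p : ℂ) ^ (2 * k - 6) * ∑ y ∈ Finset.range p,
              charSum p (2 * t 0 1 * (1 + 2 * c * N / p + 2 * c * y) + 2 * t 1 1 * c / p) *
              fourierCoeff N f
                (act t !![((c * N + p + c * N * M * y) / p : ℚ), N + N * M * y; c / p, 1])
          + (p : ℂ) ^ (2 * k - 6) * ∑ x ∈ Finset.range p, ∑ y ∈ Finset.range p,
              charSum p (2 * t 0 1 * M * y + t 1 1 / N) *
              fourierCoeff N f
                (act t !![(1 + N * M * x * y / p : ℚ), N * M * y; x / p, 1])) := by
  -- the cofactor `N / p` is prime to `p` when `p` divides `N` exactly once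
  have hcofactor : p ∣ N → ¬ p ^ 2 ∣ N → N = p * (N / p) ∧ ¬ (p : ℤ) ∣ ((N / p : ℕ) : ℤ) :=
    fun h1 h2 => ⟨(Nat.mul_div_cancel' h1).symm, fun h => h2 (by
      rw [pow_two]; exact (Nat.dvd_div_iff_mul_dvd h1).1 (by exact_mod_cast h))⟩
  have hunit : ∀ {M q : ℤ}, M * q ≡ 1 [ZMOD p] → ¬ (p : ℤ) ∣ M := fun {M q} h hM =>
    (Nat.prime_iff_prime_int.1 hp).not_isUnit (isUnit_of_dvd_one
      ((Int.ModEq.dvd_iff h).1 (hM.mul_right q)))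
  refine ⟨fun f hf => ?_, fun hk3 δ hδ => ?_, fun hpN hp2 M a c hM hac f hf t ht => ?_⟩
  · have h := isFourierExpansion_fourierCoeff hN hf.toIsParamodularForm
    refine ⟨_, h, fun b hb => hb.hasExpansion.unique h.hasExpansion⟩
  · have hz : ∀ {j : ℤ}, 0 ≤ j → ∃ z : ℤ, (p : ℂ) ^ j = z := exists_zpow_eq_intCast p
    have hχ : ∀ x, ∃ z : ℤ, charSum p x = z := exists_charSum_eq_intCast p
    have he : ∀ t, IsIntComb k N fun f => fourierCoeff N f t := IsIntComb.eval hN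
    rcases hδ with ⟨hpN, rfl | rfl⟩ | ⟨hpN, hp2, hδ⟩
    · obtain ⟨hrep, -⟩ := isRepSystem_repGoodT hN hp hpN
      refine exists_finsupp_of_isIntComb
        (fun f hf => isCuspForm_heckeOp hN (isSimilitude_deltaT hp) hrep hf) fun n r m =>
          .congr ?_ fun f hf => fourierCoeff_deltaT_of_not_dvd hN hp hpN hf rfl
      exact (((he _).add ((IsIntComb.sum _ fun x => he _).mul_left (hz (by lia)))).add
        ((he _).mul_left (hz (by lia)))).add ((he _).mul_left (hz (by lia)))
    · obtain ⟨ε, β, hεβ⟩ : IsCoprime ((p : ℤ) ^ 2) (N : ℤ) :=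
        (Nat.isCoprime_iff_coprime.2 ((Nat.Prime.coprime_iff_not_dvd hp).2 hpN)).pow_left
      have hε : (p : ℤ) ^ 2 * ε - N * (-β) = 1 := by linear_combination hεβ
      obtain ⟨hrep, -⟩ := isRepSystem_repT1 hN hp hε
      refine exists_finsupp_of_isIntComb
        (fun f hf => isCuspForm_heckeOp hN (isSimilitude_deltaT1 hp) hrep hf) fun n r m =>
          .congr ?_ fun f hf => fourierCoeff_deltaT1 hN hp hε hf rfl
      exact ((((((IsIntComb.sum _ fun y => he _).mul_left (hz (by lia))).add
        ((he _).mul_left (hz (by lia)))).add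
        ((IsIntComb.sum _ fun x => he _).mul_left (hz (by lia)))).add
        ((IsIntComb.sum _ fun x => (he _).mul_left (hχ _)).mul_left (hz (by lia)))).add
        ((he _).mul_left (hz (by lia)))).add (((he _).mul_left (hχ _)).mul_left (hz (by lia)))
    · obtain ⟨hq, hq₁⟩ := hcofactor hpN hp2
      -- a Bézout relation between `N / p` and `p` provides `M`, `a` and `c`
      obtain ⟨u, v, huv⟩ := isCoprime_of_not_dvd hp hq₁
      have hac : v * p - -u * ((N / p : ℕ) : ℤ) = 1 := by linear_combination huv
      have hM : u * ((N / p : ℕ) : ℤ) ≡ 1 [ZMOD p] :=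
        Int.modEq_iff_dvd.2 ⟨v, by linear_combination -huv⟩
      rcases hδ with rfl | rfl
      · refine exists_finsupp_of_isIntComb (fun f hf => isCuspForm_heckeOp hN
          (isSimilitude_deltaT hp) (isRepSystem_repT hN hp hq hq₁ (hunit hM) hac).1 hf)
          fun n r m => .congr ?_ fun f hf => fourierCoeff_deltaT hN hp hq hq₁ (hunit hM) hac hf rfl
        simp only [mul_assoc ((p : ℂ) ^ (k - 3))]
        exact ((((he _).add ((IsIntComb.sum _ fun x => he _).mul_left (hz (by lia)))).add
          ((IsIntComb.sum _ fun y => he _).mul_left (hz (by lia)))).add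
          ((he _).mul_left (hz (by lia)))).add (((he _).mul_left (hχ _)).mul_left (hz (by lia)))
      · refine exists_finsupp_of_isIntComb (fun f hf => isCuspForm_heckeOp hN
          (isSimilitude_deltaT0 hp) (isRepSystem_repT0 hN hp hq hq₁ (hunit hM) hac).1 hf)
          fun n r m => .congr ?_ fun f hf => fourierCoeff_deltaT0 hN hp hq hq₁ hM hac hf rfl
        exact ((((IsIntComb.sum _ fun x => he _).mul_left (hz (by lia))).add
          ((IsIntComb.sum _ fun y => he _).mul_left (hz (by lia)))).add
          ((IsIntComb.sum _ fun y => (he _).mul_left (hχ _)).mul_left (hz (by lia)))).add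
          ((IsIntComb.sum _ fun x => IsIntComb.sum _ fun y => (he _).mul_left (hχ _)).mul_left
            (hz (by lia)))
  · obtain ⟨hq, hq₁⟩ := hcofactor hpN hp2
    obtain ⟨n, r, m, -, -, -, ht⟩ := ht
    exact ⟨isCuspForm_heckeOp hN (isSimilitude_deltaT hp)
        (isRepSystem_repT hN hp hq hq₁ (hunit hM) hac).1 hf,
      isCuspForm_heckeOp hN (isSimilitude_deltaT0 hp)
        (isRepSystem_repT0 hN hp hq hq₁ (hunit hM) hac).1 hf,
      fourierCoeff_deltaT hN hp hq hq₁ (hunit hM) hac hf ht,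
      fourierCoeff_deltaT0 hN hp hq hq₁ hM hac hf ht⟩
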